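/- A control improvisation instance is a tuple $\mathcal{C} = (\mathcal{H}, \mathcal{S}, m, n, \epsilon, \lambda, \rho)$, where the hard specification $\mathcal{H}$ and the soft specification $\mathcal{S}$ represent languages $L(\mathcal{H}), L(\mathcal{S})$ over a common finite alphabet $\Sigma$, $m, n \in \mathbb{N}$, and $\epsilon, \lambda, \rho \in [0,1] \cap \mathbb{Q}$. Let $I = \{ w \in L(\mathcal{H}) : m \le |w| \le n \}$ and $A = I \cap L(\mathcal{S})$. A probability distribution $D$ on $\Sigma^*$ is an improvising distribution for $\mathcal{C}$ if $\Pr_{w \leftarrow D}[w \in I] = 1$, $\Pr_{w \leftarrow D}[w \in A] \ge 1 - \epsilon$, and $\lambda \le D(w) \le \rho$ for all $w \in I$; $\mathcal{C}$ is feasible if such a $D$ exists. An improviser for $\mathcal{C}$ is a probabilistic algorithm (using fair coin flips) with finite expected running time whose output distribution on empty input is an improvising distribution for $\mathcal{C}$. The size $|\mathcal{C}|$ is the total bit size of the parameters of $\mathcal{C}$, with $m, n$ written in unary and the other numerical parameters in binary. Running times are those of programs of a while-language over finite binary trees with natural numbers (in binary) at the leaves, with fair coin flips and logarithmic (bit-size)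 cost, a model that agrees with probabilistic Turing machines up to polynomial factors. Theorem. Consider the class of instances $\mathcal{C}$ in which $\mathcal{H}$ is an unambiguous context-free grammar (no word has two different derivation trees) and $\mathcal{S}$ is a deterministic finite automaton. There are a deterministic algorithm $S$ and polynomials $p, q$ such that for every $\mathcal{C}$ in this class: 1. if $\mathcal{C}$ is feasible, then $S(\mathcal{C})$ is (the code of) an improviser for $\mathcal{C}$, and otherwise $S(\mathcal{C}) = \bot$; 2. the running time of $S$ on $\mathcal{C}$ is at most $p(|\mathcal{C}|)$; 3. if $G = S(\mathcal{C}) \ne \bot$, then the expected running time of $G$ is at most $q(|\mathcal{C}|)$. -/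

import Mathlib

/-! ### Probabilistic algorithms with a running time

Data are binary trees whose leaves carry natural numbers written in binary.  Algorithms are programs
of a while-language over such data, with fair coin flips and logarithmic cost: a basic operation is
charged for the bit sizes of its argument and its result (multiplication and division are charged
quadratically), so that running times agree with those of (probabilistic) Turing machines up to
a polynomial. -/

namespace CI

/-- Data handled by algorithms: binary trees with natural numbers at the leaves. -/
inductive Val : Type
  | nat (n : ℕ)
  | pair (a b : Val)
  deriving DecidableEq

namespace Val

/-- Bit size of the data; a number `n` is written in binary (`Nat.size n` bits). -/
def size : Val → ℕ
  | nat n => Nat.size n + 1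
  | pair a b => a.size + b.size + 1

/-- First component (and `0` on a number). -/
def fst : Val → Val
  | nat _ => nat 0
  | pair a _ => a

/-- Second component (and `0` on a number). -/
def snd : Val → Val
  | nat _ => nat 0
  | pair _ b => b

/-- The number at a leaf (and `0` on a pair). -/
def toNat : Val → ℕ
  | nat n => n
  | pair _ _ => 0

/-- Lists as data: the empty list is `0`, and `a :: l` is a pair. -/
def ofList : List Val → Val
  | [] => nat 0
  | a :: l => pair a (ofList l)

/-- A natural number in unary: a list of `n` zeros. -/
def unary (n : ℕ) : Val := ofList (List.replicate n (nat 0))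

/-- A non-negative rational number, as numerator and denominator in binary. -/
def ofRat (x : ℚ) : Val := pair (nat x.num.natAbs) (nat x.den)

/-- The finite set `{0, …, k - 1}`, given as the list of its elements. -/
def ofFin (k : ℕ) : Val := ofList ((List.range k).map nat)

end Val

/-- Basic operations. The arithmetical ones act on a pair of numbers; `sub` is truncated
subtraction and `div` is integer division. -/
inductive Prim : Type
  | id
  | const (v : Val)
  | fst
  | snd
  | add
  | sub
  | mul
  | div
  deriving DecidableEq

namespace Prim

/-- The result of a basic operation. -/
def apply : Prim → Val → Val
  | id, x => x
  | const v, _ => v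
  | fst, x => x.fst
  | snd, x => x.snd
  | add, x => .nat (x.fst.toNat + x.snd.toNat)
  | sub, x => .nat (x.fst.toNat - x.snd.toNat)
  | mul, x => .nat (x.fst.toNat * x.snd.toNat)
  | div, x => .nat (x.fst.toNat / x.snd.toNat)

/-- The cost of a basic operation on the argument `x`. -/
def cost : Prim → Val → ℕ
  | mul, x => x.size * x.size + (mul.apply x).size
  | div, x => x.size * x.size + (div.apply x).size
  | p, x => x.size + (p.apply x).size

/-- Basic operations as data. -/
def encode : Prim → Val
  | id => .pair (.nat 0) (.nat 0)
  | const v => .pair (.nat 1) v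
  | fst => .pair (.nat 2) (.nat 0)
  | snd => .pair (.nat 3) (.nat 0)
  | add => .pair (.nat 4) (.nat 0)
  | sub => .pair (.nat 5) (.nat 0)
  | mul => .pair (.nat 6) (.nat 0)
  | div => .pair (.nat 7) (.nat 0)

end Prim

/-- Programs. On the argument `x`,
* `flip` returns a fair random bit;
* `comp f g` returns `f (g x)`;
* `pair f g` returns `(f x, g x)`;
* `cond c f g` returns `f x` if `c x ≠ 0`, and `g x` otherwise;
* `loop c f` is `while c x ≠ 0 do x := f x; return x`. -/
inductive Code : Type
  | prim (p : Prim)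
  | flip
  | comp (f g : Code)
  | pair (f g : Code)
  | cond (c f g : Code)
  | loop (c f : Code)
  deriving DecidableEq

/-- `Run c x b y t`: on the argument `x`, if the coin flips turn out to be `b` (exactly these, in this
order, are used), the program `c` halts with result `y` and running time `t`. -/
inductive Run : Code → Val → List Bool → Val → ℕ → Prop
  | prim (p : Prim) (x : Val) : Run (.prim p) x [] (p.apply x) (p.cost x)
  | flip (x : Val) (b : Bool) :
      Run .flip x [b] (.nat b.toNat) (x.size + (Val.nat b.toNat).size)
  | comp {f g : Code} {x y z : Val} {b₁ b₂ : List Bool} {t₁ t₂ : ℕ} :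
      Run g x b₁ y t₁ → Run f y b₂ z t₂ → Run (.comp f g) x (b₁ ++ b₂) z (t₁ + t₂ + 1)
  | pair {f g : Code} {x y z : Val} {b₁ b₂ : List Bool} {t₁ t₂ : ℕ} :
      Run f x b₁ y t₁ → Run g x b₂ z t₂ → Run (.pair f g) x (b₁ ++ b₂) (.pair y z) (t₁ + t₂ + 1)
  | cond_true {c f g : Code} {x v y : Val} {b₁ b₂ : List Bool} {t₁ t₂ : ℕ} :
      Run c x b₁ v t₁ → v ≠ .nat 0 → Run f x b₂ y t₂ →
        Run (.cond c f g) x (b₁ ++ b₂) y (t₁ + t₂ + 1)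
  | cond_false {c f g : Code} {x y : Val} {b₁ b₂ : List Bool} {t₁ t₂ : ℕ} :
      Run c x b₁ (.nat 0) t₁ → Run g x b₂ y t₂ →
        Run (.cond c f g) x (b₁ ++ b₂) y (t₁ + t₂ + 1)
  | loop_done {c f : Code} {x : Val} {b : List Bool} {t : ℕ} :
      Run c x b (.nat 0) t → Run (.loop c f) x b x (t + 1)
  | loop_step {c f : Code} {x v y z : Val} {b₁ b₂ b₃ : List Bool} {t₁ t₂ t₃ : ℕ} :
      Run c x b₁ v t₁ → v ≠ .nat 0 → Run f x b₂ y t₂ → Run (.loop c f) y b₃ z t₃ →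
        Run (.loop c f) x (b₁ ++ (b₂ ++ b₃)) z (t₁ + t₂ + t₃ + 1)

/-- The coin flips determine the run. In particular the coin sequences of distinct halting runs on
the same argument are pairwise incomparable, so that the probabilities below are well-defined. -/
theorem Run.deterministic {c : Code} {x y y' : Val} {b b' r r' : List Bool} {t t' : ℕ}
    (h : Run c x b y t) (h' : Run c x b' y' t') (hb : b ++ r = b' ++ r') :
    b = b' ∧ y = y' ∧ t = t' := by
  induction h generalizing y' b' r r' t' with
  | prim p x => cases h'; simp
  | flip x b => cases h'; simp at hb; simp [hb.1]
  | comp _ _ ih₁ ih₂ =>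
    cases h' with
    | comp h₁ h₂ =>
      simp only [List.append_assoc] at hb
      obtain ⟨rfl, rfl, rfl⟩ := ih₁ h₁ hb
      obtain ⟨rfl, rfl, rfl⟩ := ih₂ h₂ (List.append_cancel_left hb)
      simp
  | pair _ _ ih₁ ih₂ =>
    cases h' with
    | pair h₁ h₂ =>
      simp only [List.append_assoc] at hb
      obtain ⟨rfl, rfl, rfl⟩ := ih₁ h₁ hb
      obtain ⟨rfl, rfl, rfl⟩ := ih₂ h₂ (List.append_cancel_left hb)
      simp
  | cond_true _ hv _ ih₁ ih₂ =>
    cases h' with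
    | cond_true h₁ _ h₂ =>
      simp only [List.append_assoc] at hb
      obtain ⟨rfl, rfl, rfl⟩ := ih₁ h₁ hb
      obtain ⟨rfl, rfl, rfl⟩ := ih₂ h₂ (List.append_cancel_left hb)
      simp
    | cond_false h₁ h₂ =>
      simp only [List.append_assoc] at hb
      exact absurd (ih₁ h₁ hb).2.1 hv
  | cond_false _ _ ih₁ ih₂ =>
    cases h' with
    | cond_true h₁ hv h₂ =>
      simp only [List.append_assoc] at hb
      exact absurd (ih₁ h₁ hb).2.1.symm hv
    | cond_false h₁ h₂ =>
      simp only [List.append_assoc] at hb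
      obtain ⟨rfl, -, rfl⟩ := ih₁ h₁ hb
      obtain ⟨rfl, rfl, rfl⟩ := ih₂ h₂ (List.append_cancel_left hb)
      simp
  | loop_done _ ih₁ =>
    cases h' with
    | loop_done h₁ =>
      obtain ⟨rfl, -, rfl⟩ := ih₁ h₁ hb
      simp
    | loop_step h₁ hv h₂ h₃ =>
      simp only [List.append_assoc] at hb
      exact absurd (ih₁ h₁ hb).2.1.symm hv
  | loop_step _ hv _ _ ih₁ ih₂ ih₃ =>
    cases h' with
    | loop_done h₁ =>
      simp only [List.append_assoc] at hb
      exact absurd (ih₁ h₁ hb).2.1 hv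
    | loop_step h₁ _ h₂ h₃ =>
      simp only [List.append_assoc] at hb
      obtain ⟨rfl, rfl, rfl⟩ := ih₁ h₁ hb
      obtain ⟨rfl, rfl, rfl⟩ := ih₂ h₂ (List.append_cancel_left hb)
      obtain ⟨rfl, rfl, rfl⟩ := ih₃ h₃ (List.append_cancel_left (List.append_cancel_left hb))
      simp

namespace Code

/-- Programs as data (always a pair, hence different from `0`). -/
def encode : Code → Val
  | prim p => .pair (.nat 0) p.encode
  | flip => .pair (.nat 1) (.nat 0)
  | comp f g => .pair (.nat 2) (.pair f.encode g.encode)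
  | pair f g => .pair (.nat 3) (.pair f.encode g.encode)
  | cond c f g => .pair (.nat 4) (.pair c.encode (.pair f.encode g.encode))
  | loop c f => .pair (.nat 5) (.pair c.encode f.encode)

/-- A program can be recovered from its encoding. -/
theorem encode_injective : Function.Injective encode := by
  intro c
  induction c with
  | prim p =>
    intro d h
    cases d with
    | prim p' => cases p <;> cases p' <;> simp_all [encode, Prim.encode]
    | _ => simp [encode] at h
  | flip => intro d h; cases d <;> simp [encode] at h ⊢
  | comp f g ihf ihg =>
    intro d h
    cases d with
    | comp f' g' => simp only [encode, Val.pair.injEq] at h; rw [ihf h.2.1, ihg h.2.2]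
    | _ => simp [encode] at h
  | pair f g ihf ihg =>
    intro d h
    cases d with
    | pair f' g' => simp only [encode, Val.pair.injEq] at h; rw [ihf h.2.1, ihg h.2.2]
    | _ => simp [encode] at h
  | cond c f g ihc ihf ihg =>
    intro d h
    cases d with
    | cond c' f' g' =>
      simp only [encode, Val.pair.injEq] at h; rw [ihc h.2.1, ihf h.2.2.1, ihg h.2.2.2]
    | _ => simp [encode] at h
  | loop c f ihc ihf =>
    intro d h
    cases d with
    | loop c' f' => simp only [encode, Val.pair.injEq] at h; rw [ihc h.2.1, ihf h.2.2]
    | _ => simp [encode] at h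

/-- The halting runs of `c` on the argument `x`: coin flips, result, running time. -/
abbrev HaltingRun (c : Code) (x : Val) : Type :=
  {r : List Bool × Val × ℕ // Run c x r.1 r.2.1 r.2.2}

open scoped ENNReal in
/-- The probability of a halting run: every coin flip has probability `1/2`. -/
noncomputable def HaltingRun.prob {c : Code} {x : Val} (r : c.HaltingRun x) : ℝ≥0∞ :=
  2⁻¹ ^ r.1.1.length

open scoped ENNReal in
/-- The probability that `c` halts on `x`. -/
noncomputable def haltProb (c : Code) (x : Val) : ℝ≥0∞ := ∑' r : c.HaltingRun x, r.prob

open scoped ENNReal Classical in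
/-- The probability that `c` halts on `x` with result `y`. -/
noncomputable def outProb (c : Code) (x y : Val) : ℝ≥0∞ :=
  ∑' r : c.HaltingRun x, if r.1.2.1 = y then r.prob else 0

open scoped ENNReal in
/-- The expected running time of `c` on `x`; the running time of a run that does not halt is `∞`. -/
noncomputable def expectedTime (c : Code) (x : Val) : ℝ≥0∞ :=
  (∑' r : c.HaltingRun x, r.prob * (r.1.2.2 : ℝ≥0∞)) + ∞ * (1 - c.haltProb x)

/-- The program `c`, run as a deterministic algorithm (no coin is flipped), maps `x` to `y` in
time `t`. -/
def RunsDet (c : Code) (x y : Val) (t : ℕ) : Prop := Run c x [] y t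

end Code

/-! ### Specifications -/

/-- Ordered forests of derivation trees, for words over `T` and nonterminals in `N`: an inner node is
labelled by the rule applied there, and `rest` is what stands to the right of the first tree. -/
inductive Forest (T N : Type) : Type
  | nil
  | leaf (a : T) (rest : Forest T N)
  | node (r : ContextFreeRule T N) (children rest : Forest T N)

namespace Forest

variable {T N : Type}

/-- The labels of the roots, from left to right. -/
def roots : Forest T N → List (Symbol T N)
  | nil => []
  | leaf a rest => .terminal a :: rest.roots
  | node r _ rest => .nonterminal r.input :: rest.roots

/-- The word spelled out by the leaves, from left to right. -/
def yield : Forest T N → List T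
  | nil => []
  | leaf a rest => a :: rest.yield
  | node _ children rest => children.yield ++ rest.yield

/-- Every inner node is labelled by one of the given rules, and its children are labelled by the
right-hand side of that rule. -/
def Valid (rules : Finset (ContextFreeRule T N)) : Forest T N → Prop
  | nil => True
  | leaf _ rest => rest.Valid rules
  | node r children rest =>
      r ∈ rules ∧ children.roots = r.output ∧ children.Valid rules ∧ rest.Valid rules

end Forest

/-- `F` is a derivation tree of the grammar `g` for the word `w`: a single tree, whose root is
labelled by the initial nonterminal and whose leaves spell out `w`. -/
def IsDerivationTree {T : Type} (g : ContextFreeGrammar T) (F : Forest T g.NT) (w : List T) : Prop :=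
  F.roots = [.nonterminal g.initial] ∧ F.Valid g.rules ∧ F.yield = w

/-- A grammar is unambiguous if no word has two different derivation trees. -/
def Unambiguous {T : Type} (g : ContextFreeGrammar T) : Prop :=
  ∀ (w : List T) (F F' : Forest T g.NT),
    IsDerivationTree g F w → IsDerivationTree g F' w → F = F'

/-- A finitely presented context-free grammar over the alphabet `Fin k`: the nonterminals are
`0, …, numNT - 1` and the set of rules is given by a list. -/
structure CFG (k : ℕ) where
  numNT : ℕ
  initial : Fin numNT
  rules : List (ContextFreeRule (Fin k) (Fin numNT))

namespace CFG

variable {k : ℕ}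

/-- The underlying context-free grammar. -/
abbrev toGrammar (g : CFG k) : ContextFreeGrammar (Fin k) where
  NT := Fin g.numNT
  initial := g.initial
  rules := g.rules.toFinset

/-- A symbol as data: a tag (`0` for terminals) and a number in binary. -/
def encodeSymbol {v : ℕ} : Symbol (Fin k) (Fin v) → Val
  | .terminal a => .pair (.nat 0) (.nat a)
  | .nonterminal A => .pair (.nat 1) (.nat A)

/-- A rule as data. -/
def encodeRule {v : ℕ} (r : ContextFreeRule (Fin k) (Fin v)) : Val :=
  .pair (.nat r.input) (.ofList (r.output.map encodeSymbol))

/-- A grammar as data: the nonterminals, the initial one, and the rules. -/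
def encode (g : CFG k) : Val :=
  .ofList [.ofFin g.numNT, .nat g.initial, .ofList (g.rules.map encodeRule)]

end CFG

open scoped Classical in
/-- A deterministic finite automaton as data: the list of the states, the initial state, the table
of the transition function and the table of the accepting states. -/
noncomputable def encodeDFA {k q : ℕ} (M : DFA (Fin k) (Fin q)) : Val :=
  .ofList [.ofFin q, .nat M.start,
    .ofList ((List.finRange q).map fun s =>
      .ofList ((List.finRange k).map fun a => .nat (M.step s a))),
    .ofList ((List.finRange q).map fun s => .nat (if s ∈ M.accept then 1 else 0))]

/-- A class of specifications: finite representations of languages over finite alphabets `Fin k`,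
with the way in which they are written down as data. -/
structure SpecClass where
  Spec : ℕ → Type
  language : {k : ℕ} → Spec k → Language (Fin k)
  encode : {k : ℕ} → Spec k → Val

/-- The class of unambiguous context-free grammars. -/
def UCFG : SpecClass where
  Spec k := {g : CFG k // Unambiguous g.toGrammar}
  language g := g.1.toGrammar.language
  encode g := g.1.encode

/-- The class of deterministic finite automata. -/
noncomputable def DFAs : SpecClass where
  Spec k := (q : ℕ) × DFA (Fin k) (Fin q)
  language M := M.2.accepts
  encode M := encodeDFA M.2

/-! ### Control improvisation -/

/-- A control improvisation instance with hard specification in `H` and soft specification in `S`. -/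
structure Instance (H S : SpecClass) where
  /-- the size of the common alphabet -/
  alphabet : ℕ
  hard : H.Spec alphabet
  soft : S.Spec alphabet
  m : ℕ
  n : ℕ
  /-- the error probability -/
  ε : ℚ
  /-- the lower and the upper bound on the probability of an improvisation -/
  lo : ℚ
  hi : ℚ
  ε_mem : ε ∈ Set.Icc (0 : ℚ) 1
  lo_mem : lo ∈ Set.Icc (0 : ℚ) 1
  hi_mem : hi ∈ Set.Icc (0 : ℚ) 1

namespace Instance

variable {H S : SpecClass}

/-- The instance as data; `m` and `n` are in unary, the rational parameters in binary. -/
def encode (C : Instance H S) : Val :=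
  .ofList [.ofFin C.alphabet, H.encode C.hard, S.encode C.soft, .unary C.m, .unary C.n,
    .ofRat C.ε, .ofRat C.lo, .ofRat C.hi]

/-- The size of an instance. -/
def size (C : Instance H S) : ℕ := C.encode.size

/-- Words over the alphabet of the instance. -/
abbrev Word (C : Instance H S) : Type := List (Fin C.alphabet)

/-- A word as data. -/
def encodeWord (C : Instance H S) (w : C.Word) : Val := .ofList (w.map fun a => .nat a)

/-- The improvisations. -/
def improvisations (C : Instance H S) : Set C.Word :=
  {w | w ∈ H.language C.hard ∧ C.m ≤ w.length ∧ w.length ≤ C.n}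

/-- The admissible improvisations. -/
def admissible (C : Instance H S) : Set C.Word :=
  {w | w ∈ C.improvisations ∧ w ∈ S.language C.soft}

/-- `D` is an improvising distribution: hard constraint, soft constraint and randomness. -/
structure IsImprovising (C : Instance H S) (D : PMF C.Word) : Prop where
  hard_constraint : D.toOuterMeasure C.improvisations = 1
  soft_constraint : (1 - C.ε : ℝ) ≤ (D.toOuterMeasure C.admissible).toReal
  randomness : ∀ w ∈ C.improvisations, (C.lo : ℝ) ≤ (D w).toReal ∧ (D w).toReal ≤ (C.hi : ℝ)

/-- The instance has an improvising distribution. -/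
def Feasible (C : Instance H S) : Prop := ∃ D : PMF C.Word, C.IsImprovising D

/-- `G` is an improviser: its expected running time (on the empty input) is finite, and its output
distribution is an improvising distribution. -/
def IsImproviser (C : Instance H S) (G : Code) : Prop :=
  G.expectedTime (.nat 0) < ⊤ ∧
    ∃ D : PMF C.Word, C.IsImprovising D ∧ ∀ w, G.outProb (.nat 0) (C.encodeWord w) = D w

end Instance

/-- The (deterministic) algorithm `A` is a polynomial-time improvisation scheme for the class of
instances with hard specification in `H` and soft specification in `S`. The value `0`, which is not
the encoding of a program, stands for `⊥`. -/
structure IsPolyTimeScheme (H S : SpecClass) (A : Code) : Prop where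
  /-- on a feasible instance the algorithm outputs an improviser -/
  correct_of_feasible : ∀ C : Instance H S, C.Feasible →
    ∃ (G : Code) (t : ℕ), A.RunsDet C.encode G.encode t ∧ C.IsImproviser G
  /-- on an infeasible instance the algorithm outputs `⊥` -/
  correct_of_not_feasible : ∀ C : Instance H S, ¬ C.Feasible →
    ∃ t : ℕ, A.RunsDet C.encode (.nat 0) t
  /-- the algorithm runs in polynomial time -/
  scheme_efficiency : ∃ p : Polynomial ℕ, ∀ (C : Instance H S) (y : Val) (t : ℕ),
    A.RunsDet C.encode y t → t ≤ p.eval C.size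
  /-- the improvisers that it outputs run in expected polynomial time -/
  improviser_efficiency : ∃ q : Polynomial ℕ, ∀ (C : Instance H S) (G : Code) (t : ℕ),
    A.RunsDet C.encode G.encode t → G.expectedTime (.nat 0) ≤ (q.eval C.size : ℕ)

end CI

/-!
Let `a` and `b` be the numbers of improvisations that the automaton accepts and rejects. An
improvising distribution exists if and only if `1 ≤ hi * (a + b)`, `lo * (a + b) ≤ 1`,
`1 - ε ≤ hi * a` and `lo * b ≤ ε`: the inequalities follow by summing the values of a distribution
(`Inst.bounds_of_feasible`), and if they hold, one may choose an accepted improvisation uniformly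
with probability `min (hi * a) (1 - lo * b)`, and a rejected one uniformly otherwise
(`Inst.isImprovising_distribution`). It remains to count improvisations and to sample uniformly in
polynomial time.

Counting. The words of length at most `n` that have a given prefix and are accepted (rejected) by
the given automaton are recognized by a deterministic automaton whose states are pairs of a position and
a state. In an unambiguous grammar, words correspond to derivation trees, so the improvisations can
be counted by counting derivation trees along the runs of this automaton
(`Inst.countWords_eq`). The numbers of forests of height at most `d` whose roots spell a suffix of a
right-hand side, between two states, satisfy a recursion in `d` (`count_eq_sum_forests`). Forests
for other suffixes may be numerous, or infinitely many, but only the final result matters, which is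
less than `(k + 1) ^ n + 1`; so all numbers are computed modulo this number, which keeps them short.
The height can be bounded by the number of pairs of a suffix and a factor of the word: the set of
pairs that are derived by forests of height at most `d` grows with `d`, and once it does not grow it
is constant (`exists_forest_height_le`). By unambiguity the tree of small height is the only one.

Sampling. The numbers of words with given prefixes determine the word with a given index, letter by
letter (`exists_unrank_eq`). A random number below `M` is obtained from blocks of coin flips by
rejection; a block is rejected with probability at most `1/2`, so that the expected running time is
at most a constant times the time for a block (`IsRejectionSampler.expectedTime_le`,
`exists_rejectionSampler`). The improviser is the sampler applied to the instance as a constant.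

Running times. `PolyTime f` says that a program computes `f` on encoded data in polynomial time.
This class of functions is closed under composition, pairing, case distinction, arithmetic and
folds over lists in which the intermediate results stay short (`PolyTime.foldl`); every algorithm
is written with these operations, and `fun_prop` proves that it is polynomial.
-/


namespace CI

/-! ### Polynomial-time functions -/

theorem Val.one_le_size (x : Val) : 1 ≤ x.size := by
  cases x <;> simp [Val.size]

/-- A run reads its whole argument, since every basic operation is charged for its argument. -/
theorem Run.size_arg_le {c : Code} {x y : Val} {b : List Bool} {t : ℕ} (h : Run c x b y t) :
    x.size ≤ t := by
  induction h with
  | prim p x => cases p <;> simp only [Prim.cost] <;> nlinarith [Val.one_le_size x]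
  | _ => omega

theorem Run.size_result_le {c : Code} {x y : Val} {b : List Bool} {t : ℕ} (h : Run c x b y t) :
    y.size ≤ t := by
  induction h with
  | prim p x => cases p <;> simp [Prim.cost]
  | flip x b => omega
  | loop_done h => have := h.size_arg_le; omega
  | pair => simp only [Val.size]; omega
  | _ => omega

/-- Types whose elements are written down as data. No injectivity is required. -/
class Enc (α : Type) where
  /-- the data representing an element -/
  enc : α → Val

open Enc

instance : Enc Val := ⟨id⟩
instance : Enc Unit := ⟨fun _ => .nat 0⟩
instance : Enc ℕ := ⟨.nat⟩
instance : Enc Bool := ⟨fun b => .nat b.toNat⟩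
instance {α β : Type} [Enc α] [Enc β] : Enc (α × β) := ⟨fun p => .pair (enc p.1) (enc p.2)⟩
instance {α : Type} [Enc α] : Enc (List α) := ⟨fun l => .ofList (l.map enc)⟩

/-- The bit size of the data representing an element. -/
def sz {α : Type} [Enc α] (a : α) : ℕ := (enc a).size

section sz
variable {α β : Type} [Enc α] [Enc β]

theorem enc_pair (a : α) (b : β) : enc (a, b) = Val.pair (enc a) (enc b) := rfl
theorem enc_nil : enc ([] : List α) = Val.nat 0 := rfl
theorem enc_cons (a : α) (l : List α) : enc (a :: l) = Val.pair (enc a) (enc l) := rfl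
theorem sz_nat (n : ℕ) : sz n = Nat.size n + 1 := rfl
theorem sz_pair (a : α) (b : β) : sz (a, b) = sz a + sz b + 1 := rfl
theorem sz_nil : sz ([] : List α) = 1 := by simp [sz, enc_nil, Val.size]
theorem sz_cons (a : α) (l : List α) : sz (a :: l) = sz a + sz l + 1 := rfl
theorem one_le_sz (a : α) : 1 ≤ sz a := Val.one_le_size _

theorem sz_bool (b : Bool) : sz b ≤ 2 := by cases b <;> decide

theorem sz_nat_mono {m n : ℕ} (h : m ≤ n) : sz m ≤ sz n := by
  simpa [sz_nat] using Nat.size_le_size h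

theorem sz_append (l₁ l₂ : List α) : sz (l₁ ++ l₂) + 1 = sz l₁ + sz l₂ := by
  induction l₁ with
  | nil => simp [sz_nil]; omega
  | cons a l ih => simp only [List.cons_append, sz_cons]; omega

theorem sz_reverse (l : List α) : sz l.reverse = sz l := by
  induction l with
  | nil => rfl
  | cons a l ih =>
    have := sz_append l.reverse [a]
    simp only [List.reverse_cons, sz_cons, sz_nil] at *; omega

theorem sz_mem {a : α} {l : List α} (h : a ∈ l) : sz a < sz l := by
  induction l with
  | nil => simp at h
  | cons b l ih =>
    rw [sz_cons]
    rcases List.mem_cons.1 h with rfl | h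
    · omega
    · have := ih h; omega

theorem length_lt_sz (l : List α) : l.length < sz l := by
  induction l with
  | nil => simp [sz_nil]
  | cons a l ih => rw [sz_cons, List.length_cons]; omega

theorem sz_le_of_forall {l : List α} {B : ℕ} (h : ∀ a ∈ l, sz a ≤ B) :
    sz l ≤ l.length * (B + 1) + 1 := by
  induction l with
  | nil => simp [sz_nil]
  | cons a l ih =>
    have h₁ := ih fun a ha => h a (List.mem_cons_of_mem _ ha)
    have h₂ := h a List.mem_cons_self
    rw [sz_cons, List.length_cons, Nat.succ_mul]; omega

theorem sz_take_le (l : List α) (i : ℕ) : sz (l.take i) ≤ sz l := by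
  have := sz_append (l.take i) (l.drop i)
  rw [List.take_append_drop] at this
  have := one_le_sz (l.drop i); omega

theorem sz_prefix_le {l l' : List α} (h : l' <+: l) : sz l' ≤ sz l := by
  rw [List.prefix_iff_eq_take.1 h]; exact sz_take_le _ _

theorem natSize_add_le (a b : ℕ) : Nat.size (a + b) ≤ Nat.size a + Nat.size b := by
  rcases Nat.eq_zero_or_pos a with rfl | ha
  · simp
  rcases Nat.eq_zero_or_pos b with rfl | hb
  · simp
  have h₁ := Nat.lt_size_self a
  have h₂ := Nat.lt_size_self b
  have h₃ : 1 ≤ Nat.size a := Nat.size_pos.2 ha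
  have h₄ : 1 ≤ Nat.size b := Nat.size_pos.2 hb
  rw [Nat.size_le, pow_add]
  nlinarith

theorem natSize_mul_le (a b : ℕ) : Nat.size (a * b) ≤ Nat.size a + Nat.size b := by
  have h₁ := Nat.lt_size_self a
  have h₂ := Nat.lt_size_self b
  rw [Nat.size_le, pow_add]
  exact Nat.mul_lt_mul'' h₁ h₂

end sz

/-- A numerical function that is bounded by a polynomial in the size of its argument. -/
def PolyBdd {α : Type} [Enc α] (g : α → ℕ) : Prop :=
  ∃ p : Polynomial ℕ, ∀ a, g a ≤ p.eval (sz a)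

theorem polynomial_eval_mono (p : Polynomial ℕ) {m n : ℕ} (h : m ≤ n) :
    p.eval m ≤ p.eval n := by
  rw [Polynomial.eval_eq_sum, Polynomial.eval_eq_sum]
  exact Finset.sum_le_sum fun i _ => Nat.mul_le_mul_left _ (Nat.pow_le_pow_left h i)

namespace PolyBdd
variable {α β : Type} [Enc α] [Enc β] {f g : α → ℕ}

theorem mono (hg : PolyBdd g) (h : ∀ a, f a ≤ g a) : PolyBdd f :=
  let ⟨p, hp⟩ := hg
  ⟨p, fun a => (h a).trans (hp a)⟩

theorem const (n : ℕ) : PolyBdd (fun _ : α => n) := ⟨Polynomial.C n, fun _ => by simp⟩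

theorem size : PolyBdd (fun a : α => sz a) := ⟨Polynomial.X, fun _ => by simp⟩

theorem add (hf : PolyBdd f) (hg : PolyBdd g) : PolyBdd (fun a => f a + g a) := by
  obtain ⟨p, hp⟩ := hf
  obtain ⟨q, hq⟩ := hg
  exact ⟨p + q, fun a => by rw [Polynomial.eval_add]; exact add_le_add (hp a) (hq a)⟩

theorem mul (hf : PolyBdd f) (hg : PolyBdd g) : PolyBdd (fun a => f a * g a) := by
  obtain ⟨p, hp⟩ := hf
  obtain ⟨q, hq⟩ := hg
  exact ⟨p * q, fun a => by rw [Polynomial.eval_mul]; exact mul_le_mul' (hp a) (hq a)⟩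

theorem comp {g : β → ℕ} {f : α → β} (hg : PolyBdd g) (hf : PolyBdd fun a => sz (f a)) :
    PolyBdd (fun a => g (f a)) := by
  obtain ⟨p, hp⟩ := hg
  obtain ⟨q, hq⟩ := hf
  exact ⟨p.comp q, fun a => by
    rw [Polynomial.eval_comp]; exact (hp _).trans (polynomial_eval_mono p (hq a))⟩

/-- The composition of a polynomial with a polynomially bounded function. -/
theorem eval (p : Polynomial ℕ) (hg : PolyBdd g) : PolyBdd (fun a => p.eval (g a)) := by
  obtain ⟨q, hq⟩ := hg
  exact ⟨p.comp q, fun a => by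
    rw [Polynomial.eval_comp]; exact polynomial_eval_mono p (hq a)⟩

end PolyBdd

/-- Functions computed by a program without coin flips in polynomial time. -/
@[fun_prop]
def PolyTime {α β : Type} [Enc α] [Enc β] (f : α → β) : Prop :=
  ∃ (c : Code) (g : α → ℕ), PolyBdd g ∧ ∀ a, ∃ t, t ≤ g a ∧ Run c (enc a) [] (enc (f a)) t

theorem Val.size_toNat_lt (x : Val) : Nat.size x.toNat < x.size := by
  cases x <;> simp [Val.toNat, Val.size]

theorem Val.size_fst_le (x : Val) : x.fst.size ≤ x.size := by
  cases x <;> simp [Val.fst, Val.size]; omega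

theorem Val.size_snd_le (x : Val) : x.snd.size ≤ x.size := by
  cases x <;> simp [Val.snd, Val.size]; omega

theorem Val.size_toNat_fst_add_snd (x : Val) :
    Nat.size x.fst.toNat + Nat.size x.snd.toNat + 1 ≤ x.size := by
  cases x with
  | nat n => simp [Val.fst, Val.snd, Val.toNat, Val.size]
  | pair a b =>
    have := a.size_toNat_lt
    have := b.size_toNat_lt
    simp only [Val.fst, Val.snd, Val.size]; omega

theorem Prim.size_apply_le (p : Prim) : ∃ k, ∀ x, (p.apply x).size ≤ x.size + k := by
  refine ⟨(p.apply (.nat 0)).size + 1, fun x => ?_⟩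
  have h := x.size_toNat_fst_add_snd
  cases p with
  | id => simp only [Prim.apply]; omega
  | const v => simp only [Prim.apply]; omega
  | fst => have := x.size_fst_le; simp only [Prim.apply]; omega
  | snd => have := x.size_snd_le; simp only [Prim.apply]; omega
  | add =>
    have := natSize_add_le x.fst.toNat x.snd.toNat
    simp only [Prim.apply, Val.size]; omega
  | sub =>
    have := Nat.size_le_size (Nat.sub_le x.fst.toNat x.snd.toNat)
    simp only [Prim.apply, Val.size]; omega
  | mul =>
    have := natSize_mul_le x.fst.toNat x.snd.toNat
    simp only [Prim.apply, Val.size]; omega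
  | div =>
    have := Nat.size_le_size (Nat.div_le_self x.fst.toNat x.snd.toNat)
    simp only [Prim.apply, Val.size]; omega

theorem Prim.cost_le (p : Prim) : ∃ q : Polynomial ℕ, ∀ x, p.cost x ≤ q.eval x.size := by
  obtain ⟨k, hk⟩ := p.size_apply_le
  refine ⟨Polynomial.X * Polynomial.X + Polynomial.X + Polynomial.C k, fun x => ?_⟩
  have h := hk x
  have h₁ : x.size ≤ x.size * x.size := Nat.le_mul_self _
  simp only [Polynomial.eval_add, Polynomial.eval_mul, Polynomial.eval_X, Polynomial.eval_C]
  cases p <;> simp only [Prim.cost] <;> omega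

namespace PolyTime
variable {α β γ σ : Type} [Enc α] [Enc β] [Enc γ] [Enc σ]

/-- The result of a run is not longer than its running time; so sizes of results can be bounded by
polynomials without further work. -/
theorem polyBdd_size {f : α → β} (hf : PolyTime f) : PolyBdd (fun a => sz (f a)) := by
  obtain ⟨c, g, hg, h⟩ := hf
  refine hg.mono fun a => ?_
  obtain ⟨t, ht, hr⟩ := h a
  exact hr.size_result_le.trans ht

theorem of_prim (p : Prim) {f : α → β} (h : ∀ a, enc (f a) = p.apply (enc a)) : PolyTime f := by
  obtain ⟨q, hq⟩ := p.cost_le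
  exact ⟨.prim p, fun a => p.cost (enc a), ⟨q, fun a => hq _⟩, fun a =>
    ⟨_, le_rfl, by rw [h]; exact .prim p _⟩⟩

@[fun_prop] theorem id : PolyTime (fun x : α => x) := of_prim .id fun _ => rfl

@[fun_prop] theorem const (b : β) : PolyTime (fun _ : α => b) :=
  of_prim (.const (enc b)) fun _ => rfl

@[fun_prop] theorem fst : PolyTime (Prod.fst : α × β → α) := of_prim .fst fun _ => rfl

@[fun_prop] theorem snd : PolyTime (Prod.snd : α × β → β) := of_prim .snd fun _ => rfl

@[fun_prop] theorem comp {f : β → γ} {g : α → β} (hf : PolyTime f) (hg : PolyTime g) :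
    PolyTime (fun x => f (g x)) := by
  have hs := hg.polyBdd_size
  obtain ⟨c, u, hu, h⟩ := hf
  obtain ⟨d, v, hv, k⟩ := hg
  refine ⟨.comp c d, fun a => v a + u (g a) + 1, (hv.add (hu.comp hs)).add (.const 1), fun a => ?_⟩
  obtain ⟨t₁, ht₁, r₁⟩ := k a
  obtain ⟨t₂, ht₂, r₂⟩ := h (g a)
  exact ⟨t₁ + t₂ + 1, by dsimp only; omega, .comp r₁ r₂⟩

@[fun_prop] theorem prodMk {f : γ → α} {g : γ → β} (hf : PolyTime f) (hg : PolyTime g) :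
    PolyTime (fun x => (f x, g x)) := by
  obtain ⟨c, u, hu, h⟩ := hf
  obtain ⟨d, v, hv, k⟩ := hg
  refine ⟨.pair c d, fun a => u a + v a + 1, (hu.add hv).add (.const 1), fun a => ?_⟩
  obtain ⟨t₁, ht₁, r₁⟩ := h a
  obtain ⟨t₂, ht₂, r₂⟩ := k a
  exact ⟨t₁ + t₂ + 1, by dsimp only; omega, .pair r₁ r₂⟩

theorem fst' {f : γ → α × β} (hf : PolyTime f) : PolyTime fun x => (f x).1 := fst.comp hf

theorem snd' {f : γ → α × β} (hf : PolyTime f) : PolyTime fun x => (f x).2 := snd.comp hf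

/-- A function with the same data as a polynomial-time function. -/
theorem of_enc_eq {f : γ → α} {g : γ → β} (hf : PolyTime f) (h : ∀ x, enc (g x) = enc (f x)) :
    PolyTime g := by
  obtain ⟨c, u, hu, hc⟩ := hf
  exact ⟨c, u, hu, fun a => by rw [h]; exact hc a⟩

@[fun_prop] theorem add {f g : γ → ℕ} (hf : PolyTime f) (hg : PolyTime g) :
    PolyTime (fun x => f x + g x) :=
  (of_prim .add fun _ => rfl : PolyTime fun p : ℕ × ℕ => p.1 + p.2).comp (hf.prodMk hg)

@[fun_prop] theorem sub {f g : γ → ℕ} (hf : PolyTime f) (hg : PolyTime g) :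
    PolyTime (fun x => f x - g x) :=
  (of_prim .sub fun _ => rfl : PolyTime fun p : ℕ × ℕ => p.1 - p.2).comp (hf.prodMk hg)

@[fun_prop] theorem mul {f g : γ → ℕ} (hf : PolyTime f) (hg : PolyTime g) :
    PolyTime (fun x => f x * g x) :=
  (of_prim .mul fun _ => rfl : PolyTime fun p : ℕ × ℕ => p.1 * p.2).comp (hf.prodMk hg)

@[fun_prop] theorem div {f g : γ → ℕ} (hf : PolyTime f) (hg : PolyTime g) :
    PolyTime (fun x => f x / g x) :=
  (of_prim .div fun _ => rfl : PolyTime fun p : ℕ × ℕ => p.1 / p.2).comp (hf.prodMk hg)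

@[fun_prop] theorem mod {f g : γ → ℕ} (hf : PolyTime f) (hg : PolyTime g) :
    PolyTime (fun x => f x % g x) := by
  have h : (fun x => f x % g x) = fun x => f x - g x * (f x / g x) := by
    funext x; exact Nat.mod_eq_sub_mul_div
  rw [h]; fun_prop

@[fun_prop] theorem cond {c : γ → Bool} {f g : γ → α} (hc : PolyTime c) (hf : PolyTime f)
    (hg : PolyTime g) : PolyTime (fun x => bif c x then f x else g x) := by
  obtain ⟨cc, u, hu, h⟩ := hc
  obtain ⟨cf, v, hv, k⟩ := hf
  obtain ⟨cg, w, hw, l⟩ := hg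
  refine ⟨.cond cc cf cg, fun a => u a + v a + w a + 1, ((hu.add hv).add hw).add (.const 1),
    fun a => ?_⟩
  obtain ⟨t₁, ht₁, r₁⟩ := h a
  cases hca : c a with
  | true =>
    rw [hca] at r₁
    obtain ⟨t₂, ht₂, r₂⟩ := k a
    refine ⟨t₁ + t₂ + 1, by dsimp only; omega, ?_⟩
    simp only [hca]
    exact .cond_true r₁ (by simp [enc]) r₂
  | false =>
    rw [hca] at r₁
    obtain ⟨t₂, ht₂, r₂⟩ := l a
    refine ⟨t₁ + t₂ + 1, by dsimp only; omega, ?_⟩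
    simp only [hca]
    exact .cond_false r₁ r₂

@[fun_prop] theorem beq_zero : PolyTime (fun n : ℕ => n.beq 0) := by
  refine ⟨.cond (.prim .id) (.prim (.const (.nat 0))) (.prim (.const (.nat 1))),
    fun n => 10 + 3 * sz n, (PolyBdd.const 10).add ((PolyBdd.const 3).mul .size), fun n => ?_⟩
  have hz := one_le_sz n
  cases n with
  | zero =>
    refine ⟨_, ?_, .cond_false (.prim .id _) (.prim _ _)⟩
    simp [Prim.cost, Prim.apply, enc, Val.size, sz]
  | succ n =>
    refine ⟨_, ?_, .cond_true (.prim .id _) (by simp [Prim.apply, enc]) (.prim _ _)⟩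
    simp [Prim.cost, Prim.apply, enc, Val.size, sz]
    omega

@[fun_prop] theorem not {f : γ → Bool} (hf : PolyTime f) : PolyTime (fun x => !(f x)) := by
  have h : (fun x => !(f x)) = fun x => bif f x then false else true := by
    funext x; cases f x <;> rfl
  rw [h]; fun_prop

@[fun_prop] theorem and {f g : γ → Bool} (hf : PolyTime f) (hg : PolyTime g) :
    PolyTime (fun x => f x && g x) := by
  have h : (fun x => f x && g x) = fun x => bif f x then g x else false := by
    funext x; cases f x <;> rfl
  rw [h]; fun_prop

@[fun_prop] theorem or {f g : γ → Bool} (hf : PolyTime f) (hg : PolyTime g) :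
    PolyTime (fun x => f x || g x) := by
  have h : (fun x => f x || g x) = fun x => bif f x then true else g x := by
    funext x; cases f x <;> rfl
  rw [h]; fun_prop

@[fun_prop] theorem ble {f g : γ → ℕ} (hf : PolyTime f) (hg : PolyTime g) :
    PolyTime (fun x => Nat.ble (f x) (g x)) := by
  have h : (fun x => Nat.ble (f x) (g x)) = fun x => Nat.beq (f x - g x) 0 := by
    funext x
    rw [Bool.eq_iff_iff, Nat.ble_eq, Nat.beq_eq]; omega
  rw [h]; exact beq_zero.comp (by fun_prop)

end PolyTime
/-! ### Polynomial-time operations on lists -/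

namespace PolyTime
variable {α β γ σ κ : Type} [Enc α] [Enc β] [Enc γ] [Enc σ] [Enc κ]

/-- A fold over a list runs in polynomial time if the step does and the intermediate states have
polynomial size. -/
theorem foldl {l : γ → List α} {init : γ → σ} {step : γ → σ → α → σ} (hl : PolyTime l)
    (hi : PolyTime init) (hs : PolyTime fun p : γ × σ × α => step p.1 p.2.1 p.2.2)
    (b : γ → ℕ) (hb : PolyBdd b)
    (hbd : ∀ x l', l' <+: l x → sz (l'.foldl (step x) (init x)) ≤ b x) :
    PolyTime fun x => (l x).foldl (step x) (init x) := by
  -- A nonempty list has the same data as the pair of its head and its tail.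
  have hbody : PolyTime fun p : γ × (α × List α) × σ =>
      (p.1, p.2.1.2, step p.1 p.2.2 p.2.1.1) := by
    refine prodMk (by fun_prop) (prodMk (by fun_prop) ?_)
    exact hs.comp (g := fun p : γ × (α × List α) × σ => (p.1, p.2.2, p.2.1.1)) (by fun_prop)
  have htest : PolyTime fun p : γ × List α × σ => enc p.2.1 :=
    of_enc_eq (f := fun p : γ × List α × σ => p.2.1) (by fun_prop) fun _ => rfl
  obtain ⟨cb, ub, ⟨pb, hpb⟩, hcb⟩ := hbody
  obtain ⟨ct, ut, ⟨pt, hpt⟩, hct⟩ := htest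
  have key : ∀ (x : γ) (Z : ℕ) (l : List α) (s : σ),
      (∀ l₁ l₂, l = l₁ ++ l₂ → sz (x, l₂, l₁.foldl (step x) s) ≤ Z) →
      ∃ t, t ≤ (l.length + 1) * (pt.eval Z + pb.eval Z + 1) ∧
        Run (.loop ct cb) (enc (x, l, s)) [] (enc (x, ([] : List α), l.foldl (step x) s)) t := by
    intro x Z l
    induction l with
    | nil =>
      intro s h
      obtain ⟨t, ht, r⟩ := hct (x, [], s)
      have h₁ := (ht.trans (hpt _)).trans (polynomial_eval_mono pt (h [] [] rfl))
      exact ⟨t + 1, by simp; omega, .loop_done r⟩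
    | cons a l ih =>
      intro s h
      obtain ⟨t₁, ht₁, r₁⟩ := hct (x, a :: l, s)
      obtain ⟨t₂, ht₂, r₂⟩ := hcb (x, (a, l), s)
      obtain ⟨t₃, ht₃, r₃⟩ := ih (step x s a) fun l₁ l₂ hl => h (a :: l₁) l₂ (by simp [hl])
      have h₁ := (ht₁.trans (hpt _)).trans (polynomial_eval_mono pt (h [] (a :: l) rfl))
      have h₂ := (ht₂.trans (hpb _)).trans (polynomial_eval_mono pb (h [] (a :: l) rfl))
      refine ⟨t₁ + t₂ + t₃ + 1, ?_, .loop_step r₁ (by simp [enc, Val.ofList]) r₂ r₃⟩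
      rw [List.length_cons, Nat.succ_mul]; omega
  have hinit : PolyTime fun x => (x, l x, init x) := by fun_prop
  have hfin : PolyTime fun p : γ × List α × σ => p.2.2 := by fun_prop
  have hloop : PolyBdd fun x => ((l x).length + 1) *
      (pt.eval (sz x + sz (l x) + b x + 2) + pb.eval (sz x + sz (l x) + b x + 2) + 1) := by
    have hZ : PolyBdd fun x => sz x + sz (l x) + b x + 2 :=
      ((PolyBdd.size.add hl.polyBdd_size).add hb).add (.const 2)
    exact ((hl.polyBdd_size.mono fun x => (length_lt_sz _).le).add (.const 1)).mul
      (((hZ.eval pt).add (hZ.eval pb)).add (.const 1))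
  have hres : PolyBdd fun x =>
      sz (x, ([] : List α), (l x).foldl (step x) (init x)) := by
    refine ((PolyBdd.size.add hb).add (.const 3)).mono fun x => ?_
    have := hbd x (l x) List.prefix_rfl
    simp only [sz_pair, sz_nil]; omega
  obtain ⟨ci, ui, hui, hci⟩ := hinit
  obtain ⟨cf, uf, ⟨pf, hpf⟩, hcf⟩ := hfin
  refine ⟨.comp cf (.comp (.loop ct cb) ci), _,
    (((hui.add hloop).add (.const 1)).add (hres.eval pf)).add (.const 1), fun x => ?_⟩
  obtain ⟨t₁, ht₁, r₁⟩ := hci x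
  obtain ⟨t₂, ht₂, r₂⟩ := key x (sz x + sz (l x) + b x + 2) (l x) (init x) (by
    intro l₁ l₂ h
    have h₁ := hbd x l₁ ⟨l₂, h.symm⟩
    have h₂ := sz_append l₁ l₂
    have h₃ := one_le_sz l₁
    rw [← h] at h₂
    simp only [sz_pair]; omega)
  obtain ⟨t₃, ht₃, r₃⟩ := hcf (x, ([] : List α), (l x).foldl (step x) (init x))
  refine ⟨t₁ + t₂ + 1 + t₃ + 1, ?_, .comp (.comp r₁ r₂) r₃⟩
  have := ht₃.trans (hpf _)
  omega

/-- A fold over a list runs in polynomial time if the step does and an invariant bounds the sizes of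
the intermediate states by a polynomial. -/
theorem foldl_of_invariant {l : γ → List α} {init : γ → σ} {step : γ → σ → α → σ} (hl : PolyTime l)
    (hi : PolyTime init) (hs : PolyTime fun p : γ × σ × α => step p.1 p.2.1 p.2.2)
    (P : γ → σ → Prop) (h0 : ∀ x, P x (init x))
    (hP : ∀ x s a, a ∈ l x → P x s → P x (step x s a))
    (b : γ → ℕ) (hb : PolyBdd b) (hbd : ∀ x s, P x s → sz s ≤ b x) :
    PolyTime fun x => (l x).foldl (step x) (init x) := by
  refine foldl hl hi hs b hb fun x l' hl' => hbd x _ ?_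
  have key : ∀ (m : List α) (s : σ), (∀ a ∈ m, a ∈ l x) → P x s → P x (m.foldl (step x) s) := by
    intro m
    induction m with
    | nil => intro s _ h; exact h
    | cons a m ih =>
      intro s hm h
      exact ih _ (fun a ha => hm a (List.mem_cons_of_mem _ ha))
        (hP x s a (hm a List.mem_cons_self) h)
  exact key l' (init x) (fun a ha => hl'.subset ha) (h0 x)

@[fun_prop] theorem cons {f : γ → α} {l : γ → List α} (hf : PolyTime f) (hl : PolyTime l) :
    PolyTime fun x => f x :: l x :=
  (hf.prodMk hl).of_enc_eq fun _ => rfl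

@[fun_prop] theorem tail {l : γ → List α} (hl : PolyTime l) : PolyTime fun x => (l x).tail := by
  have h : PolyTime (List.tail : List α → List α) := of_prim .snd fun l => by
    cases l <;> rfl
  exact h.comp hl

@[fun_prop] theorem isEmpty {l : γ → List α} (hl : PolyTime l) :
    PolyTime fun x => (l x).isEmpty := by
  have h : PolyTime (List.isEmpty : List α → Bool) := by
    refine ⟨.cond (.prim .id) (.prim (.const (.nat 0))) (.prim (.const (.nat 1))),
      fun n => 10 + 3 * sz n, (PolyBdd.const 10).add ((PolyBdd.const 3).mul .size), fun l => ?_⟩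
    have hz := one_le_sz l
    cases l with
    | nil =>
      refine ⟨_, ?_, .cond_false (.prim .id _) (.prim _ _)⟩
      simp [Prim.cost, Prim.apply, enc, Val.size, sz, Val.ofList]
    | cons a l =>
      refine ⟨_, ?_, .cond_true (.prim .id _) (by simp [Prim.apply, enc, Val.ofList]) (.prim _ _)⟩
      simp [Prim.cost, Prim.apply, enc, Val.size, sz, Val.ofList]
      omega
  exact h.comp hl

@[fun_prop] theorem reverse {l : γ → List α} (hl : PolyTime l) :
    PolyTime fun x => (l x).reverse := by
  have h : ∀ (m s : List α), m.foldl (fun s a => a :: s) s = m.reverse ++ s := by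
    intro m
    induction m with
    | nil => simp
    | cons a m ih => intro s; simp [ih]
  refine (foldl (init := fun _ => []) (step := fun _ s a => a :: s) hl (by fun_prop) (by fun_prop)
    (fun x => sz (l x)) hl.polyBdd_size ?_).of_enc_eq fun x => by rw [h, List.append_nil]
  intro x l' hl'
  rw [h, List.append_nil, sz_reverse]
  exact sz_prefix_le hl'

@[fun_prop] theorem map {f : γ → α → β} {l : γ → List α}
    (hf : PolyTime fun p : γ × α => f p.1 p.2) (hl : PolyTime l) :
    PolyTime fun x => (l x).map (f x) := by
  have h : ∀ (x : γ) (m : List α) (s : List β),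
      m.foldl (fun s a => f x a :: s) s = (m.map (f x)).reverse ++ s := by
    intro x m
    induction m with
    | nil => simp
    | cons a m ih => intro s; simp [ih]
  obtain ⟨p, hp⟩ := hf.polyBdd_size
  have hfold : PolyTime fun x => (l x).foldl (fun s a => f x a :: s) [] := by
    refine foldl (init := fun _ => []) (step := fun x s a => f x a :: s) hl (by fun_prop)
      (cons (hf.comp (g := fun p : γ × List β × α => (p.1, p.2.2)) (by fun_prop)) (by fun_prop))
      (fun x => sz (l x) * (p.eval (sz x + sz (l x) + 1) + 1) + 1) ?_ ?_
    · exact (hl.polyBdd_size.mul ((((PolyBdd.size.add hl.polyBdd_size).add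
        (.const 1)).eval p).add (.const 1))).add (.const 1)
    · intro x l' hl'
      rw [h, List.append_nil, sz_reverse]
      refine (sz_le_of_forall (B := p.eval (sz x + sz (l x) + 1)) ?_).trans ?_
      · intro b hb
        obtain ⟨a, ha, rfl⟩ := List.mem_map.1 hb
        refine (hp (x, a)).trans (polynomial_eval_mono p ?_)
        have := sz_mem (hl'.subset ha)
        rw [sz_pair]; omega
      · rw [List.length_map]
        have := hl'.length_le.trans (length_lt_sz (l x)).le
        gcongr
  exact (reverse hfold).of_enc_eq fun x => by rw [h]; simp

@[fun_prop] theorem append {l₁ l₂ : γ → List α} (h₁ : PolyTime l₁) (h₂ : PolyTime l₂) :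
    PolyTime fun x => l₁ x ++ l₂ x := by
  have h : ∀ (m s : List α), m.foldl (fun s a => a :: s) s = m.reverse ++ s := by
    intro m
    induction m with
    | nil => simp
    | cons a m ih => intro s; simp [ih]
  refine (foldl (init := l₂) (step := fun _ s a => a :: s) (h₁.reverse) h₂ (by fun_prop)
    (fun x => sz (l₁ x) + sz (l₂ x)) (h₁.polyBdd_size.add h₂.polyBdd_size) ?_).of_enc_eq
    fun x => by rw [h, List.reverse_reverse]
  intro x l' hl'
  have h₃ := sz_append l'.reverse (l₂ x)
  have h₄ := sz_prefix_le hl'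
  rw [sz_reverse] at h₃ h₄
  rw [h]; omega

theorem sz_flatten_le (l : List (List α)) : sz l.flatten ≤ sz l := by
  induction l with
  | nil => simp [sz_nil]
  | cons a l ih =>
    have := sz_append a l.flatten
    rw [List.flatten_cons, sz_cons]; omega

@[fun_prop] theorem flatten {l : γ → List (List α)} (hl : PolyTime l) :
    PolyTime fun x => (l x).flatten := by
  have h : ∀ (m : List (List α)) s, m.foldl (fun s a => s ++ a) s = s ++ m.flatten := by
    intro m
    induction m with
    | nil => simp
    | cons a m ih => intro s; simp [ih]
  refine (foldl (init := fun _ => []) (step := fun _ s a => s ++ a) hl (by fun_prop) (by fun_prop)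
    (fun x => sz (l x)) hl.polyBdd_size ?_).of_enc_eq fun x => by rw [h, List.nil_append]
  intro x l' hl'
  rw [h, List.nil_append]
  exact (sz_flatten_le l').trans (sz_prefix_le hl')

@[fun_prop] theorem flatMap {f : γ → α → List β} {l : γ → List α}
    (hf : PolyTime fun p : γ × α => f p.1 p.2) (hl : PolyTime l) :
    PolyTime fun x => (l x).flatMap (f x) := by
  simp only [List.flatMap_def]; fun_prop

@[fun_prop] theorem filter {p : γ → α → Bool} {l : γ → List α}
    (hp : PolyTime fun q : γ × α => p q.1 q.2) (hl : PolyTime l) :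
    PolyTime fun x => (l x).filter (p x) := by
  have h : (fun x => (l x).filter (p x)) =
      fun x => (l x).flatMap fun a => bif p x a then [a] else [] := by
    funext x
    induction l x with
    | nil => rfl
    | cons a l ih => rw [List.flatMap_cons, ← ih]; cases h : p x a <;> simp [h]
  rw [h]; fun_prop

@[fun_prop] theorem sum {l : γ → List ℕ} (hl : PolyTime l) : PolyTime fun x => (l x).sum := by
  have h : ∀ (m : List ℕ) (s : ℕ), m.foldl (fun s a => s + a) s = s + m.sum := by
    intro m
    induction m with
    | nil => simp
    | cons a m ih => intro s; simp [ih, add_assoc]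
  refine (foldl (init := fun _ => 0) (step := fun _ s a => s + a) hl (by fun_prop) (by fun_prop)
    (fun x => sz (l x)) hl.polyBdd_size ?_).of_enc_eq fun x => by rw [h, zero_add]
  intro x l' hl'
  rw [h, zero_add]
  refine le_trans ?_ (sz_prefix_le hl')
  clear hl'
  induction l' with
  | nil => simp [sz_nat, sz_nil]
  | cons a m ih =>
    have := natSize_add_le a m.sum
    rw [sz_nat] at ih
    rw [List.sum_cons, sz_nat, sz_cons, sz_nat]; omega

@[fun_prop] theorem length {l : γ → List α} (hl : PolyTime l) : PolyTime fun x => (l x).length := by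
  have h : (fun x => (l x).length) = fun x => ((l x).map fun _ => 1).sum := by
    funext x; simp
  rw [h]; fun_prop

@[fun_prop] theorem range_length {l : γ → List α} (hl : PolyTime l) :
    PolyTime fun x => List.range (l x).length := by
  have h : ∀ (m : List α), m.foldl (fun s _ => s ++ [s.length]) [] = List.range m.length := by
    intro m
    induction m using List.reverseRecOn with
    | nil => simp
    | append_singleton m a ih => simp [ih, List.range_succ]
  have hz : PolyBdd fun x => sz (l x) * (sz (l x) + 2) + 1 :=
    (hl.polyBdd_size.mul (hl.polyBdd_size.add (.const 2))).add (.const 1)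
  refine (foldl (init := fun _ => []) (step := fun _ s a => s ++ [s.length]) hl (by fun_prop)
    (by fun_prop) _ hz ?_).of_enc_eq fun x => by rw [h]
  intro x l' hl'
  rw [h]
  have h₁ := hl'.length_le.trans (length_lt_sz (l x)).le
  refine (sz_le_of_forall (B := sz (l x) + 1) fun a ha => ?_).trans ?_
  · rw [sz_nat]
    have h₂ := List.mem_range.1 ha
    have h₃ : Nat.size a ≤ a := Nat.size_le.2 Nat.lt_two_pow_self
    omega
  · rw [List.length_range]; gcongr

@[fun_prop] theorem tails {l : γ → List α} (hl : PolyTime l) : PolyTime fun x => (l x).tails := by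
  have h : ∀ (m : List α), m.foldl (fun (s : List α × List (List α)) a =>
      (a :: s.1, (a :: s.1) :: s.2)) ([], [[]]) = (m.reverse, m.reverse.tails) := by
    intro m
    induction m using List.reverseRecOn with
    | nil => simp
    | append_singleton m a ih => simp [ih]
  have hz : PolyBdd fun x => sz (l x) + ((sz (l x) + 1) * (sz (l x) + 1) + 1) + 1 :=
    (hl.polyBdd_size.add (((hl.polyBdd_size.add (.const 1)).mul
      (hl.polyBdd_size.add (.const 1))).add (.const 1))).add (.const 1)
  have hfold := foldl (init := fun _ => ([], [[]])) (step := fun _ s a =>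
      (a :: s.1, (a :: s.1) :: s.2)) hl.reverse (by fun_prop) (by fun_prop) _ hz (by
    intro x l' hl'
    rw [h, sz_pair]
    have h₁ := sz_prefix_le hl'
    have h₂ := length_lt_sz l'
    rw [sz_reverse] at h₁
    rw [sz_reverse]
    have h₃ : sz l'.reverse.tails ≤ (sz (l x) + 1) * (sz (l x) + 1) + 1 := by
      refine (sz_le_of_forall (B := sz (l x)) fun m hm => ?_).trans ?_
      · rw [List.mem_tails] at hm
        have h₄ := sz_prefix_le (List.reverse_prefix.2 hm)
        rw [sz_reverse, List.reverse_reverse] at h₄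
        omega
      · rw [List.length_tails, List.length_reverse]; gcongr; omega
    omega)
  exact hfold.snd'.of_enc_eq fun x => by rw [h, List.reverse_reverse]

end PolyTime

/-- The value of the last entry with the given key in an association list, or `0`. -/
def lookup {κ : Type} [DecidableEq κ] (k : κ) (T : List (κ × ℕ)) : ℕ :=
  T.foldl (fun s e => bif decide (e.1 = k) then e.2 else s) 0

theorem lookup_map {κ : Type} [DecidableEq κ] (keys : List κ) (f : κ → ℕ) {k : κ} (hk : k ∈ keys) :
    lookup k (keys.map fun k => (k, f k)) = f k := by
  unfold lookup
  induction keys using List.reverseRecOn with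
  | nil => simp at hk
  | append_singleton l a ih =>
    rw [List.map_append, List.foldl_append, List.map_singleton, List.foldl_cons, List.foldl_nil]
    by_cases h : a = k
    · simp [h]
    · have hk' : k ∈ l := by
        rcases List.mem_append.1 hk with hk | hk
        · exact hk
        · exact absurd (List.mem_singleton.1 hk).symm h
      simp only [h, decide_false, cond_false]; exact ih hk'

/-- The decided equality of two elements. -/
def eqb {α : Type} [DecidableEq α] (a b : α) : Bool := decide (a = b)

/-- Types in which equality is decided in polynomial time. -/
class PolyTimeEq (α : Type) [Enc α] [DecidableEq α] : Prop where
  eqb : PolyTime fun p : α × α => eqb p.1 p.2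

/-- The elements of a list, without repetitions. -/
def nub {α : Type} [DecidableEq α] (l : List α) : List α :=
  l.foldl (fun s a => bif s.contains a then s else a :: s) []

theorem mem_nub_and_nodup {α : Type} [DecidableEq α] (l : List α) :
    (∀ a, a ∈ nub l ↔ a ∈ l) ∧ (nub l).Nodup := by
  unfold nub
  induction l using List.reverseRecOn with
  | nil => simp
  | append_singleton l a ih =>
    rw [List.foldl_append, List.foldl_cons, List.foldl_nil]
    generalize List.foldl _ _ l = s at ih ⊢
    by_cases h : a ∈ s
    · have h' := (ih.1 a).1 h
      simp only [List.contains_iff_mem.2 h, cond_true]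
      refine ⟨fun b => ?_, ih.2⟩
      rw [ih.1, List.mem_append, List.mem_singleton]
      exact ⟨Or.inl, fun h => h.elim _root_.id fun h => h ▸ h'⟩
    · have hc : s.contains a = false := by simpa using h
      simp only [hc, cond_false]
      refine ⟨fun b => ?_, List.nodup_cons.2 ⟨h, ih.2⟩⟩
      rw [List.mem_cons, ih.1, List.mem_append, List.mem_singleton, or_comm]

/-- The entry of a list at a position, or a default value. -/
def entryAt {α : Type} (l : List α) (i : ℕ) (d : α) : α :=
  (l.foldl (fun (s : ℕ × α) a => (s.1 + 1, bif eqb s.1 i then a else s.2)) (0, d)).2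

theorem entryAt_eq {α : Type} (l : List α) (i : ℕ) (d : α) : entryAt l i d = l.getD i d := by
  have h : l.foldl (fun (s : ℕ × α) a => (s.1 + 1, bif eqb s.1 i then a else s.2)) (0, d) =
      (l.length, l.getD i d) := by
    induction l using List.reverseRecOn with
    | nil => simp
    | append_singleton l a ih =>
      rw [List.foldl_append, ih, List.foldl_cons, List.foldl_nil, eqb]
      rcases lt_trichotomy l.length i with h | h | h
      · simp [h.ne, List.getD_eq_getElem?_getD, List.getElem?_append_right h.le]
        rw [List.getElem?_eq_none h.le, List.getElem?_eq_none (by simp; omega)]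
      · simp [h]
      · simp [h.ne', List.getD_eq_getElem?_getD, List.getElem?_append_left h]
  rw [entryAt, h]

namespace PolyTime
variable {α β γ σ κ : Type} [Enc α] [Enc β] [Enc γ] [Enc σ] [Enc κ] [DecidableEq α]

@[fun_prop] theorem eqb [PolyTimeEq α] {f g : γ → α} (hf : PolyTime f) (hg : PolyTime g) :
    PolyTime fun x => eqb (f x) (g x) :=
  PolyTimeEq.eqb.comp (hf.prodMk hg)

instance : PolyTimeEq ℕ where
  eqb := by
    have h : (fun p : ℕ × ℕ => CI.eqb p.1 p.2) = fun p => Nat.ble p.1 p.2 && Nat.ble p.2 p.1 := by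
      funext p
      rw [Bool.eq_iff_iff, Bool.and_eq_true, Nat.ble_eq, Nat.ble_eq, CI.eqb, decide_eq_true_iff]
      omega
    rw [h]; fun_prop

instance [DecidableEq β] [PolyTimeEq α] [PolyTimeEq β] : PolyTimeEq (α × β) where
  eqb := by
    have h : (fun p : (α × β) × α × β => CI.eqb p.1 p.2) =
        fun p => CI.eqb p.1.1 p.2.1 && CI.eqb p.1.2 p.2.2 := by
      funext p
      rw [Bool.eq_iff_iff, Bool.and_eq_true]
      simp [CI.eqb, Prod.ext_iff]
    rw [h]; fun_prop

@[fun_prop] theorem entryAt {l : γ → List β} {i : γ → ℕ} {d : γ → β} (hl : PolyTime l)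
    (hi : PolyTime i) (hd : PolyTime d) : PolyTime fun x => entryAt (l x) (i x) (d x) := by
  have hfold := foldl (init := fun x => (0, d x))
    (step := fun x (s : ℕ × β) a => (s.1 + 1, bif CI.eqb s.1 (i x) then a else s.2))
    hl (by fun_prop) (by fun_prop) (fun x => (sz (l x) + 1) + (sz (l x) + sz (d x)) + 1)
    (((hl.polyBdd_size.add (.const 1)).add (hl.polyBdd_size.add hd.polyBdd_size)).add (.const 1)) ?_
  · exact hfold.snd'
  · intro x l' hl'
    have key : ∀ m : List β, m <+: l x →
        (m.foldl (fun (s : ℕ × β) a => (s.1 + 1, bif CI.eqb s.1 (i x) then a else s.2)) (0, d x)).1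
          = m.length ∧
        sz (m.foldl (fun (s : ℕ × β) a => (s.1 + 1, bif CI.eqb s.1 (i x) then a else s.2))
          (0, d x)).2 ≤ sz (l x) + sz (d x) := by
      intro m
      induction m using List.reverseRecOn with
      | nil => simp
      | append_singleton m a ih =>
        intro hm
        have ih := ih ((List.prefix_append _ _).trans hm)
        have ha := sz_mem (hm.subset (by simp : a ∈ m ++ [a]))
        rw [List.foldl_append, List.foldl_cons, List.foldl_nil, List.length_append]
        refine ⟨by simp [ih.1], ?_⟩
        dsimp only
        cases CI.eqb (α := ℕ) _ _
        · exact ih.2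
        · simp only [cond_true]; omega
    obtain ⟨h₁, h₂⟩ := key l' hl'
    have h₃ := hl'.length_le.trans_lt (length_lt_sz (l x))
    rw [← Prod.mk.eta (p := List.foldl _ _ _), sz_pair, h₁, sz_nat]
    have h₄ : Nat.size l'.length ≤ l'.length := Nat.size_le.2 Nat.lt_two_pow_self
    omega

theorem sz_tail_le (l : List β) : sz l.tail ≤ sz l := by
  cases l with
  | nil => simp
  | cons a l => rw [List.tail_cons, sz_cons]; omega

instance [PolyTimeEq α] : PolyTimeEq (List α) where
  eqb := by
    have h : ∀ (l r : List α) (ok : Bool),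
        (fun s : List α × Bool => s.2 && s.1.isEmpty)
          (l.foldl (fun s a => (s.1.tail, s.2 && !s.1.isEmpty && CI.eqb (CI.entryAt s.1 0 a) a))
            (r, ok)) = true ↔ ok = true ∧ l = r := by
      intro l
      induction l with
      | nil => intro r ok; cases r <;> simp
      | cons a l ih =>
        intro r ok
        rw [List.foldl_cons, ih]
        cases r with
        | nil => simp
        | cons b r => simp [entryAt_eq, CI.eqb, eq_comm (a := b), and_assoc]
    have hfold := foldl_of_invariant (l := fun p : List α × List α => p.1)
      (init := fun p => (p.2, true)) (step := fun _ (s : List α × Bool) a =>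
        (s.1.tail, s.2 && !s.1.isEmpty && CI.eqb (CI.entryAt s.1 0 a) a))
      (by fun_prop) (by fun_prop) (by fun_prop) (fun p s => sz s.1 ≤ sz p) (fun p => by
        rw [← Prod.mk.eta (p := p), sz_pair]; dsimp only; omega)
      (fun p s a _ hs => (sz_tail_le _).trans hs) (fun p => sz p + 3)
      (PolyBdd.size.add (.const 3)) (fun p s hs => by
        have := sz_bool s.2
        rw [← Prod.mk.eta (p := s), sz_pair]; omega)
    have hres : (fun p : List α × List α => CI.eqb p.1 p.2) = fun p =>
        (fun s : List α × Bool => s.2 && s.1.isEmpty) (p.1.foldl (fun s a =>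
          (s.1.tail, s.2 && !s.1.isEmpty && CI.eqb (CI.entryAt s.1 0 a) a)) (p.2, true)) := by
      funext p
      rw [Bool.eq_iff_iff, h, CI.eqb]; simp
    rw [hres]
    exact (show PolyTime fun s : List α × Bool => s.2 && s.1.isEmpty by fun_prop).comp hfold

@[fun_prop] theorem contains [PolyTimeEq α] {l : γ → List α} {f : γ → α} (hl : PolyTime l)
    (hf : PolyTime f) : PolyTime fun x => (l x).contains (f x) := by
  have h : (fun x => (l x).contains (f x)) =
      fun x => !((l x).filter fun a => CI.eqb a (f x)).isEmpty := by
    funext x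
    rw [Bool.eq_iff_iff]
    simp [CI.eqb]
  rw [h]; fun_prop

@[fun_prop] theorem nub [PolyTimeEq α] {l : γ → List α} (hl : PolyTime l) :
    PolyTime fun x => nub (l x) := by
  refine foldl (init := fun _ => []) (step := fun _ s a => bif s.contains a then s else a :: s) hl
    (by fun_prop) (by fun_prop) (fun x => sz (l x)) hl.polyBdd_size fun x l' hl' =>
      le_trans ?_ (sz_prefix_le hl')
  clear hl'
  induction l' using List.reverseRecOn with
  | nil => simp
  | append_singleton m a ih =>
    have := sz_append m [a]
    rw [sz_cons, sz_nil] at this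
    rw [List.foldl_append, List.foldl_cons, List.foldl_nil]
    cases List.contains _ a
    · simp only [cond_false, sz_cons]; omega
    · simp only [cond_true]; omega

@[fun_prop] theorem lookup [DecidableEq κ] [PolyTimeEq κ] {k : γ → κ} {T : γ → List (κ × ℕ)}
    (hk : PolyTime k) (hT : PolyTime T) : PolyTime fun x => lookup (k x) (T x) := by
  refine foldl_of_invariant (init := fun _ => 0)
    (step := fun x s (e : κ × ℕ) => bif CI.eqb e.1 (k x) then e.2 else s) hT (by fun_prop)
    (by fun_prop) (fun x s => sz s ≤ sz (T x)) (fun x => ?_) (fun x s e he hs => ?_)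
    (fun x => sz (T x)) hT.polyBdd_size fun x s hs => hs
  · simpa [sz_nat] using one_le_sz (T x)
  · have := sz_mem he
    rw [← Prod.mk.eta (p := e), sz_pair] at this
    cases CI.eqb (α := κ) _ _
    · exact hs
    · simp only [cond_true]; omega

end PolyTime
/-! ### Derivation forests of a context-free grammar -/

namespace Forest
variable {T N : Type}

/-- Concatenation of forests. -/
def append : Forest T N → Forest T N → Forest T N
  | nil, G => G
  | leaf a rest, G => leaf a (rest.append G)
  | node r children rest, G => node r children (rest.append G)

/-- The height of a forest as a binary tree (first child, next sibling). -/
def height : Forest T N → ℕ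
  | nil => 1
  | leaf _ rest => rest.height + 1
  | node _ children rest => max children.height rest.height + 1

@[simp] theorem roots_append (F G : Forest T N) : (F.append G).roots = F.roots ++ G.roots := by
  induction F with
  | nil => rfl
  | leaf a r ih => simp [append, roots, ih]
  | node r c rest _ ih => simp [append, roots, ih]

@[simp] theorem yield_append (F G : Forest T N) : (F.append G).yield = F.yield ++ G.yield := by
  induction F with
  | nil => rfl
  | leaf a r ih => simp [append, yield, ih]
  | node r c rest _ ih => simp [append, yield, ih]

@[simp] theorem valid_append (R : Finset (ContextFreeRule T N)) (F G : Forest T N) :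
    (F.append G).Valid R ↔ F.Valid R ∧ G.Valid R := by
  induction F with
  | nil => simp [append, Valid]
  | leaf a r ih => simp [append, Valid, ih]
  | node r c rest _ ih => simp [append, Valid, ih]; tauto

theorem exists_append_of_roots (R : Finset (ContextFreeRule T N)) (F : Forest T N) :
    ∀ α β, F.roots = α ++ β → F.Valid R → ∃ G H : Forest T N, G.roots = α ∧ H.roots = β ∧
      G.Valid R ∧ H.Valid R ∧ F.yield = G.yield ++ H.yield := by
  induction F with
  | nil =>
    intro α β h hv
    have h' : α = [] ∧ β = [] := by simpa [roots] using h.symm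
    exact ⟨nil, nil, h'.1.symm, h'.2.symm, trivial, trivial, rfl⟩
  | leaf a r ih =>
    intro α β h hv
    cases α with
    | nil => exact ⟨nil, leaf a r, rfl, h, trivial, hv, rfl⟩
    | cons s α =>
      simp only [roots, List.cons_append, List.cons.injEq] at h
      obtain ⟨G, H, h₁, h₂, h₃, h₄, h₅⟩ := ih α β h.2 hv
      exact ⟨leaf a G, H, by simp [roots, h₁, h.1], h₂, h₃, h₄, by simp [yield, h₅]⟩
  | node r c rest _ ih =>
    intro α β h hv
    cases α with
    | nil => exact ⟨nil, node r c rest, rfl, h, trivial, hv, rfl⟩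
    | cons s α =>
      simp only [roots, List.cons_append, List.cons.injEq] at h
      obtain ⟨G, H, h₁, h₂, h₃, h₄, h₅⟩ := ih α β h.2 hv.2.2.2
      exact ⟨node r c G, H, by simp [roots, h₁, h.1], h₂, ⟨hv.1, hv.2.1, hv.2.2.1, h₃⟩, h₄,
        by simp [yield, h₅]⟩

/-- The forest of leaves spelling out a word. -/
def ofWord : List T → Forest T N
  | [] => nil
  | a :: w => leaf a (ofWord w)

theorem ofWord_spec (R : Finset (ContextFreeRule T N)) (w : List T) :
    (ofWord w : Forest T N).roots = w.map .terminal ∧ (ofWord w : Forest T N).Valid R ∧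
      (ofWord w : Forest T N).yield = w := by
  induction w with
  | nil => simp [ofWord, roots, Valid, yield]
  | cons a w ih => simpa [ofWord, roots, Valid, yield] using ih

end Forest

open Forest

theorem derives_of_forest {T : Type} (g : ContextFreeGrammar T) (F : Forest T g.NT)
    (hv : F.Valid g.rules) : g.Derives F.roots (F.yield.map .terminal) := by
  induction F with
  | nil => exact .refl _
  | leaf a r ih => exact (ih hv).append_left [.terminal a]
  | node r c rest ihc ihr =>
    obtain ⟨h₁, h₂, h₃, h₄⟩ := hv
    have hr : g.Produces (.nonterminal r.input :: rest.roots) (r.output ++ rest.roots) :=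
      ⟨r, h₁, ContextFreeRule.Rewrites.head _⟩
    refine ContextFreeGrammar.Produces.trans_derives hr ?_
    rw [yield, List.map_append, ← h₂]
    exact ((ihc h₃).append_right _).trans ((ihr h₄).append_left _)

theorem exists_forest_of_derives {T : Type} (g : ContextFreeGrammar T) {α : List (Symbol T g.NT)}
    {w : List T} (h : g.Derives α (w.map .terminal)) :
    ∃ F : Forest T g.NT, F.roots = α ∧ F.Valid g.rules ∧ F.yield = w := by
  induction h using Relation.ReflTransGen.head_induction_on with
  | refl => exact ⟨_, ofWord_spec g.rules w⟩
  | head h _ ih =>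
    obtain ⟨F, h₁, h₂, h₃⟩ := ih
    obtain ⟨r, hr, hrw⟩ := h
    obtain ⟨p, q, rfl, rfl⟩ := hrw.exists_parts
    obtain ⟨G, H, hG, hH, vG, vH, hy⟩ := exists_append_of_roots g.rules F _ _ h₁ h₂
    obtain ⟨G₁, G₂, hG₁, hG₂, vG₁, vG₂, hy'⟩ := exists_append_of_roots g.rules G _ _ hG vG
    refine ⟨G₁.append (node r G₂ H), by simp [roots, hG₁, hH], ?_, ?_⟩
    · rw [valid_append]; exact ⟨vG₁, hr, hG₂, vG₂, vH⟩
    · rw [← h₃, hy, hy', yield_append, yield, List.append_assoc]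

theorem mem_language_iff_exists_tree {T : Type} (g : ContextFreeGrammar T) (w : List T) :
    w ∈ g.language ↔ ∃ F, IsDerivationTree g F w := by
  rw [ContextFreeGrammar.mem_language_iff]
  constructor
  · exact exists_forest_of_derives g
  · rintro ⟨F, h₁, h₂, h₃⟩
    rw [← h₁, ← h₃]; exact derives_of_forest g F h₂

section forests
variable {T N : Type} [DecidableEq N]

/-- The list of the forests of height at most `d` with the given roots, for a list of rules. -/
def forests (R : List (ContextFreeRule T N)) : ℕ → List (Symbol T N) → List (Forest T N)
  | 0, _ => []
  | _ + 1, [] => [nil]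
  | d + 1, .terminal a :: β => (forests R d β).map (leaf a)
  | d + 1, .nonterminal A :: β => (R.filter fun r => r.input = A).flatMap fun r =>
      (forests R d r.output).flatMap fun F => (forests R d β).map (node r F)

theorem mem_forests (R : List (ContextFreeRule T N)) (S : Finset (ContextFreeRule T N))
    (hRS : ∀ r, r ∈ R ↔ r ∈ S) (d : ℕ) : ∀ (α : List (Symbol T N)) (F : Forest T N),
      F ∈ forests R d α ↔ F.roots = α ∧ F.Valid S ∧ F.height ≤ d := by
  induction d with
  | zero => intro α F; cases F <;> simp [forests, height]
  | succ d ih =>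
    intro α F
    match α with
    | [] => cases F <;> simp [forests, height, roots, Valid]
    | .terminal a :: β =>
      cases F with
      | nil => simp [forests, roots]
      | leaf b r => simp [forests, height, roots, Valid, ih]; tauto
      | node => simp [forests, roots]
    | .nonterminal A :: β =>
      cases F with
      | nil => simp [forests, roots]
      | leaf b r => simp [forests, roots]
      | node r c rest => simp [forests, height, roots, Valid, ih, hRS]; tauto

theorem nodup_forests (R : List (ContextFreeRule T N)) (hR : R.Nodup) (d : ℕ) :
    ∀ α : List (Symbol T N), (forests R d α).Nodup := by
  induction d with
  | zero => intro α; simp [forests]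
  | succ d ih =>
    intro α
    match α with
    | [] => simp [forests]
    | .terminal a :: β =>
      exact (ih β).map fun F G h => by simpa using h
    | .nonterminal A :: β =>
      refine List.nodup_flatMap.2 ⟨fun r _ => List.nodup_flatMap.2 ⟨fun F _ =>
        (ih β).map fun F G h => by simpa using h, ?_⟩, ?_⟩
      · refine (ih r.output).imp fun {F G} h => ?_
        simp only [Function.onFun, List.disjoint_left, List.mem_map]
        rintro _ ⟨a, -, rfl⟩ ⟨b, -, hb⟩
        simp only [node.injEq] at hb
        exact h hb.2.1.symm
      · refine (hR.filter _).imp fun {r s} h => ?_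
        simp only [Function.onFun, List.disjoint_left, List.mem_map, List.mem_flatMap]
        rintro _ ⟨F, -, a, -, rfl⟩ ⟨G, -, b, -, hb⟩
        simp only [node.injEq] at hb
        exact h hb.1.symm

end forests

/-- An increasing sequence of subsets of a finite set in which every set determines the next one
is constant from the index given by the cardinality on. -/
theorem subset_of_chain {X : Type} [DecidableEq X] (U : Finset X) (S : ℕ → Finset X)
    (hmono : ∀ d, S d ⊆ S (d + 1)) (hU : ∀ d, S d ⊆ U)
    (hstep : ∀ d, S d = S (d + 1) → S (d + 1) = S (d + 2)) (d : ℕ) : S d ⊆ S U.card := by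
  have hM : Monotone S := monotone_nat_of_le_succ hmono
  have hconst : ∀ e, S e = S (e + 1) → ∀ k, S (e + k) = S e ∧ S (e + k) = S (e + k + 1) := by
    intro e he k
    induction k with
    | zero => exact ⟨rfl, he⟩
    | succ k ih => exact ⟨ih.2.symm.trans ih.1, hstep _ ih.2⟩
  have hex : ∃ e ≤ U.card, S e = S (e + 1) := by
    by_contra! hne
    have hcard : ∀ e ≤ U.card + 1, e ≤ (S e).card := by
      intro e
      induction e with
      | zero => simp
      | succ e ih =>
        intro he
        have h₁ := ih (by omega)
        have h₂ := Finset.card_lt_card ((hmono e).ssubset_of_ne (hne e (by omega)))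
        omega
    have h₁ := hcard _ le_rfl
    have h₂ := Finset.card_le_card (hU (U.card + 1))
    omega
  obtain ⟨e, he, hS⟩ := hex
  rcases le_total d e with h | h
  · exact hM (h.trans he)
  · obtain ⟨k, rfl⟩ := Nat.exists_eq_add_of_le h
    rw [(hconst e hS k).1]; exact hM he

section saturation
variable {T N : Type}

/-- If a finite set of lists of symbols is closed under suffixes and contains the right-hand sides
of the rules, and a finite set of words is closed under factors, then every word of the second set that
can be derived from a list of the first one has a forest whose height is at most the product of the
two cardinalities: the set of pairs derived by forests of height `d` determines that for `d + 1`. -/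
theorem exists_forest_height_le (S : Finset (ContextFreeRule T N))
    (items : Finset (List (Symbol T N))) (words : Finset (List T))
    (hout : ∀ r ∈ S, r.output ∈ items) (htail : ∀ s β, s :: β ∈ items → β ∈ items)
    (hfac : ∀ u v, u ++ v ∈ words → u ∈ words ∧ v ∈ words)
    (F : Forest T N) (hF : F.Valid S) (hr : F.roots ∈ items) (hy : F.yield ∈ words) :
    ∃ G : Forest T N, G.roots = F.roots ∧ G.Valid S ∧ G.yield = F.yield ∧
      G.height ≤ items.card * words.card := by
  classical
  let H : ℕ → List (Symbol T N) × List T → Prop := fun d p =>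
    ∃ G : Forest T N, G.roots = p.1 ∧ G.Valid S ∧ G.yield = p.2 ∧ G.height ≤ d
  let U := items ×ˢ words
  have hmem : ∀ d p, p ∈ U.filter (H d) ↔ (p.1 ∈ items ∧ p.2 ∈ words) ∧ H d p := by
    intro d p; simp [U]
  have key := subset_of_chain U (fun d => U.filter (H d)) ?_ (fun d => Finset.filter_subset _ _)
    ?_ F.height
  · have h := key ((hmem _ (F.roots, F.yield)).2 ⟨⟨hr, hy⟩, F, rfl, hF, rfl, le_rfl⟩)
    rw [hmem] at h
    obtain ⟨-, G, h₁, h₂, h₃, h₄⟩ := h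
    exact ⟨G, h₁, h₂, h₃, h₄.trans (Finset.card_product _ _).le⟩
  · intro d p hp
    rw [hmem] at hp ⊢
    obtain ⟨h, G, h₁, h₂, h₃, h₄⟩ := hp
    exact ⟨h, G, h₁, h₂, h₃, h₄.trans (Nat.le_succ d)⟩
  · intro d hd
    have hlow : ∀ G : Forest T N, G.roots ∈ items → G.yield ∈ words → G.Valid S →
        G.height ≤ d + 1 → H d (G.roots, G.yield) := by
      intro G h₁ h₂ h₃ h₄
      have := (hmem (d + 1) (G.roots, G.yield)).2 ⟨⟨h₁, h₂⟩, G, rfl, h₃, rfl, h₄⟩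
      rw [← show U.filter (H d) = U.filter (H (d + 1)) from hd, hmem] at this
      exact this.2
    ext p
    rw [hmem, hmem]
    refine ⟨fun ⟨h, G, h₁, h₂, h₃, h₄⟩ => ⟨h, G, h₁, h₂, h₃, h₄.trans (Nat.le_succ _)⟩, ?_⟩
    rintro ⟨h, G, h₁, h₂, h₃, h₄⟩
    refine ⟨h, ?_⟩
    obtain ⟨α, u⟩ := p
    simp only at h h₁ h₃
    subst h₁ h₃
    cases G with
    | nil => exact ⟨nil, rfl, h₂, rfl, by simp [height]⟩
    | leaf a r =>
      simp only [height] at h₄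
      obtain ⟨G, e₁, e₂, e₃, e₄⟩ := hlow r (htail _ _ h.1) (hfac [a] _ h.2).2 h₂ (by omega)
      exact ⟨leaf a G, by simp [roots, e₁], e₂, by simp [yield, e₃], by simp [height, e₄]⟩
    | node r c rest =>
      simp only [height] at h₄
      obtain ⟨v₁, v₂, v₃, v₄⟩ := h₂
      obtain ⟨G, e₁, e₂, e₃, e₄⟩ := hlow c (v₂ ▸ hout r v₁) (hfac _ _ h.2).1 v₃ (by omega)
      obtain ⟨K, f₁, f₂, f₃, f₄⟩ := hlow rest (htail _ _ h.1) (hfac _ _ h.2).2 v₄ (by omega)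
      exact ⟨node r G K, by simp [roots, f₁], ⟨v₁, e₁.trans v₂, e₂, f₂⟩,
        by simp [yield, e₃, f₃], by simp [height, e₄, f₄]⟩

end saturation

/-- The factors of a word. -/
def factors {T : Type} [DecidableEq T] (w : List T) : Finset (List T) :=
  (Finset.range (w.length + 1) ×ˢ Finset.range (w.length + 1)).image
    fun p => (w.drop p.1).take p.2

theorem mem_factors {T : Type} [DecidableEq T] {w u : List T} : u ∈ factors w ↔ u <:+: w := by
  simp only [factors, Finset.mem_image, Finset.mem_product, Finset.mem_range, Prod.exists]
  constructor
  · rintro ⟨i, j, -, rfl⟩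
    exact (List.take_prefix _ _).isInfix.trans (List.drop_suffix _ _).isInfix
  · rintro ⟨s, t, rfl⟩
    exact ⟨s.length, u.length, by simp; omega, by simp⟩

theorem card_factors_le {T : Type} [DecidableEq T] (w : List T) :
    (factors w).card ≤ (w.length + 1) * (w.length + 1) :=
  Finset.card_image_le.trans (by simp)

/-- In an unambiguous grammar, the derivation trees of bounded height correspond to the words of
bounded length. -/
theorem countP_forests_eq_card {T : Type} [DecidableEq T] (g : ContextFreeGrammar T)
    [DecidableEq g.NT] (hg : Unambiguous g) (R : List (ContextFreeRule T g.NT)) (hR : R.Nodup)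
    (hRS : ∀ r, r ∈ R ↔ r ∈ g.rules) (items : Finset (List (Symbol T g.NT)))
    (hout : ∀ r ∈ g.rules, r.output ∈ items) (htail : ∀ s β, s :: β ∈ items → β ∈ items)
    (hinit : [.nonterminal g.initial] ∈ items) (n d : ℕ)
    (hd : items.card * ((n + 1) * (n + 1)) ≤ d) (P : List T → Prop) [DecidablePred P]
    (hP : ∀ w, P w → w.length ≤ n) (W : Finset (List T))
    (hW : ∀ w, w ∈ W ↔ w ∈ g.language ∧ P w) :
    ((forests R d [.nonterminal g.initial]).map fun F => if P F.yield then 1 else 0).sum =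
      W.card := by
  have hmem := mem_forests R g.rules hRS d [.nonterminal g.initial]
  have hsum : ∀ l : List (Forest T g.NT), (l.map fun F => if P F.yield then 1 else 0).sum =
      (l.filter fun F => P F.yield).length := by
    intro l
    induction l with
    | nil => rfl
    | cons F l ih => by_cases h : P F.yield <;> simp [h, ih, add_comm]
  have hnd : ((forests R d [.nonterminal g.initial]).filter fun F => P F.yield).Nodup :=
    (nodup_forests R hR d _).filter _
  have hnd' : (((forests R d [.nonterminal g.initial]).filter fun F => P F.yield).map
      Forest.yield).Nodup := by
    refine List.Nodup.map_on (fun F hF G hG h => ?_) hnd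
    have h₁ := (hmem F).1 (List.mem_filter.1 hF).1
    have h₂ := (hmem G).1 (List.mem_filter.1 hG).1
    exact hg F.yield F G ⟨h₁.1, h₁.2.1, rfl⟩ ⟨h₂.1, h₂.2.1, h.symm⟩
  rw [hsum, ← List.length_map Forest.yield, ← List.toFinset_card_of_nodup hnd']
  congr 1
  ext w
  rw [List.mem_toFinset, List.mem_map, hW, mem_language_iff_exists_tree]
  constructor
  · rintro ⟨F, hF, rfl⟩
    have h₁ := (hmem F).1 (List.mem_filter.1 hF).1
    exact ⟨⟨F, h₁.1, h₁.2.1, rfl⟩, by simpa using (List.mem_filter.1 hF).2⟩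
  · rintro ⟨⟨F, h₁, h₂, h₃⟩, hPw⟩
    obtain ⟨G, e₁, e₂, e₃, e₄⟩ := exists_forest_height_le g.rules items (factors w) hout htail
      (fun u v h => by
        rw [mem_factors] at h ⊢
        rw [mem_factors]
        exact ⟨(List.prefix_append u v).isInfix.trans h, (List.suffix_append u v).isInfix.trans h⟩)
      F h₂ (h₁ ▸ hinit) (by rw [h₃, mem_factors])
    refine ⟨G, List.mem_filter.2 ⟨(hmem G).2 ⟨e₁.trans h₁, e₂, e₄.trans (le_trans ?_ hd)⟩, ?_⟩,
      e₃.trans h₃⟩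
    · have := hP w hPw
      exact Nat.mul_le_mul_left _ ((card_factors_le w).trans (by gcongr))
    · rw [e₃, h₃]; simpa using hPw

/-! ### Counting derivation forests along the runs of an automaton -/

section listSum
variable {α β : Type}

theorem sum_map_comm (l : List α) (m : List β) (f : α → β → ℕ) :
    (l.map fun a => (m.map fun b => f a b).sum).sum =
      (m.map fun b => (l.map fun a => f a b).sum).sum := by
  induction l with
  | nil => simp
  | cons a l ih => simp only [List.map_cons, List.sum_cons, ih, List.sum_map_add]

theorem sum_map_flatMap (l : List α) (g : α → List β) (f : β → ℕ) :
    ((l.flatMap g).map f).sum = (l.map fun a => ((g a).map f).sum).sum := by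
  induction l with
  | nil => simp
  | cons a l ih => simp [ih]

theorem sum_map_eq_single {l : List α} (hl : l.Nodup) {x : α} (hx : x ∈ l) (f : α → ℕ)
    (hf : ∀ z ∈ l, z ≠ x → f z = 0) : (l.map f).sum = f x := by
  classical
  rw [← List.sum_toFinset f hl]
  exact Finset.sum_eq_single x (fun z hz hne => hf z (by simpa using hz) hne)
    (fun h => absurd (by simpa using hx) h)

theorem sum_map_modEq {l : List α} {f g : α → ℕ} {K : ℕ} (h : ∀ a ∈ l, f a ≡ g a [MOD K]) :
    (l.map f).sum ≡ (l.map g).sum [MOD K] := by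
  induction l with
  | nil => rfl
  | cons a l ih =>
    simp only [List.map_cons, List.sum_cons]
    exact (h a List.mem_cons_self).add (ih fun b hb => h b (List.mem_cons_of_mem _ hb))

end listSum

section count
variable (rules : List (ℕ × List (ℕ × ℕ))) (states : List (ℕ × ℕ))
  (edge : ℕ → ℕ × ℕ → ℕ × ℕ → ℕ)

/-- One step of the recursion that counts forests with given roots, along the runs of an automaton
from a state to another one. Symbols are pairs of a tag (`0` for terminals) and a number; `c` counts
forests of smaller height. -/
def countStep (c : List (ℕ × ℕ) → ℕ × ℕ → ℕ × ℕ → ℕ) (α : List (ℕ × ℕ)) (x y : ℕ × ℕ) : ℕ :=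
  bif α.isEmpty then bif eqb x y then 1 else 0
  else (states.map fun z =>
    (bif eqb (entryAt α 0 (0, 0)).1 0 then edge (entryAt α 0 (0, 0)).2 x z
      else ((rules.filter fun r => eqb r.1 (entryAt α 0 (0, 0)).2).map fun r => c r.2 x z).sum) *
    c α.tail z y).sum

/-- The number of forests of height at most `d` with given roots, counted with the number of runs
of the automaton on their yields. -/
def count : ℕ → List (ℕ × ℕ) → ℕ × ℕ → ℕ × ℕ → ℕ
  | 0 => fun _ _ _ => 0
  | d + 1 => countStep rules states edge (count d)

/-- The number of runs of the automaton on a word. -/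
def runs : List ℕ → ℕ × ℕ → ℕ × ℕ → ℕ
  | [], x, y => if x = y then 1 else 0
  | a :: w, x, y => (states.map fun z => edge a x z * runs w z y).sum

variable {states}

theorem runs_append (hs : states.Nodup) (u v : List ℕ) {x : ℕ × ℕ} (hx : x ∈ states)
    (y : ℕ × ℕ) : runs states edge (u ++ v) x y =
      (states.map fun z => runs states edge u x z * runs states edge v z y).sum := by
  induction u generalizing x with
  | nil =>
    rw [List.nil_append, sum_map_eq_single hs hx]
    · simp [runs]
    · intro z _ hz; simp [runs, hz.symm]
  | cons a u ih =>
    simp only [List.cons_append, runs]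
    have h : (states.map fun z => edge a x z * runs states edge (u ++ v) z y) =
        states.map fun z => (states.map fun t =>
          edge a x z * (runs states edge u z t * runs states edge v t y)).sum := by
      refine List.map_congr_left fun z hz => ?_
      rw [ih hz, List.sum_map_mul_left]
    rw [h, sum_map_comm]
    congr 1
    refine List.map_congr_left fun z _ => ?_
    rw [← List.sum_map_mul_right]
    simp only [mul_assoc]

/-- A symbol as a pair of a tag and a number. -/
def codeSymbol {k v : ℕ} : Symbol (Fin k) (Fin v) → ℕ × ℕ
  | .terminal a => (0, a)
  | .nonterminal A => (1, A)

/-- A rule as a pair of a number and a list of symbols. -/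
def codeRule {k v : ℕ} (r : ContextFreeRule (Fin k) (Fin v)) : ℕ × List (ℕ × ℕ) :=
  (r.input, r.output.map codeSymbol)

theorem codeSymbol_injective {k v : ℕ} :
    Function.Injective (codeSymbol : Symbol (Fin k) (Fin v) → ℕ × ℕ) := by
  rintro (a | A) (b | B) h <;> simp [codeSymbol, Fin.ext_iff] at h ⊢ <;> exact h

theorem codeRule_injective {k v : ℕ} :
    Function.Injective (codeRule : ContextFreeRule (Fin k) (Fin v) → ℕ × List (ℕ × ℕ)) := by
  rintro ⟨A, α⟩ ⟨B, β⟩ h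
  simp only [codeRule, Prod.mk.injEq] at h
  rw [Fin.ext h.1, codeSymbol_injective.list_map h.2]

variable {rules}

/-- The table counts the forests of bounded height with given roots, each one with the number of
runs on its yield: a run on a concatenation is split at the state between the two parts. -/
theorem count_eq_sum_forests {k v : ℕ} (R : List (ContextFreeRule (Fin k) (Fin v)))
    (hR : rules.Perm (R.map codeRule)) (hs : states.Nodup) (d : ℕ) :
    ∀ (α : List (Symbol (Fin k) (Fin v))) {x : ℕ × ℕ} (_ : x ∈ states) (y : ℕ × ℕ),
      count rules states edge d (α.map codeSymbol) x y =
        ((forests R d α).map fun F => runs states edge (F.yield.map (↑)) x y).sum := by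
  induction d with
  | zero => intro α x _ y; simp [count, forests]
  | succ d ih =>
    intro α x hx y
    match α with
    | [] => by_cases h : x = y <;> simp [count, countStep, forests, eqb, h, Forest.yield, runs]
    | .terminal a :: β =>
      simp only [count, countStep, List.map_cons, List.isEmpty_cons, cond_false, entryAt_eq,
        List.getD_cons_zero, codeSymbol, eqb, decide_true, cond_true, List.tail_cons, forests,
        List.map_map]
      have h : (states.map fun z => edge a x z * count rules states edge d (β.map codeSymbol) z y) =
          states.map fun z => ((forests R d β).map fun F =>
            edge a x z * runs states edge (F.yield.map (↑)) z y).sum := by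
        refine List.map_congr_left fun z hz => ?_
        rw [ih β hz, List.sum_map_mul_left]
      rw [h, sum_map_comm]
      rfl
    | .nonterminal A :: β =>
      simp only [count, countStep, List.map_cons, List.isEmpty_cons, cond_false, entryAt_eq,
        List.getD_cons_zero, codeSymbol, eqb, List.tail_cons, forests, sum_map_flatMap,
        List.map_map, one_ne_zero, decide_false]
      have hrules : ∀ z, ((rules.filter fun r => decide (r.1 = (A : ℕ))).map fun r =>
          count rules states edge d r.2 x z).sum =
          ((R.filter fun r => r.input = A).map fun r => ((forests R d r.output).map fun F =>
            runs states edge (F.yield.map (↑)) x z).sum).sum := by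
        intro z
        rw [((hR.filter _).map _).sum_eq, List.filter_map, List.map_map]
        congr 1
        have h₁ : (fun r : ℕ × List (ℕ × ℕ) => decide (r.1 = (A : ℕ))) ∘ codeRule =
            fun r : ContextFreeRule (Fin k) (Fin v) => decide (r.input = A) := by
          funext r; exact decide_eq_decide.2 Fin.ext_iff.symm
        rw [h₁]
        exact List.map_congr_left fun r _ => ih r.output hx z
      have h : (states.map fun z => ((rules.filter fun r => decide (r.1 = (A : ℕ))).map fun r =>
          count rules states edge d r.2 x z).sum *
            count rules states edge d (β.map codeSymbol) z y) =
          states.map fun z => ((R.filter fun r => r.input = A).map fun r =>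
            ((forests R d r.output).map fun F => ((forests R d β).map fun G =>
              runs states edge (F.yield.map (↑)) x z *
                runs states edge (G.yield.map (↑)) z y).sum).sum).sum := by
        refine List.map_congr_left fun z hz => ?_
        rw [hrules, ih β hz, ← List.sum_map_mul_right]
        simp only [← List.sum_map_mul_right, ← List.sum_map_mul_left]
        congr 1
        exact List.map_congr_left fun r _ => sum_map_comm _ _ _
      rw [h, sum_map_comm]
      congr 1
      refine List.map_congr_left fun r _ => ?_
      rw [sum_map_comm]
      congr 1
      refine List.map_congr_left fun F _ => ?_
      rw [sum_map_comm]
      congr 1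
      refine List.map_congr_left fun G _ => ?_
      simp only [Function.comp, Forest.yield, List.map_append]
      rw [runs_append edge hs _ _ hx]

/-- The residues of the counts depend only on the residues of the counts for smaller height, and
only on those for the lists of symbols in `items`. -/
theorem countStep_modEq {K : ℕ} {c c' : List (ℕ × ℕ) → ℕ × ℕ → ℕ × ℕ → ℕ}
    {items : List (List (ℕ × ℕ))} (hout : ∀ r ∈ rules, r.2 ∈ items)
    (htail : ∀ s β, s :: β ∈ items → β ∈ items)
    (hc : ∀ α ∈ items, ∀ x ∈ states, ∀ y ∈ states, c α x y ≡ c' α x y [MOD K]) :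
    ∀ α ∈ items, ∀ x ∈ states, ∀ y ∈ states,
      countStep rules states edge c α x y ≡ countStep rules states edge c' α x y [MOD K] := by
  intro α hα x hx y hy
  cases α with
  | nil => rfl
  | cons s β =>
    simp only [countStep, List.isEmpty_cons, cond_false, List.tail_cons]
    refine sum_map_modEq fun z hz => Nat.ModEq.mul ?_ (hc β (htail _ _ hα) z hz y hy)
    cases eqb (entryAt (s :: β) 0 (0, 0)).1 0
    · simp only [cond_false]
      exact sum_map_modEq fun r hr => hc r.2 (hout r (List.mem_of_mem_filter hr)) x hx z hz
    · rfl

variable (rules states)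

/-- The keys of the table: lists of symbols and pairs of states. -/
def tableKeys (items : List (List (ℕ × ℕ))) : List (List (ℕ × ℕ) × (ℕ × ℕ) × ℕ × ℕ) :=
  items.flatMap fun α => states.flatMap fun x => states.map fun y => (α, x, y)

/-- The next table of numbers of forests, modulo `K`. -/
def tableStep (K : ℕ) (items : List (List (ℕ × ℕ)))
    (T : List ((List (ℕ × ℕ) × (ℕ × ℕ) × ℕ × ℕ) × ℕ)) :
    List ((List (ℕ × ℕ) × (ℕ × ℕ) × ℕ × ℕ) × ℕ) :=
  (tableKeys states items).map fun k =>
    (k, countStep rules states edge (fun α x y => lookup (α, x, y) T) k.1 k.2.1 k.2.2 % K)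

/-- The table of the numbers of forests, modulo `K`, of a height that suffices for all words
of interest. -/
def table (K : ℕ) (items : List (List (ℕ × ℕ))) :
    List ((List (ℕ × ℕ) × (ℕ × ℕ) × ℕ × ℕ) × ℕ) :=
  (tableKeys states items).foldl (fun T _ => tableStep rules states edge K items T) []

variable {rules states}

theorem mem_tableKeys {items : List (List (ℕ × ℕ))} {α : List (ℕ × ℕ)} {x y : ℕ × ℕ} :
    (α, x, y) ∈ tableKeys states items ↔ α ∈ items ∧ x ∈ states ∧ y ∈ states := by
  simp only [tableKeys, List.mem_flatMap, List.mem_map, Prod.mk.injEq]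
  constructor
  · rintro ⟨α, h₁, x, h₂, y, h₃, rfl, rfl, rfl⟩; exact ⟨h₁, h₂, h₃⟩
  · rintro ⟨h₁, h₂, h₃⟩; exact ⟨α, h₁, x, h₂, y, h₃, rfl, rfl, rfl⟩

theorem length_tableKeys (items : List (List (ℕ × ℕ))) :
    (tableKeys states items).length = items.length * (states.length * states.length) := by
  simp [tableKeys]

/-- The number of rounds by which the table is computed is the number of its keys, which is large
enough by `exists_forest_height_le`. The keys that are not in the table do not matter. -/
theorem lookup_table {K : ℕ} {items : List (List (ℕ × ℕ))} (hout : ∀ r ∈ rules, r.2 ∈ items)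
    (htail : ∀ s β, s :: β ∈ items → β ∈ items) {α : List (ℕ × ℕ)} {x y : ℕ × ℕ} (hα : α ∈ items)
    (hx : x ∈ states) (hy : y ∈ states) :
    lookup (α, x, y) (table rules states edge K items) =
      count rules states edge (items.length * (states.length * states.length)) α x y % K := by
  have key : ∀ m : List (List (ℕ × ℕ) × (ℕ × ℕ) × ℕ × ℕ), ∀ α ∈ items, ∀ x ∈ states,
      ∀ y ∈ states,
      lookup (α, x, y) (m.foldl (fun T _ => tableStep rules states edge K items T) []) =
        count rules states edge m.length α x y % K := by
    intro m
    induction m using List.reverseRecOn with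
    | nil => intro α _ x _ y _; simp [lookup, count]
    | append_singleton m a ih =>
      intro α hα x hx y hy
      rw [List.foldl_append, List.foldl_cons, List.foldl_nil, tableStep,
        lookup_map _ (fun k : List (ℕ × ℕ) × (ℕ × ℕ) × ℕ × ℕ =>
          countStep rules states edge _ k.1 k.2.1 k.2.2 % K) (mem_tableKeys.2 ⟨hα, hx, hy⟩),
        List.length_append, List.length_singleton, count]
      refine countStep_modEq edge hout htail (fun α hα x hx y hy => ?_) α hα x hx y hy
      rw [ih α hα x hx y hy]
      exact Nat.mod_modEq _ _
  rw [table, key _ α hα x hx y hy, length_tableKeys]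

end count

namespace PolyTime
variable {γ : Type} [Enc γ]

theorem tableKeys {states : γ → List (ℕ × ℕ)} {items : γ → List (List (ℕ × ℕ))}
    (hs : PolyTime states) (hi : PolyTime items) :
    PolyTime fun x => tableKeys (states x) (items x) := by
  unfold CI.tableKeys; fun_prop

theorem table {rules : γ → List (ℕ × List (ℕ × ℕ))} {states : γ → List (ℕ × ℕ)}
    {edge : γ → ℕ → ℕ × ℕ → ℕ × ℕ → ℕ} {K : γ → ℕ} {items : γ → List (List (ℕ × ℕ))}
    (hr : PolyTime rules) (hs : PolyTime states)
    (he : PolyTime fun p : γ × ℕ × (ℕ × ℕ) × ℕ × ℕ => edge p.1 p.2.1 p.2.2.1 p.2.2.2)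
    (hK : PolyTime K) (hKpos : ∀ x, 0 < K x) (hi : PolyTime items) :
    PolyTime fun x => table (rules x) (states x) (edge x) (K x) (items x) := by
  have hkeys := tableKeys hs hi
  have hedge : ∀ {δ : Type} [Enc δ] {c : δ → γ} {a : δ → ℕ} {x y : δ → ℕ × ℕ}, PolyTime c →
      PolyTime a → PolyTime x → PolyTime y → PolyTime fun p => edge (c p) (a p) (x p) (y p) :=
    fun h₁ h₂ h₃ h₄ => he.comp (h₁.prodMk (h₂.prodMk (h₃.prodMk h₄)))
  unfold CI.table
  refine foldl_of_invariant (init := fun _ => [])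
    (step := fun x T _ => tableStep (rules x) (states x) (edge x) (K x) (items x) T)
    hkeys (by fun_prop) ?_
    (fun x T => T.length ≤ (CI.tableKeys (states x) (items x)).length ∧
      ∀ e ∈ T, sz e ≤ sz (CI.tableKeys (states x) (items x)) + sz (K x) + 1)
    (fun x => by simp) ?_
    (fun x => sz (CI.tableKeys (states x) (items x)) *
      (sz (CI.tableKeys (states x) (items x)) + sz (K x) + 1 + 1) + 1) ?_ ?_
  · unfold tableStep countStep
    refine map ?_ (hkeys.comp fst)
    refine prodMk snd (mod ?_ (by fun_prop))
    refine cond (by fun_prop) (by fun_prop) ?_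
    refine sum (map (mul (cond (by fun_prop) ?_ (by fun_prop)) (by fun_prop)) (by fun_prop))
    exact hedge (by fun_prop) (by fun_prop) (by fun_prop) (by fun_prop)
  · intro x T k _ _
    refine ⟨by simp [tableStep], fun e he => ?_⟩
    obtain ⟨k', hk', rfl⟩ := List.mem_map.1 he
    have h₁ := sz_mem hk'
    have h₂ : ∀ v, sz (v % K x) ≤ sz (K x) := fun v => sz_nat_mono (Nat.mod_lt v (hKpos x)).le
    rw [sz_pair]
    have := h₂ (countStep (rules x) (states x) (edge x) (fun α x y => CI.lookup (α, x, y) T)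
      k'.1 k'.2.1 k'.2.2)
    omega
  · exact (hkeys.polyBdd_size.mul (((hkeys.polyBdd_size.add hK.polyBdd_size).add
      (.const 1)).add (.const 1))).add (.const 1)
  · intro x T hT
    refine (sz_le_of_forall hT.2).trans ?_
    have := hT.1.trans (length_lt_sz _).le
    gcongr

end PolyTime
/-! ### Counting improvisations with a given prefix -/

/-- The control improvisation instances with an unambiguous grammar as hard specification and an
automaton as soft specification. -/
noncomputable abbrev Inst : Type := Instance UCFG DFAs

noncomputable instance : Enc Inst := ⟨Instance.encode⟩

namespace Inst

/-- The grammar of an instance. -/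
def grammar (C : Inst) : CFG C.alphabet := C.hard.1

/-- The number of states of the automaton of an instance. -/
def dfaSize (C : Inst) : ℕ := C.soft.1

/-- The automaton of an instance. -/
def dfa (C : Inst) : DFA (Fin C.alphabet) (Fin C.dfaSize) := C.soft.2

open scoped Classical in
/-- The table of the accepting states. -/
noncomputable def acceptTable (C : Inst) : List ℕ :=
  (List.finRange C.dfaSize).map fun s => if s ∈ C.dfa.accept then 1 else 0

/-- The table of the transition function. -/
def stepTable (C : Inst) : List (List ℕ) :=
  (List.finRange C.dfaSize).map fun s =>
    (List.finRange C.alphabet).map fun a => (C.dfa.step s a : ℕ)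

/-- The rules of the grammar, with repetitions as in the instance. -/
def codedRules (C : Inst) : List (ℕ × List (ℕ × ℕ)) := C.grammar.rules.map codeRule

/-- The numerator of a non-negative rational number. -/
def ratNum (x : ℚ) : ℕ := x.num.natAbs

/-- The denominator of a rational number. -/
def ratDen (x : ℚ) : ℕ := x.den

/-- All parameters of an instance, with the same data as the instance. -/
noncomputable def parameters (C : Inst) : List ℕ × (List ℕ × ℕ × List (ℕ × List (ℕ × ℕ)) × Unit) ×
    (List ℕ × ℕ × List (List ℕ) × List ℕ × Unit) × List ℕ × List ℕ × (ℕ × ℕ) × (ℕ × ℕ) ×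
    (ℕ × ℕ) × Unit :=
  (List.range C.alphabet,
    (List.range C.grammar.numNT, (C.grammar.initial : ℕ), C.codedRules, ()),
    (List.range C.dfaSize, (C.dfa.start : ℕ), C.stepTable, C.acceptTable, ()),
    List.replicate C.m 0, List.replicate C.n 0, (ratNum C.ε, ratDen C.ε),
    (ratNum C.lo, ratDen C.lo), (ratNum C.hi, ratDen C.hi), ())

theorem enc_parameters (C : Inst) : enc C.parameters = enc C := by
  have hr : ∀ r : ContextFreeRule (Fin C.alphabet) (Fin C.grammar.numNT),
      enc (codeRule r) = CFG.encodeRule r := by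
    intro r
    simp only [codeRule, CFG.encodeRule, enc, List.map_map, Val.pair.injEq, true_and]
    congr 1
    refine List.map_congr_left fun s _ => ?_
    cases s <;> rfl
  have hR : enc C.codedRules = .ofList (C.grammar.rules.map CFG.encodeRule) := by
    simp only [enc, codedRules, List.map_map]
    congr 1
    exact List.map_congr_left fun r _ => hr r
  have hS : enc C.stepTable = .ofList ((List.finRange C.dfaSize).map fun s =>
      .ofList ((List.finRange C.alphabet).map fun a => .nat (C.dfa.step s a))) := by
    simp only [enc, stepTable, List.map_map, Function.comp_def]
  have hA : enc C.acceptTable = .ofList ((List.finRange C.dfaSize).map fun s =>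
      .nat (open scoped Classical in if s ∈ C.dfa.accept then 1 else 0)) := by
    simp only [enc, acceptTable, List.map_map]
    rfl
  have hu : ∀ n : ℕ, enc (List.replicate n 0 : List ℕ) = Val.unary n := by
    intro n; simp [enc, Val.unary]
  simp only [parameters, enc_pair, hR, hS, hA, hu]
  rfl

end Inst

namespace PolyTime
open Inst

theorem parameters : PolyTime parameters :=
  (PolyTime.id : PolyTime fun C : Inst => C).of_enc_eq enc_parameters

variable {γ : Type} [Enc γ] {c : γ → Inst}

@[fun_prop] theorem letters (h : PolyTime c) : PolyTime fun x => List.range (c x).alphabet :=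
  (parameters.comp h).fst'

@[fun_prop] theorem initial (h : PolyTime c) : PolyTime fun x => ((c x).grammar.initial : ℕ) := by
  have h' := parameters.comp h
  exact h'.snd'.fst'.snd'.fst'

@[fun_prop] theorem codedRules (h : PolyTime c) : PolyTime fun x => (c x).codedRules := by
  have h' := parameters.comp h
  exact h'.snd'.fst'.snd'.snd'.fst'

@[fun_prop] theorem dfaStates (h : PolyTime c) : PolyTime fun x => List.range (c x).dfaSize := by
  have h' := parameters.comp h
  exact h'.snd'.snd'.fst'.fst'

@[fun_prop] theorem dfaStart (h : PolyTime c) : PolyTime fun x => ((c x).dfa.start : ℕ) := by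
  have h' := parameters.comp h
  exact h'.snd'.snd'.fst'.snd'.fst'

@[fun_prop] theorem stepTable (h : PolyTime c) : PolyTime fun x => (c x).stepTable := by
  have h' := parameters.comp h
  exact h'.snd'.snd'.fst'.snd'.snd'.fst'

@[fun_prop] theorem acceptTable (h : PolyTime c) : PolyTime fun x => (c x).acceptTable := by
  have h' := parameters.comp h
  exact h'.snd'.snd'.fst'.snd'.snd'.snd'.fst'

@[fun_prop] theorem unary_m (h : PolyTime c) : PolyTime fun x => List.replicate (c x).m 0 := by
  have h' := parameters.comp h
  exact h'.snd'.snd'.snd'.fst'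

@[fun_prop] theorem unary_n (h : PolyTime c) : PolyTime fun x => List.replicate (c x).n 0 := by
  have h' := parameters.comp h
  exact h'.snd'.snd'.snd'.snd'.fst'

@[fun_prop] theorem ratNum_ε (h : PolyTime c) : PolyTime fun x => ratNum (c x).ε := by
  have h' := parameters.comp h
  exact h'.snd'.snd'.snd'.snd'.snd'.fst'.fst'

@[fun_prop] theorem ratDen_ε (h : PolyTime c) : PolyTime fun x => ratDen (c x).ε := by
  have h' := parameters.comp h
  exact h'.snd'.snd'.snd'.snd'.snd'.fst'.snd'

@[fun_prop] theorem ratNum_lo (h : PolyTime c) : PolyTime fun x => ratNum (c x).lo := by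
  have h' := parameters.comp h
  exact h'.snd'.snd'.snd'.snd'.snd'.snd'.fst'.fst'

@[fun_prop] theorem ratDen_lo (h : PolyTime c) : PolyTime fun x => ratDen (c x).lo := by
  have h' := parameters.comp h
  exact h'.snd'.snd'.snd'.snd'.snd'.snd'.fst'.snd'

@[fun_prop] theorem ratNum_hi (h : PolyTime c) : PolyTime fun x => ratNum (c x).hi := by
  have h' := parameters.comp h
  exact h'.snd'.snd'.snd'.snd'.snd'.snd'.snd'.fst'.fst'

@[fun_prop] theorem ratDen_hi (h : PolyTime c) : PolyTime fun x => ratDen (c x).hi := by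
  have h' := parameters.comp h
  exact h'.snd'.snd'.snd'.snd'.snd'.snd'.snd'.fst'.snd'

@[fun_prop] theorem minLength (h : PolyTime c) : PolyTime fun x => (c x).m := by
  have h' : (fun x => (c x).m) = fun x => (List.replicate (c x).m 0).length := by simp
  rw [h']; fun_prop

@[fun_prop] theorem range_maxLength_succ (h : PolyTime c) :
    PolyTime fun x => List.range ((c x).n + 1) := by
  have h' : (fun x => List.range ((c x).n + 1)) =
      fun x => List.range (0 :: List.replicate (c x).n 0).length := by simp
  rw [h']; fun_prop

@[fun_prop] theorem alphabet (h : PolyTime c) : PolyTime fun x => (c x).alphabet := by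
  have h' : (fun x => (c x).alphabet) = fun x => (List.range (c x).alphabet).length := by simp
  rw [h']; fun_prop

end PolyTime

namespace Inst

/-- The states of the automaton that reads words of length at most `n`: positions together with
states of the given automaton. -/
def states (C : Inst) : List (ℕ × ℕ) :=
  (List.range (C.n + 1)).flatMap fun i => (List.range C.dfaSize).map fun s => (i, s)

/-- The transitions of the automaton that reads words which agree with `u`. -/
def edge (C : Inst) (u : List ℕ) (a : ℕ) (x y : ℕ × ℕ) : ℕ :=
  bif eqb y.1 (x.1 + 1) && eqb y.2 (entryAt (entryAt C.stepTable x.2 []) a 0) &&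
    (Nat.ble u.length x.1 || eqb (entryAt u x.1 0) a) then 1 else 0

/-- The rules of the grammar, without repetitions. -/
def rules (C : Inst) : List (ℕ × List (ℕ × ℕ)) := nub C.codedRules

/-- The lists of symbols for which forests are counted. -/
def items (C : Inst) : List (List (ℕ × ℕ)) :=
  [(1, (C.grammar.initial : ℕ))] :: [] :: C.rules.flatMap fun r => r.2.tails

/-- A number that exceeds the number of words of length at most `n`. -/
def modulus (C : Inst) : ℕ := (C.alphabet + 1) ^ C.n + 1

/-- The algorithm that counts the improvisations with prefix `u` that are accepted (`b = 1`) or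
rejected (`b = 0`) by the automaton. Working modulo `C.modulus` keeps the numbers short: the true
result is smaller, but the number of forests for other words need not be. -/
noncomputable def countWords (C : Inst) (b : ℕ) (u : List ℕ) : ℕ :=
  ((C.states.filter fun y => Nat.ble C.m y.1 && Nat.ble u.length y.1 &&
      eqb (entryAt C.acceptTable y.2 0) b).map fun y =>
    lookup ([(1, (C.grammar.initial : ℕ))], (0, (C.dfa.start : ℕ)), y)
      (table C.rules C.states (C.edge u) C.modulus C.items)).sum % C.modulus

end Inst

namespace PolyTime
variable {γ : Type} [Enc γ] {c : γ → Inst}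

theorem pow_length {f : γ → ℕ} {α : Type} [Enc α] {l : γ → List α} (hf : PolyTime f)
    (hl : PolyTime l) : PolyTime fun x => f x ^ (l x).length := by
  have h : ∀ (k : ℕ) (m : List α), m.foldl (fun s _ => s * k) 1 = k ^ m.length := by
    intro k m
    induction m using List.reverseRecOn with
    | nil => simp
    | append_singleton m a ih => simp [ih, pow_succ]
  have hs : ∀ k e : ℕ, Nat.size (k ^ e) ≤ e * Nat.size k + 1 := by
    intro k e
    induction e with
    | zero => simp
    | succ e ih =>
      have := natSize_mul_le (k ^ e) k
      rw [pow_succ, Nat.succ_mul]; omega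
  refine (foldl (init := fun _ => 1) (step := fun x s _ => s * f x) hl (by fun_prop) (by fun_prop)
    (fun x => sz (l x) * sz (f x) + 2)
    ((hl.polyBdd_size.mul hf.polyBdd_size).add (.const 2)) ?_).of_enc_eq fun x => by rw [h]
  intro x l' hl'
  have h₁ := hl'.length_le.trans (length_lt_sz (l x)).le
  have h₂ := hs (f x) l'.length
  have h₃ : l'.length * Nat.size (f x) ≤ sz (l x) * sz (f x) :=
    Nat.mul_le_mul h₁ (by rw [sz_nat]; omega)
  rw [h, sz_nat]; omega

@[fun_prop] theorem states (h : PolyTime c) : PolyTime fun x => (c x).states := by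
  unfold Inst.states; fun_prop

@[fun_prop] theorem rules (h : PolyTime c) : PolyTime fun x => (c x).rules := by
  unfold Inst.rules; fun_prop

@[fun_prop] theorem items (h : PolyTime c) : PolyTime fun x => (c x).items := by
  unfold Inst.items; fun_prop

@[fun_prop] theorem modulus (h : PolyTime c) : PolyTime fun x => (c x).modulus := by
  have h' := (pow_length (f := fun x => (c x).alphabet + 1) (by fun_prop) (unary_n h)).add
    (const 1)
  simpa [Inst.modulus] using h'

@[fun_prop] theorem countWords {b : γ → ℕ} {u : γ → List ℕ} (h : PolyTime c) (hb : PolyTime b)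
    (hu : PolyTime u) : PolyTime fun x => (c x).countWords (b x) (u x) := by
  have hT : PolyTime fun x => CI.table (c x).rules (c x).states ((c x).edge (u x)) (c x).modulus
      (c x).items := by
    refine table (by fun_prop) (by fun_prop) ?_ (by fun_prop) (fun x => Nat.succ_pos _)
      (by fun_prop)
    unfold Inst.edge; fun_prop
  unfold Inst.countWords
  exact mod (sum (map (lookup (by fun_prop) (hT.comp fst)) (by fun_prop))) (by fun_prop)

end PolyTime

/-! ### Correctness of the count -/

/-- The words of length at most `n`. -/
def wordsUpTo (k : ℕ) : ℕ → Finset (List (Fin k))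
  | 0 => {[]}
  | n + 1 => insert [] ((Finset.univ ×ˢ wordsUpTo k n).image fun p => p.1 :: p.2)

theorem mem_wordsUpTo {k n : ℕ} {w : List (Fin k)} : w ∈ wordsUpTo k n ↔ w.length ≤ n := by
  induction n generalizing w with
  | zero => simp [wordsUpTo]
  | succ n ih => cases w <;> simp [wordsUpTo, ih]

theorem card_wordsUpTo_le (k n : ℕ) : (wordsUpTo k n).card ≤ (k + 1) ^ n := by
  induction n with
  | zero => simp [wordsUpTo]
  | succ n ih =>
    refine (Finset.card_insert_le _ _).trans ?_
    have h₁ : ((Finset.univ ×ˢ wordsUpTo k n).image fun p : Fin k × List (Fin k) =>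
        p.1 :: p.2).card ≤ k * (wordsUpTo k n).card :=
      Finset.card_image_le.trans (by simp)
    have h₂ : 1 ≤ (k + 1) ^ n := Nat.one_le_pow _ _ (Nat.succ_pos _)
    have h₃ := Nat.mul_le_mul_left k ih
    rw [pow_succ]; nlinarith

/-- The word `w`, placed at position `i`, agrees with the word `u` at the positions that both
have. -/
def Agrees (u : List ℕ) : ℕ → List ℕ → Prop
  | _, [] => True
  | i, a :: w => (u.length ≤ i ∨ u.getD i 0 = a) ∧ Agrees u (i + 1) w

theorem agrees_iff (u : List ℕ) (w : List ℕ) (i : ℕ) (h : u.length ≤ i + w.length) :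
    Agrees u i w ↔ u.drop i <+: w := by
  induction w generalizing i with
  | nil => simpa [Agrees] using h
  | cons a w ih =>
    rw [List.length_cons] at h
    rw [Agrees, ih (i + 1) (by omega)]
    rcases le_or_gt u.length i with hi | hi
    · simp [hi, List.drop_eq_nil_of_le hi, List.drop_eq_nil_of_le (hi.trans (Nat.le_succ i))]
    · rw [List.drop_eq_getElem_cons hi, List.cons_prefix_cons, List.getD_eq_getElem _ _ hi]
      simp [hi.not_ge]

namespace Inst
variable (C : Inst)

theorem mem_states {i s : ℕ} : (i, s) ∈ C.states ↔ i ≤ C.n ∧ s < C.dfaSize := by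
  simp [states]

theorem nodup_states : C.states.Nodup := by
  refine List.nodup_flatMap.2 ⟨fun i _ => List.nodup_range.map fun s t h => by simpa using h, ?_⟩
  refine List.nodup_range.imp fun {i j} h => ?_
  simp only [Function.onFun, List.disjoint_left, List.mem_map]
  rintro _ ⟨s, -, rfl⟩ ⟨t, -, ht⟩
  simp only [Prod.mk.injEq] at ht
  exact h ht.1.symm

theorem length_states : C.n + 1 ≤ C.states.length := by
  have h : 1 ≤ C.dfaSize := C.dfa.start.pos
  simpa [states] using h

theorem stepTable_entry (s : Fin C.dfaSize) (a : Fin C.alphabet) :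
    entryAt (entryAt C.stepTable s []) a 0 = C.dfa.step s a := by
  simp [entryAt_eq, stepTable]

theorem acceptTable_entry (s : Fin C.dfaSize) (b : Bool) :
    eqb (entryAt C.acceptTable s 0) b.toNat = true ↔ (s ∈ C.dfa.accept ↔ b = true) := by
  rw [entryAt_eq, acceptTable, List.getD_eq_getElem _ _ (by simp)]
  by_cases h : s ∈ C.dfa.accept <;> cases b <;> simp [eqb, h]

theorem edge_eq_zero {u : List ℕ} {a : Fin C.alphabet} {i : ℕ} {s : Fin C.dfaSize} {z : ℕ × ℕ}
    (h : z ≠ (i + 1, (C.dfa.step s a : ℕ))) : C.edge u a (i, s) z = 0 := by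
  rw [edge, stepTable_entry]
  rw [Ne, Prod.ext_iff, not_and_or] at h
  rcases h with h | h <;> simp [eqb, h]

open scoped Classical in
/-- The automaton is deterministic: it has at most one run on every word, which ends in the position
and the state that the word leads to. -/
theorem runs_eq (u : List ℕ) (w : List (Fin C.alphabet)) (i : ℕ) (hi : i ≤ C.n)
    (s : Fin C.dfaSize) (y : ℕ × ℕ) :
    runs C.states (C.edge u) (w.map (↑)) (i, s) y =
      if i + w.length ≤ C.n ∧ y = (i + w.length, (C.dfa.evalFrom s w : ℕ)) ∧
        Agrees u i (w.map (↑)) then 1 else 0 := by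
  induction w generalizing i s with
  | nil => simp [runs, Agrees, hi, eq_comm (a := y)]
  | cons a w ih =>
    rw [List.map_cons, runs]
    by_cases hi' : i + 1 ≤ C.n
    · rw [sum_map_eq_single C.nodup_states (x := (i + 1, (C.dfa.step s a : ℕ)))
        (C.mem_states.2 ⟨hi', Fin.is_lt _⟩)]
      · rw [ih _ hi', edge, stepTable_entry]
        have h₁ : i + 1 + w.length = i + (w.length + 1) := by omega
        simp only [List.length_cons, DFA.evalFrom_cons, Agrees, h₁]
        by_cases h₂ : u.length ≤ i ∨ u.getD i 0 = a
        · have h₃ : (Nat.ble u.length i || eqb (entryAt u i 0) (a : ℕ)) = true := by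
            simpa [eqb, entryAt_eq] using h₂
          simp only [h₃, eq_true h₂]
          simp [eqb]
        · have h₃ : (Nat.ble u.length i || eqb (entryAt u i 0) (a : ℕ)) = false := by
            rw [← Bool.not_eq_true]
            simpa [eqb, entryAt_eq] using h₂
          simp only [h₃, eq_false h₂]
          simp
      · intro z _ hz
        rw [C.edge_eq_zero hz, zero_mul]
    · have h₁ : ¬ i + (w.length + 1) ≤ C.n := by omega
      simp only [List.length_cons, h₁, false_and, if_false]
      refine List.sum_eq_zero fun t ht => ?_
      obtain ⟨z, hz, rfl⟩ := List.mem_map.1 ht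
      rw [C.edge_eq_zero, zero_mul]
      rintro rfl
      exact hi' (C.mem_states.1 hz).1

/-- The word `w` has an admissible length, starts with `u`, and is accepted or rejected by the
automaton as prescribed by `b`. -/
def Fits (b : Bool) (u : List ℕ) (w : List (Fin C.alphabet)) : Prop :=
  (C.m ≤ w.length ∧ w.length ≤ C.n) ∧ u <+: w.map (↑) ∧ (w ∈ C.dfa.accepts ↔ b = true)

open scoped Classical in
theorem sum_runs_final (b : Bool) (u : List ℕ) (w : List (Fin C.alphabet)) :
    ((C.states.filter fun y => Nat.ble C.m y.1 && Nat.ble u.length y.1 &&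
      eqb (entryAt C.acceptTable y.2 0) b.toNat).map fun y =>
        runs C.states (C.edge u) (w.map (↑)) (0, (C.dfa.start : ℕ)) y).sum =
      if C.Fits b u w then 1 else 0 := by
  simp only [C.runs_eq u w 0 (Nat.zero_le _), zero_add]
  have hpre : u.length ≤ w.length → (Agrees u 0 (w.map (↑)) ↔ u <+: w.map (↑)) := fun h => by
    rw [agrees_iff u _ 0 (by simpa using h), List.drop_zero]
  by_cases hw : C.Fits b u w
  · rw [if_pos hw]
    obtain ⟨⟨h₁, h₂⟩, h₃, h₄⟩ := hw
    have h₅ : u.length ≤ w.length := by simpa using h₃.length_le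
    rw [sum_map_eq_single (C.nodup_states.filter _) (x := (w.length, (C.dfa.eval w : ℕ)))]
    · rw [if_pos ⟨h₂, rfl, (hpre h₅).2 h₃⟩]
    · rw [List.mem_filter, Bool.and_eq_true, Bool.and_eq_true, acceptTable_entry]
      exact ⟨C.mem_states.2 ⟨h₂, Fin.is_lt _⟩, ⟨by simpa using h₁, by simpa using h₅⟩, h₄⟩
    · intro z _ hz
      exact if_neg fun h => hz h.2.1
  · rw [if_neg hw]
    refine List.sum_eq_zero fun t ht => ?_
    obtain ⟨y, hy, rfl⟩ := List.mem_map.1 ht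
    refine if_neg fun h => hw ?_
    obtain ⟨h₁, rfl, h₃⟩ := h
    rw [List.mem_filter, Bool.and_eq_true, Bool.and_eq_true] at hy
    obtain ⟨-, ⟨h₄, h₅⟩, h₆⟩ := hy
    have h₆ := (C.acceptTable_entry (C.dfa.eval w) b).1 h₆
    rw [Nat.ble_eq] at h₄ h₅
    exact ⟨⟨h₄, h₁⟩, (hpre h₅).1 h₃, h₆⟩

open scoped Classical in
/-- The improvisations that are accepted, or rejected, by the automaton. -/
noncomputable def words (b : Bool) : Finset (List (Fin C.alphabet)) :=
  (wordsUpTo C.alphabet C.n).filter fun w =>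
    w ∈ C.improvisations ∧ (w ∈ C.dfa.accepts ↔ b = true)

open scoped Classical in
theorem mem_words {b : Bool} {w : List (Fin C.alphabet)} :
    w ∈ C.words b ↔ w ∈ C.improvisations ∧ (w ∈ C.dfa.accepts ↔ b = true) := by
  rw [words, Finset.mem_filter, mem_wordsUpTo, and_iff_right_iff_imp]
  exact fun h => h.1.2.2

open scoped Classical in
theorem card_words_lt (b : Bool) : (C.words b).card < C.modulus :=
  Nat.lt_succ_of_le ((Finset.card_le_card (Finset.filter_subset _ _)).trans
    (card_wordsUpTo_le _ _))

theorem items_tail {s : ℕ × ℕ} {β : List (ℕ × ℕ)} (h : s :: β ∈ C.items) : β ∈ C.items := by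
  simp only [items, List.mem_cons, List.cons.injEq, List.mem_flatMap, List.mem_tails] at h ⊢
  rcases h with ⟨-, rfl⟩ | h | ⟨r, hr, h⟩
  · exact Or.inr (Or.inl rfl)
  · exact absurd h (by simp)
  · exact Or.inr (Or.inr ⟨r, hr, (List.suffix_cons s β).trans h⟩)

theorem items_rule {r : ℕ × List (ℕ × ℕ)} (h : r ∈ C.rules) : r.2 ∈ C.items := by
  simp only [items, List.mem_cons, List.mem_flatMap, List.mem_tails]
  exact Or.inr (Or.inr ⟨r, h, List.suffix_rfl⟩)

theorem rules_perm : C.rules.Perm (C.grammar.rules.dedup.map codeRule) := by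
  have h := mem_nub_and_nodup C.codedRules
  refine (List.perm_ext_iff_of_nodup h.2 ((List.nodup_dedup _).map codeRule_injective)).2 ?_
  intro r
  rw [h.1]
  simp [codedRules]

open scoped Classical in
/-- The counting algorithm is correct. -/
theorem countWords_eq (b : Bool) (u : List ℕ) :
    C.countWords b.toNat u = ((C.words b).filter fun w => u <+: w.map (↑)).card := by
  have hstart : (0, (C.dfa.start : ℕ)) ∈ C.states := C.mem_states.2 ⟨Nat.zero_le _, Fin.is_lt _⟩
  have hinit : [(1, (C.grammar.initial : ℕ))] ∈ C.items := List.mem_cons_self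
  set D := C.items.length * (C.states.length * C.states.length) with hD
  have hW : ((C.words b).filter fun w => u <+: w.map (↑)).card < C.modulus :=
    (Finset.card_le_card (Finset.filter_subset _ _)).trans_lt (C.card_words_lt b)
  rw [countWords, ← Nat.mod_eq_of_lt hW]
  have h₁ : ∀ y ∈ C.states, lookup ([(1, (C.grammar.initial : ℕ))], (0, (C.dfa.start : ℕ)), y)
      (table C.rules C.states (C.edge u) C.modulus C.items) ≡
        ((forests C.grammar.rules.dedup D [.nonterminal C.grammar.initial]).map fun F =>
          runs C.states (C.edge u) (F.yield.map (↑)) (0, (C.dfa.start : ℕ)) y).sum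
        [MOD C.modulus] := by
    intro y hy
    rw [lookup_table _ (fun r => C.items_rule) (fun s β => C.items_tail) hinit hstart hy,
      ← count_eq_sum_forests (C.edge u) _ C.rules_perm C.nodup_states D _ hstart y]
    exact Nat.mod_modEq _ _
  refine (sum_map_modEq fun y hy => h₁ y (List.mem_of_mem_filter hy)).trans ?_
  rw [sum_map_comm]
  simp only [sum_runs_final]
  let I : Finset (List (Symbol (Fin C.alphabet) (Fin C.grammar.numNT))) :=
    C.items.toFinset.preimage (List.map codeSymbol) (codeSymbol_injective.list_map.injOn)
  have hIcard : I.card ≤ C.items.length := by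
    refine le_trans ?_ (List.toFinset_card_le C.items)
    exact Finset.card_le_card_of_injOn (List.map codeSymbol)
      (fun α hα => by simpa [I] using hα) (codeSymbol_injective.list_map.injOn)
  have hmemI : ∀ α, α ∈ I ↔ α.map codeSymbol ∈ C.items := fun α => by simp [I]
  have key := countP_forests_eq_card C.grammar.toGrammar C.hard.2 C.grammar.rules.dedup
    (List.nodup_dedup _) (fun r => by simp) I (fun r hr => ?_) (fun s β h => ?_) ?_ C.n D ?_
    (C.Fits b u) (fun w hw => hw.1.2) ((C.words b).filter fun w => u <+: w.map (↑)) ?_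
  · exact congrArg (· % C.modulus) key
  · rw [hmemI]
    refine C.items_rule (r := codeRule r) (C.rules_perm.mem_iff.2 (List.mem_map_of_mem ?_))
    simpa using hr
  · rw [hmemI] at h ⊢
    exact C.items_tail h
  · rw [hmemI]; exact hinit
  · exact Nat.mul_le_mul hIcard (Nat.mul_le_mul C.length_states C.length_states)
  · intro w
    rw [Finset.mem_filter, mem_words]
    constructor
    · rintro ⟨⟨⟨h₁, h₂⟩, h₃⟩, h₄⟩; exact ⟨h₁, h₂, h₄, h₃⟩
    · rintro ⟨h₁, h₂, h₄, h₃⟩; exact ⟨⟨⟨h₁, h₂⟩, h₃⟩, h₄⟩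

end Inst
/-! ### Enumerating the words of a finite set by counting prefixes -/

section unrank
variable (c : List ℕ → ℕ) (letters : List ℕ)

/-- Given the numbers `c u` of words with prefix `u`, look for the letter that follows `u` in the
word with index `i` among the words with prefix `u`. The result consists of the index among the
words with the longer prefix, a bit telling whether there is such a letter, and the letter. -/
def nextLetter (u : List ℕ) (i : ℕ) : ℕ × Bool × ℕ :=
  letters.foldl (fun s a => bif s.2.1 then s else
    bif Nat.ble (c (u ++ [a])) s.1 then (s.1 - c (u ++ [a]), false, 0) else (s.1, true, a))
    (i, false, 0)

/-- Extend a prefix by one letter, if the word with the given index is longer than the prefix. The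
prefix itself, if it is one of the words, has the last index. -/
def unrankStep (s : List ℕ × ℕ) : List ℕ × ℕ :=
  bif (nextLetter c letters s.1 s.2).2.1 then
    (s.1 ++ [(nextLetter c letters s.1 s.2).2.2], (nextLetter c letters s.1 s.2).1) else s

/-- The word with index `i`. The length of the list `rounds` bounds the length of the word. -/
def unrank (rounds : List ℕ) (i : ℕ) : List ℕ :=
  (rounds.foldl (fun s _ => unrankStep c letters s) ([], i)).1

theorem nextLetter_fold_of_le (u : List ℕ) (l : List ℕ) (i : ℕ) :
    l.foldl (fun (s : ℕ × Bool × ℕ) a => bif s.2.1 then s else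
      bif Nat.ble (c (u ++ [a])) s.1 then (s.1 - c (u ++ [a]), false, 0) else (s.1, true, a))
      ((l.map fun a => c (u ++ [a])).sum + i, false, 0) = (i, false, 0) := by
  induction l with
  | nil => simp
  | cons a l ih =>
    rw [List.foldl_cons, List.map_cons, List.sum_cons]
    have h : Nat.ble (c (u ++ [a]))
        (c (u ++ [a]) + (l.map fun a => c (u ++ [a])).sum + i) = true := by
      rw [Nat.ble_eq]; omega
    have h' : c (u ++ [a]) + (l.map fun a => c (u ++ [a])).sum + i - c (u ++ [a]) =
        (l.map fun a => c (u ++ [a])).sum + i := by omega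
    simp only [cond_false, h, cond_true, h']
    exact ih

theorem nextLetter_fold_found (u : List ℕ) (l : List ℕ) (i a : ℕ) :
    l.foldl (fun (s : ℕ × Bool × ℕ) a => bif s.2.1 then s else
      bif Nat.ble (c (u ++ [a])) s.1 then (s.1 - c (u ++ [a]), false, 0) else (s.1, true, a))
      (i, true, a) = (i, true, a) := by
  induction l with
  | nil => simp
  | cons b l ih => simpa using ih

theorem unrankStep_none {u : List ℕ} {i : ℕ}
    (h : i = (letters.map fun a => c (u ++ [a])).sum) : unrankStep c letters (u, i) = (u, i) := by
  have := nextLetter_fold_of_le c u letters 0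
  rw [add_zero, ← h] at this
  simp only [unrankStep, nextLetter, this, cond_false]

theorem unrankStep_some {u l₁ l₂ : List ℕ} {i j a : ℕ} (hl : letters = l₁ ++ a :: l₂)
    (h : i = (l₁.map fun a => c (u ++ [a])).sum + j) (hj : j < c (u ++ [a])) :
    unrankStep c letters (u, i) = (u ++ [a], j) := by
  have h₂ : Nat.ble (c (u ++ [a])) j = false := by
    rw [← Bool.not_eq_true, Nat.ble_eq]; omega
  have : nextLetter c letters u i = (j, true, a) := by
    rw [nextLetter, hl, List.foldl_append, h, nextLetter_fold_of_le, List.foldl_cons]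
    simp only [cond_false, h₂]
    exact nextLetter_fold_found c u l₂ j a
  simp only [unrankStep, this, cond_true]

variable {c letters}

/-- The words with prefix `u` are `u` itself, if it is one of the words, and the words with the
prefixes that are longer by one letter. -/
theorem sum_card_prefix_le (W : Finset (List ℕ)) (hl : letters.Nodup)
    (hc : ∀ u, c u = (W.filter fun w => u <+: w).card) (u : List ℕ) :
    (letters.map fun a => c (u ++ [a])).sum + (if u ∈ W then 1 else 0) ≤ c u := by
  have h₁ : (letters.map fun a => c (u ++ [a])).sum =
      (letters.toFinset.biUnion fun a => W.filter fun w => u ++ [a] <+: w).card := by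
    rw [Finset.card_biUnion, ← List.sum_toFinset _ hl]
    · exact Finset.sum_congr rfl fun a _ => hc _
    · intro a _ b _ hab
      rw [Function.onFun, Finset.disjoint_left]
      intro w hw hw'
      have h := List.prefix_of_prefix_length_le (Finset.mem_filter.1 hw).2
        (Finset.mem_filter.1 hw').2 (by simp)
      exact hab (by simpa using h.eq_of_length (by simp))
  have h₂ : (if u ∈ W then 1 else 0) = (W.filter fun w => w = u).card := by
    split_ifs with h <;> simp [Finset.filter_eq', h]
  rw [h₁, h₂, hc, ← Finset.card_union_of_disjoint]
  · refine Finset.card_le_card fun w hw => ?_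
    simp only [Finset.mem_union, Finset.mem_biUnion, Finset.mem_filter] at hw ⊢
    rcases hw with ⟨a, -, h, h'⟩ | ⟨h, rfl⟩
    · exact ⟨h, (List.prefix_append _ _).trans h'⟩
    · exact ⟨h, List.prefix_rfl⟩
  · rw [Finset.disjoint_left]
    intro w hw hw'
    obtain ⟨-, rfl⟩ := Finset.mem_filter.1 hw'
    obtain ⟨a, -, ha⟩ := Finset.mem_biUnion.1 hw
    have := (Finset.mem_filter.1 ha).2.length_le
    simp at this

/-- Every word of the set has an index below the number of words. -/
theorem exists_unrank_eq (W : Finset (List ℕ)) (hl : letters.Nodup)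
    (hW : ∀ w ∈ W, ∀ a ∈ w, a ∈ letters)
    (hc : ∀ u, c u = (W.filter fun w => u <+: w).card) (rounds : List ℕ) {w : List ℕ} (hw : w ∈ W)
    (hlen : w.length ≤ rounds.length) : ∃ i < W.card, unrank c letters rounds i = w := by
  have key : ∀ (r : List ℕ) (u : List ℕ), u <+: w → w.length ≤ u.length + r.length →
      ∃ i < c u, (r.foldl (fun s _ => unrankStep c letters s) (u, i)).1 = w := by
    intro r
    induction r with
    | nil =>
      intro u hu hr
      have h := sum_card_prefix_le W hl hc u
      rw [hu.eq_of_length_le (by simpa using hr), if_pos hw] at h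
      exact ⟨0, by rw [hu.eq_of_length_le (by simpa using hr)]; omega,
        hu.eq_of_length_le (by simpa using hr)⟩
    | cons x r ih =>
      intro u hu hr
      obtain ⟨v, rfl⟩ := hu
      cases v with
      | nil =>
        rw [List.append_nil] at *
        have h := sum_card_prefix_le W hl hc u
        rw [if_pos hw] at h
        refine ⟨(letters.map fun a => c (u ++ [a])).sum, by omega, ?_⟩
        have hfix : ∀ r : List ℕ, (r.foldl (fun s _ => unrankStep c letters s)
            (u, (letters.map fun a => c (u ++ [a])).sum)).1 = u := by
          intro r
          induction r with
          | nil => rfl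
          | cons y r ih => rw [List.foldl_cons, unrankStep_none c letters rfl]; exact ih
        exact hfix _
      | cons a v =>
        obtain ⟨j, hj, h⟩ := ih (u ++ [a]) ⟨v, by simp⟩ (by
          simp only [List.length_append, List.length_cons, List.length_nil] at hr ⊢; omega)
        obtain ⟨l₁, l₂, hs⟩ := List.append_of_mem (hW _ hw a (by simp))
        refine ⟨(l₁.map fun a => c (u ++ [a])).sum + j, ?_, ?_⟩
        · have h₁ := sum_card_prefix_le W hl hc u
          rw [hs, List.map_append, List.sum_append, List.map_cons, List.sum_cons] at h₁
          omega
        · rw [List.foldl_cons, unrankStep_some c letters hs rfl hj]; exact h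
  obtain ⟨i, hi, h⟩ := key rounds [] List.nil_prefix (by simpa using hlen)
  rw [hc] at hi
  exact ⟨i, by simpa using hi, h⟩

theorem nextLetter_bounds (u : List ℕ) (i : ℕ) :
    (nextLetter c letters u i).1 ≤ i ∧
      ((nextLetter c letters u i).2.2 = 0 ∨ (nextLetter c letters u i).2.2 ∈ letters) := by
  unfold nextLetter
  induction letters using List.reverseRecOn with
  | nil => simp
  | append_singleton l a ih =>
    rw [List.foldl_append, List.foldl_cons, List.foldl_nil]
    generalize List.foldl _ _ l = s at ih ⊢
    obtain ⟨h₁, h₂⟩ := ih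
    cases s.2.1
    · simp only [cond_false]
      cases Nat.ble (c (u ++ [a])) s.1
      · simpa using h₁
      · simp only [cond_true]; exact ⟨(Nat.sub_le _ _).trans h₁, by simp⟩
    · simp only [cond_true]
      exact ⟨h₁, h₂.imp_right fun h => List.mem_append_left _ h⟩

end unrank

namespace PolyTime
variable {γ : Type} [Enc γ]

theorem nextLetter {c : γ → List ℕ → ℕ} {letters : γ → List ℕ} {u : γ → List ℕ} {i : γ → ℕ}
    (hc : PolyTime fun p : γ × List ℕ => c p.1 p.2) (hl : PolyTime letters) (hu : PolyTime u)
    (hi : PolyTime i) : PolyTime fun x => nextLetter (c x) (letters x) (u x) (i x) := by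
  have hc' : PolyTime fun p : γ × (ℕ × Bool × ℕ) × ℕ => c p.1 (u p.1 ++ [p.2.2]) :=
    hc.comp (g := fun p : γ × (ℕ × Bool × ℕ) × ℕ => (p.1, u p.1 ++ [p.2.2])) (by fun_prop)
  refine foldl_of_invariant (init := fun x => (i x, false, 0)) (step := fun x s a =>
      bif s.2.1 then s else bif Nat.ble (c x (u x ++ [a])) s.1 then
        (s.1 - c x (u x ++ [a]), false, 0) else (s.1, true, a)) hl (by fun_prop) ?_
    (fun x s => s.1 ≤ i x ∧ sz s.2.2 ≤ sz (letters x)) (fun x => ⟨le_rfl, ?_⟩) ?_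
    (fun x => sz (i x) + (sz (letters x) + 3) + 1)
    ((hi.polyBdd_size.add (hl.polyBdd_size.add (.const 3))).add (.const 1)) ?_
  · exact cond (by fun_prop) (by fun_prop) (cond (ble hc' (by fun_prop))
      (prodMk (sub (by fun_prop) hc') (by fun_prop)) (by fun_prop))
  · simpa [sz_nat] using one_le_sz (letters x)
  · intro x s a ha hs
    cases s.2.1
    · simp only [cond_false]
      cases Nat.ble _ s.1
      · exact ⟨hs.1, (sz_mem ha).le⟩
      · exact ⟨(Nat.sub_le _ _).trans hs.1, by simpa [sz_nat] using one_le_sz (letters x)⟩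
    · exact hs
  · intro x s hs
    have h₁ := sz_nat_mono hs.1
    have h₂ := sz_bool s.2.1
    have h₃ := hs.2
    rw [← Prod.mk.eta (p := s), sz_pair, ← Prod.mk.eta (p := s.2), sz_pair]
    omega

theorem unrank {c : γ → List ℕ → ℕ} {letters rounds : γ → List ℕ} {i : γ → ℕ}
    (hc : PolyTime fun p : γ × List ℕ => c p.1 p.2) (hl : PolyTime letters)
    (hr : PolyTime rounds) (hi : PolyTime i) :
    PolyTime fun x => unrank (c x) (letters x) (rounds x) (i x) := by
  have hn : PolyTime fun p : γ × (List ℕ × ℕ) × ℕ =>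
      CI.nextLetter (c p.1) (letters p.1) p.2.1.1 p.2.1.2 :=
    nextLetter (c := fun p : γ × (List ℕ × ℕ) × ℕ => c p.1)
      (hc.comp (g := fun q : (γ × (List ℕ × ℕ) × ℕ) × List ℕ => (q.1.1, q.2)) (by fun_prop))
      (by fun_prop) (by fun_prop) (by fun_prop)
  have hfold : PolyTime fun x => (rounds x).foldl
      (fun s _ => unrankStep (c x) (letters x) s) ([], i x) := by
    refine foldl (init := fun x => ([], i x))
      (step := fun x s _ => unrankStep (c x) (letters x) s) hr (by fun_prop) ?_
      (fun x => sz (rounds x) * (sz (letters x) + 1) + 1 + sz (i x) + 1)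
      ((((hr.polyBdd_size.mul (hl.polyBdd_size.add (.const 1))).add (.const 1)).add
        hi.polyBdd_size).add (.const 1)) ?_
    · exact cond hn.snd'.fst' (prodMk (append (by fun_prop) (cons hn.snd'.snd' (by fun_prop)))
        hn.fst') (by fun_prop)
    · intro x l' hl'
      have key : ∀ m : List ℕ,
          (m.foldl (fun s _ => unrankStep (c x) (letters x) s) ([], i x)).2 ≤ i x ∧
          (m.foldl (fun s _ => unrankStep (c x) (letters x) s) ([], i x)).1.length ≤ m.length ∧
          ∀ a ∈ (m.foldl (fun s _ => unrankStep (c x) (letters x) s) ([], i x)).1,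
            sz a ≤ sz (letters x) := by
        intro m
        induction m using List.reverseRecOn with
        | nil => simp
        | append_singleton m a ih =>
          rw [List.foldl_append, List.foldl_cons, List.foldl_nil]
          generalize List.foldl _ _ m = s at ih ⊢
          obtain ⟨h₁, h₂, h₃⟩ := ih
          obtain ⟨h₄, h₅⟩ := nextLetter_bounds (c := c x) (letters := letters x) s.1 s.2
          rw [unrankStep, List.length_append, List.length_singleton]
          cases (CI.nextLetter (c x) (letters x) s.1 s.2).2.1
          · exact ⟨h₁, h₂.trans (Nat.le_succ _), h₃⟩
          · simp only [cond_true]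
            refine ⟨h₄.trans h₁, by simpa using h₂, fun b hb => ?_⟩
            rcases List.mem_append.1 hb with hb | hb
            · exact h₃ b hb
            · rw [List.mem_singleton.1 hb]
              rcases h₅ with h | h
              · rw [h]; simpa [sz_nat] using one_le_sz (letters x)
              · exact (sz_mem h).le
      obtain ⟨h₁, h₂, h₃⟩ := key l'
      generalize List.foldl _ _ l' = s at h₁ h₂ h₃ ⊢
      have h₄ := sz_nat_mono h₁
      have h₅ := sz_le_of_forall h₃
      have h₆ : s.1.length * (sz (letters x) + 1) ≤ sz (rounds x) * (sz (letters x) + 1) :=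
        Nat.mul_le_mul_right _ (h₂.trans (hl'.length_le.trans (length_lt_sz _).le))
      rw [← Prod.mk.eta (p := s), sz_pair]
      omega
  exact hfold.fst'

end PolyTime
/-! ### Rejection sampling -/

open scoped ENNReal

/-- The `j` lowest binary digits of a number, the highest one first. -/
def bits : ℕ → ℕ → List Bool
  | 0, _ => []
  | j + 1, w => decide (2 ^ j ≤ w) :: bits j (w % 2 ^ j)

theorem length_bits (j w : ℕ) : (bits j w).length = j := by
  induction j generalizing w with
  | zero => rfl
  | succ j ih => simp [bits, ih]

theorem mod_two_pow_of_lt {j w : ℕ} (hw : w < 2 ^ (j + 1)) :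
    w = (decide (2 ^ j ≤ w)).toNat * 2 ^ j + w % 2 ^ j := by
  rw [pow_succ] at hw
  by_cases h : 2 ^ j ≤ w
  · have h₁ : w % 2 ^ j = w - 2 ^ j := by
      rw [Nat.mod_eq_sub_mod h, Nat.mod_eq_of_lt (by omega)]
    simp only [h, decide_true, Bool.toNat_true, one_mul, h₁]; omega
  · simp only [h, decide_false, Bool.toNat_false, zero_mul, zero_add]
    exact (Nat.mod_eq_of_lt (by omega)).symm

theorem bits_injOn {j v w : ℕ} (hv : v < 2 ^ j) (hw : w < 2 ^ j) (h : bits j v = bits j w) :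
    v = w := by
  induction j generalizing v w with
  | zero => simp at hv hw; omega
  | succ j ih =>
    simp only [bits, List.cons.injEq] at h
    have h₂ := ih (Nat.mod_lt _ (by positivity)) (Nat.mod_lt _ (by positivity)) h.2
    rw [mod_two_pow_of_lt hv, mod_two_pow_of_lt hw, h.1, h₂]

theorem exists_bits_eq (b : List Bool) : ∃ v < 2 ^ b.length, bits b.length v = b := by
  induction b with
  | nil => exact ⟨0, by simp, rfl⟩
  | cons a b ih =>
    obtain ⟨v, hv, h⟩ := ih
    have h2 : 0 < 2 ^ b.length := by positivity
    refine ⟨a.toNat * 2 ^ b.length + v, ?_, ?_⟩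
    · rw [List.length_cons, pow_succ]
      cases a <;> simp <;> omega
    · rw [List.length_cons, bits]
      have h₁ : (a.toNat * 2 ^ b.length + v) % 2 ^ b.length = v := by
        rw [add_comm, Nat.add_mul_mod_self_right, Nat.mod_eq_of_lt hv]
      rw [h₁, h]
      cases a <;> simp [hv]

/-- Every sequence of coin flips can be extended so that it has an initial segment consisting of
rejected blocks and an accepted block. -/
theorem exists_blocks (L M : ℕ) (hM : 0 < M) (hML : M ≤ 2 ^ L) (b : List Bool) :
    ∃ (bs : List ℕ) (v : ℕ) (r r' : List Bool), (∀ a ∈ bs, M ≤ a ∧ a < 2 ^ L) ∧ v < M ∧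
      ((bs.map (bits L)).flatten ++ bits L v) ++ r = b ++ r' := by
  rcases Nat.eq_zero_or_pos L with rfl | hL
  · exact ⟨[], 0, b, [], by simp, hM, by simp [bits]⟩
  induction hn : b.length using Nat.strong_induction_on generalizing b with
  | _ n ih =>
    subst hn
    rcases eq_or_ne b [] with rfl | hb
    · exact ⟨[], 0, [], bits L 0, by simp, hM, by simp⟩
    set B := b ++ List.replicate L false with hB
    have hlen : (B.take L).length = L := by simp [hB]
    obtain ⟨v, hv, hvB⟩ := exists_bits_eq (B.take L)
    rw [hlen] at hv hvB
    rcases lt_or_ge v M with hvM | hvM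
    · exact ⟨[], v, B.drop L, List.replicate L false, by simp, hvM, by
        simp only [List.map_nil, List.flatten_nil, List.nil_append, hvB, List.take_append_drop, hB]⟩
    · have hb' : 0 < b.length := List.length_pos_iff.2 hb
      obtain ⟨bs, v', r, r', h₁, h₂, h₃⟩ := ih (b.drop L).length (by
        rw [List.length_drop]; omega) (b.drop L) rfl
      have h₄ : B.take L ++ b.drop L = b ++ List.replicate (L - b.length) false := by
        rw [hB, List.take_append, List.take_replicate]
        rcases le_total L b.length with h | h
        · have : L - b.length = 0 := by omega
          simp [this]
        · rw [List.drop_eq_nil_of_le h, List.take_of_length_le h, min_eq_left (by omega)]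
          simp
      refine ⟨v :: bs, v', r, List.replicate (L - b.length) false ++ r', ?_, h₂, ?_⟩
      · intro a ha
        rcases List.mem_cons.1 ha with rfl | ha
        · exact ⟨hvM, hv⟩
        · exact h₁ a ha
      · rw [List.map_cons, List.flatten_cons, hvB, ← List.append_assoc b, ← h₄]
        simp only [List.append_assoc] at h₃ ⊢
        rw [h₃]

/-- The sequence of coin flips determines the rejected blocks and the accepted block. -/
theorem flatten_bits_inj {L M : ℕ} (bs cs : List ℕ) (v w : ℕ)
    (hbs : ∀ a ∈ bs, M ≤ a ∧ a < 2 ^ L) (hcs : ∀ a ∈ cs, M ≤ a ∧ a < 2 ^ L) (hv : v < M)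
    (hw : w < M) (hML : M ≤ 2 ^ L)
    (h : (bs.map (bits L)).flatten ++ bits L v = (cs.map (bits L)).flatten ++ bits L w) :
    bs = cs ∧ v = w := by
  have hsingle : ∀ {x y : ℕ} {s t : List Bool}, x < 2 ^ L → y < 2 ^ L →
      bits L x ++ s = bits L y ++ t → x = y ∧ s = t := by
    intro x y s t hx hy hxy
    have := List.append_inj hxy (by rw [length_bits, length_bits])
    exact ⟨bits_injOn hx hy this.1, this.2⟩
  induction bs generalizing cs with
  | nil =>
    cases cs with
    | nil =>
      have := hsingle (s := []) (t := []) (hv.trans_le hML) (hw.trans_le hML) (by simpa using h)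
      exact ⟨rfl, this.1⟩
    | cons c cs =>
      have hc := hcs c List.mem_cons_self
      have := hsingle (s := []) (t := (cs.map (bits L)).flatten ++ bits L w)
        (hv.trans_le hML) hc.2 (by simpa using h)
      omega
  | cons b bs ih =>
    have hb := hbs b List.mem_cons_self
    cases cs with
    | nil =>
      have := hsingle (s := (bs.map (bits L)).flatten ++ bits L v) (t := [])
        hb.2 (hw.trans_le hML) (by simpa using h)
      omega
    | cons c cs =>
      have hc := hcs c List.mem_cons_self
      have h₁ := hsingle (s := (bs.map (bits L)).flatten ++ bits L v)
        (t := (cs.map (bits L)).flatten ++ bits L w) hb.2 hc.2 (by simpa using h)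
      have h₂ := ih cs (fun a ha => hbs a (List.mem_cons_of_mem _ ha))
        (fun a ha => hcs a (List.mem_cons_of_mem _ ha)) h₁.2
      exact ⟨by rw [h₁.1, h₂.1], h₂.2⟩

/-- The program `G` on the argument `x` draws blocks of `L` bits until the value of the block is
less than `M`; then it outputs a function of this value. Every block takes time at most `T`. -/
structure IsRejectionSampler (G : Code) (x : Val) (L M T : ℕ) (out : ℕ → Val) : Prop where
  pos : 0 < M
  le : M ≤ 2 ^ L
  lt : 2 ^ L < 2 * M
  run : ∀ (bs : List ℕ) (v : ℕ), (∀ a ∈ bs, M ≤ a ∧ a < 2 ^ L) → v < M →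
    ∃ t ≤ (bs.length + 1) * T, Run G x ((bs.map (bits L)).flatten ++ bits L v) (out v) t

namespace IsRejectionSampler
variable {G : Code} {x : Val} {L M T : ℕ} {out : ℕ → Val}

/-- The rejected blocks. -/
def rejected {R : ℕ} (M : ℕ) {j : ℕ} (f : Fin j → Fin R) : List ℕ := List.ofFn fun i => M + f i

theorem rejected_bounds {j : ℕ} (h : M ≤ 2 ^ L) (f : Fin j → Fin (2 ^ L - M)) :
    ∀ a ∈ rejected M f, M ≤ a ∧ a < 2 ^ L := by
  intro a ha
  obtain ⟨i, rfl⟩ := List.mem_ofFn.1 ha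
  have := (f i).is_lt
  omega

/-- The halting runs correspond to the finite sequences of rejected blocks followed by an accepted
block. -/
theorem exists_equiv (h : IsRejectionSampler G x L M T out) :
    ∃ e : ((j : ℕ) × (Fin j → Fin (2 ^ L - M)) × Fin M) ≃ G.HaltingRun x, ∀ i,
      (e i).prob = (2⁻¹ ^ L) ^ (i.1 + 1) ∧ (e i).1.2.1 = out i.2.2 ∧
        (e i).1.2.2 ≤ (i.1 + 1) * T := by
  choose! t ht hrun using h.run
  let φ : ((j : ℕ) × (Fin j → Fin (2 ^ L - M)) × Fin M) → G.HaltingRun x := fun i =>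
    ⟨(((rejected M i.2.1).map (bits L)).flatten ++ bits L i.2.2, out i.2.2,
      t (rejected M i.2.1) i.2.2), hrun _ _ (rejected_bounds h.le i.2.1) i.2.2.is_lt⟩
  have hφ : Function.Bijective φ := by
    constructor
    · rintro ⟨j, f, v⟩ ⟨k, g, w⟩ hfg
      have h₁ := congrArg (fun r => r.1.1) hfg
      obtain ⟨h₂, h₃⟩ := flatten_bits_inj _ _ _ _ (rejected_bounds h.le f)
        (rejected_bounds h.le g) v.is_lt w.is_lt h.le h₁
      have hjk : j = k := by simpa [rejected] using congrArg List.length h₂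
      subst hjk
      have hfg' : f = g := by
        funext i
        have := congrFun (List.ofFn_injective h₂) i
        exact Fin.ext (by omega)
      rw [hfg', Fin.ext h₃]
    · rintro ⟨⟨b, y, s⟩, hr⟩
      obtain ⟨bs, v, r, r', h₁, h₂, h₃⟩ := exists_blocks L M h.pos h.le b
      have hdet := (hrun bs v h₁ h₂).deterministic hr h₃
      obtain ⟨f, hf⟩ : ∃ f : Fin bs.length → Fin (2 ^ L - M), rejected M f = bs := by
        refine ⟨fun i => ⟨bs.get i - M, by have := h₁ (bs.get i) (List.get_mem _ _); omega⟩, ?_⟩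
        refine List.ext_get (by simp [rejected]) fun i hi hi' => ?_
        have := h₁ (bs.get ⟨i, hi'⟩) (List.get_mem _ _)
        simp only [rejected, List.get_eq_getElem, List.getElem_ofFn] at this ⊢
        omega
      refine ⟨⟨bs.length, f, ⟨v, h₂⟩⟩, Subtype.ext ?_⟩
      simp only [φ, hf, hdet.1, hdet.2.1, hdet.2.2]
  refine ⟨Equiv.ofBijective φ hφ, fun i => ⟨?_, rfl, ?_⟩⟩
  · have hl : ∀ bs : List ℕ, ((bs.map (bits L)).flatten).length = L * bs.length := by
      intro bs
      induction bs with
      | nil => simp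
      | cons b bs ih => simp [ih, length_bits]; ring
    have : (φ i).1.1.length = L * (i.1 + 1) := by
      simp only [φ, List.length_append, hl, length_bits, rejected, List.length_ofFn]; ring
    rw [Equiv.ofBijective_apply, Code.HaltingRun.prob, this, pow_mul]
  · have := ht (rejected M i.2.1) i.2.2 (rejected_bounds h.le i.2.1) i.2.2.is_lt
    rwa [rejected, List.length_ofFn] at this

theorem reject_prob (h : IsRejectionSampler G x L M T out) :
    ((2 ^ L - M : ℕ) : ℝ≥0∞) * 2⁻¹ ^ L = 1 - (M : ℝ≥0∞) * 2⁻¹ ^ L ∧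
      (M : ℝ≥0∞) * 2⁻¹ ^ L ≤ 1 ∧ ((2 ^ L - M : ℕ) : ℝ≥0∞) * 2⁻¹ ^ L ≤ 2⁻¹ := by
  have h₁ : ((2 ^ L : ℕ) : ℝ≥0∞) * 2⁻¹ ^ L = 1 := by
    rw [Nat.cast_pow, ← mul_pow, Nat.cast_ofNat, ENNReal.mul_inv_cancel (by simp) (by simp),
      one_pow]
  have h₂ : ((2 ^ L - M : ℕ) : ℝ≥0∞) * 2⁻¹ ^ L + (M : ℝ≥0∞) * 2⁻¹ ^ L = 1 := by
    rw [← add_mul, ← Nat.cast_add, Nat.sub_add_cancel h.le, h₁]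
  have hM : (M : ℝ≥0∞) * 2⁻¹ ^ L ≤ 1 := h₂ ▸ le_add_self
  refine ⟨ENNReal.eq_sub_of_add_eq (ne_top_of_le_ne_top ENNReal.one_ne_top hM) h₂, hM, ?_⟩
  have h₃ : ((2 ^ L - M : ℕ) : ℝ≥0∞) * 2⁻¹ ^ L * 2 ≤ 1 := by
    rw [mul_right_comm, ← h₁]
    gcongr
    have := h.le
    have := h.lt
    exact_mod_cast (by omega : (2 ^ L - M) * 2 ≤ 2 ^ L)
  rwa [← ENNReal.le_div_iff_mul_le (by simp) (by simp), one_div] at h₃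

/-- Summation over all halting runs: the value of the accepted block is uniformly distributed. -/
theorem tsum_eq (h : IsRejectionSampler G x L M T out) (f : Fin M → ℝ≥0∞) :
    ∑' i : (j : ℕ) × (Fin j → Fin (2 ^ L - M)) × Fin M,
      (2⁻¹ ^ L : ℝ≥0∞) ^ (i.1 + 1) * f i.2.2 = (∑ v, f v) / M := by
  obtain ⟨h₁, h₂, -⟩ := h.reject_prob
  have hp : (2⁻¹ ^ L : ℝ≥0∞) ≠ 0 := by simp
  have hM : (M : ℝ≥0∞) ≠ 0 := by simpa using h.pos.ne'
  have hj : ∀ j : ℕ, ∑' i : (Fin j → Fin (2 ^ L - M)) × Fin M,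
      (2⁻¹ ^ L : ℝ≥0∞) ^ (j + 1) * f i.2 =
        (((2 ^ L - M : ℕ) : ℝ≥0∞) * 2⁻¹ ^ L) ^ j * (2⁻¹ ^ L * ∑ v, f v) := by
    intro j
    rw [tsum_fintype, Fintype.sum_prod_type]
    simp only [← Finset.mul_sum, Finset.sum_const, Finset.card_univ, Fintype.card_fun,
      Fintype.card_fin, nsmul_eq_mul, Nat.cast_pow, mul_pow, pow_succ]
    ring
  rw [ENNReal.tsum_sigma']
  simp only [hj]
  rw [ENNReal.tsum_mul_right, ENNReal.tsum_geometric, h₁,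
    ENNReal.sub_sub_cancel ENNReal.one_ne_top h₂, ENNReal.mul_inv (Or.inl hM) (Or.inr hp),
    ENNReal.div_eq_inv_mul, mul_assoc, ← mul_assoc (2⁻¹ ^ L)⁻¹,
    ENNReal.inv_mul_cancel hp (by simp), one_mul]

theorem haltProb_eq (h : IsRejectionSampler G x L M T out) : G.haltProb x = 1 := by
  obtain ⟨e, he⟩ := h.exists_equiv
  have hM : (M : ℝ≥0∞) ≠ 0 := by simpa using h.pos.ne'
  rw [Code.haltProb, ← e.tsum_eq]
  simp only [fun i => (he i).1]
  simpa [ENNReal.div_self hM] using h.tsum_eq fun _ => 1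

open scoped Classical in
theorem outProb_eq (h : IsRejectionSampler G x L M T out) (y : Val) :
    G.outProb x y = (((Finset.range M).filter fun v => out v = y).card : ℝ≥0∞) / M := by
  obtain ⟨e, he⟩ := h.exists_equiv
  rw [Code.outProb, ← e.tsum_eq]
  simp only [fun i => (he i).1, fun i => (he i).2.1]
  have h₁ := h.tsum_eq fun v => if out v = y then 1 else 0
  simp only [mul_ite, mul_one, mul_zero] at h₁
  rw [h₁, Fin.sum_univ_eq_sum_range (fun v => if out v = y then (1 : ℝ≥0∞) else 0) M,
    Finset.sum_boole]

/-- The expected number of blocks. The bound is far from optimal; it follows by comparison with the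
geometric series of `3/4`. -/
theorem tsum_succ_mul_geometric_le {r : ℝ≥0∞} (hr : r ≤ 2⁻¹) :
    ∑' j : ℕ, ((j + 1 : ℕ) : ℝ≥0∞) * r ^ j ≤ 8 := by
  have h₁ : ∀ j : ℕ, (j + 1) * 2 ^ j ≤ 2 * 3 ^ j := by
    intro j
    induction j with
    | zero => simp
    | succ j ih =>
      have : 2 ^ j ≤ 3 ^ j := Nat.pow_le_pow_left (by omega) j
      rw [pow_succ, pow_succ]; nlinarith
  have h₂ : ∀ j : ℕ, ((j + 1 : ℕ) : ℝ≥0∞) * r ^ j ≤ 2 * (3 * 4⁻¹) ^ j := by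
    intro j
    have h₃ : (2⁻¹ : ℝ≥0∞) = 2 * 4⁻¹ := by
      rw [show (4 : ℝ≥0∞) = 2 * 2 by norm_num, ENNReal.mul_inv (by simp) (by simp), ← mul_assoc,
        ENNReal.mul_inv_cancel (by simp) (by simp), one_mul]
    calc ((j + 1 : ℕ) : ℝ≥0∞) * r ^ j ≤ ((j + 1 : ℕ) : ℝ≥0∞) * (2 * 4⁻¹) ^ j := by
          rw [← h₃]; gcongr
      _ = (((j + 1) * 2 ^ j : ℕ) : ℝ≥0∞) * 4⁻¹ ^ j := by push_cast; ring
      _ ≤ ((2 * 3 ^ j : ℕ) : ℝ≥0∞) * 4⁻¹ ^ j :=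
        mul_le_mul' (by exact_mod_cast h₁ j) le_rfl
      _ = 2 * (3 * 4⁻¹) ^ j := by push_cast; ring
  refine (ENNReal.tsum_le_tsum h₂).trans ?_
  have h₄ : (1 - 3 * 4⁻¹ : ℝ≥0∞) = 4⁻¹ := by
    refine (ENNReal.eq_sub_of_add_eq (by finiteness) ?_).symm
    calc (4⁻¹ + 3 * 4⁻¹ : ℝ≥0∞) = 4 * 4⁻¹ := by ring
      _ = 1 := ENNReal.mul_inv_cancel (by simp) (by simp)
  rw [ENNReal.tsum_mul_left, ENNReal.tsum_geometric, h₄, inv_inv]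
  norm_num

theorem expectedTime_le (h : IsRejectionSampler G x L M T out) :
    G.expectedTime x ≤ (8 * T : ℕ) := by
  obtain ⟨e, he⟩ := h.exists_equiv
  obtain ⟨-, h₂, h₃⟩ := h.reject_prob
  rw [Code.expectedTime, h.haltProb_eq, tsub_self, mul_zero, add_zero, ← e.tsum_eq]
  have h₄ : ∀ i, (e i).prob * ((e i).1.2.2 : ℝ≥0∞) ≤
      (2⁻¹ ^ L : ℝ≥0∞) ^ (i.1 + 1) * (((i.1 + 1) * T : ℕ) : ℝ≥0∞) := by
    intro i
    rw [(he i).1]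
    gcongr
    exact (he i).2.2
  refine (ENNReal.tsum_le_tsum h₄).trans ?_
  have hj : ∀ j : ℕ, ∑' _ : (Fin j → Fin (2 ^ L - M)) × Fin M,
      (2⁻¹ ^ L : ℝ≥0∞) ^ (j + 1) * (((j + 1) * T : ℕ) : ℝ≥0∞) =
        ((j + 1 : ℕ) : ℝ≥0∞) * (((2 ^ L - M : ℕ) : ℝ≥0∞) * 2⁻¹ ^ L) ^ j *
          ((M : ℝ≥0∞) * 2⁻¹ ^ L * T) := by
    intro j
    rw [tsum_fintype]
    simp only [Finset.sum_const, Finset.card_univ, Fintype.card_prod, Fintype.card_fun,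
      Fintype.card_fin, nsmul_eq_mul, Nat.cast_mul, Nat.cast_pow, mul_pow, pow_succ]
    ring
  rw [ENNReal.tsum_sigma']
  simp only [hj]
  rw [ENNReal.tsum_mul_right, Nat.cast_mul]
  refine mul_le_mul' (by simpa using tsum_succ_mul_geometric_le h₃) ?_
  calc (M : ℝ≥0∞) * 2⁻¹ ^ L * T ≤ 1 * T := by gcongr
    _ = T := one_mul _

end IsRejectionSampler
/-! ### A program for rejection sampling -/

/-- A polynomial bound in terms of any bound `Z` for the size of the argument. -/
theorem PolyTime.exists_polynomial {α β : Type} [Enc α] [Enc β] {f : α → β} (hf : PolyTime f) :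
    ∃ (c : Code) (p : Polynomial ℕ), ∀ a (Z : ℕ), sz a ≤ Z →
      ∃ t ≤ p.eval Z, Run c (enc a) [] (enc (f a)) t := by
  obtain ⟨c, u, ⟨p, hp⟩, h⟩ := hf
  refine ⟨c, p, fun a Z hZ => ?_⟩
  obtain ⟨t, ht, hr⟩ := h a
  exact ⟨t, (ht.trans (hp a)).trans (polynomial_eval_mono p hZ), hr⟩

section sampler
variable {γ : Type} [Enc γ]

/-- The loop that draws a block of bits: while `r < m`, double `r` and append a random bit to
`v`. -/
theorem exists_block_code (γ : Type) [Enc γ] : ∃ (c : Code) (p : Polynomial ℕ),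
    ∀ (x : γ) (m Z : ℕ), sz (x, m) + 2 * sz (2 * m) + 2 ≤ Z → ∀ (j w r v : ℕ), w < 2 ^ j → v < r →
      (∀ i < j, r * 2 ^ i < m) → m ≤ r * 2 ^ j → r * 2 ^ j ≤ 2 * m →
      ∃ t ≤ (j + 1) * p.eval Z, Run c (enc ((x, m), (r, v))) (bits j w)
        (enc ((x, m), (r * 2 ^ j, v * 2 ^ j + w))) t := by
  obtain ⟨ct, pt, ht⟩ := (show PolyTime fun p : (γ × ℕ) × ℕ × ℕ => !(Nat.ble p.1.2 p.2.1) by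
    fun_prop).exists_polynomial
  obtain ⟨cd, pd, hd⟩ := (show PolyTime fun p : ((γ × ℕ) × ℕ × ℕ) × ℕ =>
    (p.1.1, (2 * p.1.2.1, 2 * p.1.2.2 + p.2)) by fun_prop).exists_polynomial
  refine ⟨.loop ct (.comp cd (.pair (.prim .id) .flip)),
    pt + pd.comp (Polynomial.X + 3) + 3 * Polynomial.X + 10, fun x m Z hZ j => ?_⟩
  simp only [Polynomial.eval_add, Polynomial.eval_comp, Polynomial.eval_mul, Polynomial.eval_X,
    Polynomial.eval_ofNat]
  have hsz : ∀ r v, v < r → r ≤ 2 * m → sz ((x, m), (r, v)) ≤ Z := by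
    intro r v hv hr
    have h₁ := sz_nat_mono hr
    have h₂ := sz_nat_mono (hv.le.trans hr)
    rw [sz_pair (x, m), sz_pair r]; omega
  induction j with
  | zero =>
    intro w r v hw hv _ hm hr
    obtain ⟨t, htt, hrun⟩ := ht ((x, m), (r, v)) Z (hsz r v hv (by simpa using hr))
    have hw0 : w = 0 := by simpa using hw
    have htest : Nat.ble m r = true := by simpa using hm
    rw [htest] at hrun
    refine ⟨t + 1, by omega, ?_⟩
    rw [hw0, pow_zero, mul_one, mul_one, add_zero]
    exact .loop_done hrun
  | succ j ih =>
    intro w r v hw hv hlt hm hr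
    have hr0 : r < m := by simpa using hlt 0 (Nat.succ_pos _)
    have hs := hsz r v hv (by omega)
    obtain ⟨t, htt, hrun⟩ := ht ((x, m), (r, v)) Z hs
    have htest : Nat.ble m r = false := by
      rw [← Bool.not_eq_true, Nat.ble_eq]; omega
    rw [htest] at hrun
    set a : Bool := decide (2 ^ j ≤ w) with ha
    have hsa : sz a.toNat ≤ 2 := by cases a <;> decide
    obtain ⟨t', htt', hrun'⟩ := hd (((x, m), (r, v)), a.toNat) (Z + 3) (by rw [sz_pair]; omega)
    have hpow : 2 * r * 2 ^ j = r * 2 ^ (j + 1) := by rw [pow_succ]; ring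
    have hva : 2 * v + a.toNat < 2 * r := by cases a <;> simp <;> omega
    obtain ⟨t'', htt'', hrun''⟩ := ih (w % 2 ^ j) (2 * r) (2 * v + a.toNat)
      (Nat.mod_lt _ (by positivity)) hva (fun i hi => by
        have := hlt (i + 1) (by omega)
        rw [pow_succ] at this; linarith) (hpow ▸ hm) (hpow ▸ hr)
    have hres : (2 * v + a.toNat) * 2 ^ j + w % 2 ^ j = v * 2 ^ (j + 1) + w := by
      conv_rhs => rw [mod_two_pow_of_lt hw]
      rw [pow_succ]; ring
    rw [hpow, hres] at hrun''
    refine ⟨_, ?_, .loop_step hrun (by simp [enc])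
      (.comp (.pair (.prim .id _) (.flip _ a)) hrun') hrun''⟩
    have e₁ : (enc ((x, m), (r, v))).size ≤ Z := hs
    have e₂ : (Val.nat a.toNat).size ≤ 2 := hsa
    simp only [Prim.cost, Prim.apply]
    rw [Nat.succ_mul]
    omega

/-- Rejection sampling: for polynomial-time functions `M` and `out` there is a program that outputs
`out x v`, where `v < M x` is uniformly distributed, and every block of random bits takes time
polynomial in the size of `x`. -/
theorem exists_rejectionSampler {β : Type} [Enc β] {M : γ → ℕ} {out : γ × ℕ → β}
    (hM : PolyTime M) (hpos : ∀ x, 0 < M x) (hout : PolyTime out) :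
    ∃ (G : Code) (T : γ → ℕ), PolyBdd T ∧ ∀ x,
      IsRejectionSampler (.comp G (.prim (.const (enc x)))) (.nat 0) (Nat.clog 2 (M x)) (M x) (T x)
        fun v => enc (out (x, v)) := by
  obtain ⟨cb, pb, hb⟩ := exists_block_code γ
  obtain ⟨ct, pt, ht⟩ := (show PolyTime fun p : (γ × ℕ) × ℕ × ℕ => Nat.ble p.1.2 p.2.2 by
    fun_prop).exists_polynomial
  obtain ⟨cr, pr, hr⟩ := (show PolyTime fun p : (γ × ℕ) × ℕ × ℕ => (p.1, ((1 : ℕ), (0 : ℕ))) by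
    fun_prop).exists_polynomial
  obtain ⟨ci, pi, hi⟩ := (show PolyTime fun x : γ => ((x, M x), ((0 : ℕ), M x)) by
    fun_prop).exists_polynomial
  obtain ⟨co, po, ho⟩ := (show PolyTime fun p : (γ × ℕ) × ℕ × ℕ => out (p.1.1, p.2.2) by
    fun_prop).exists_polynomial
  let Z : γ → ℕ := fun x => sz (x, M x) + 2 * sz (2 * M x) + 2
  have hZ : PolyBdd Z :=
    ((show PolyTime fun x => (x, M x) by fun_prop).polyBdd_size.add
      ((PolyBdd.const 2).mul (show PolyTime fun x => 2 * M x by fun_prop).polyBdd_size)).add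
      (.const 2)
  let τ : γ → ℕ := fun x => pt.eval (Z x) + (pr.eval (Z x) + (sz (M x) + 1) * pb.eval (Z x)) + 2
  have hτ : PolyBdd τ := ((hZ.eval pt).add ((hZ.eval pr).add
    ((hM.polyBdd_size.add (.const 1)).mul (hZ.eval pb)))).add (.const 2)
  refine ⟨.comp co (.comp (.loop ct (.comp cb cr)) ci),
    fun x => 2 * τ x + pt.eval (Z x) + (sz x + 2 + pi.eval (Z x) + po.eval (Z x) + 5), ?_, ?_⟩
  · exact (((PolyBdd.const 2).mul hτ).add (hZ.eval pt)).add
      ((((PolyBdd.size.add (.const 2)).add (hZ.eval pi)).add (hZ.eval po)).add (.const 5))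
  intro x
  set L := Nat.clog 2 (M x) with hL
  have hle : M x ≤ 2 ^ L := Nat.le_pow_clog (by omega) _
  have hlow : ∀ i < L, 2 ^ i < M x := fun i hi => Nat.pow_lt_of_lt_clog hi
  have hlt : 2 ^ L < 2 * M x := by
    rcases Nat.eq_zero_or_pos L with h | h
    · have := hpos x
      rw [h]; omega
    · have := hlow (L - 1) (by omega)
      rw [show L = L - 1 + 1 by omega, pow_succ]; omega
  have hLsz : L + 1 ≤ sz (M x) + 1 := by
    have : L ≤ Nat.size (M x) := Nat.clog_le_of_le_pow (Nat.lt_size_self _).le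
    rw [sz_nat]; omega
  have hsz : ∀ r v, v ≤ 2 * M x → r ≤ 2 * M x → sz ((x, M x), (r, v)) ≤ Z x := by
    intro r v hv hr
    have h₁ := sz_nat_mono hr
    have h₂ := sz_nat_mono hv
    rw [sz_pair (x, M x), sz_pair r]; simp only [Z]; omega
  -- One round: the block `w` is drawn, whatever the previous one was.
  have hround : ∀ r v w, v ≤ 2 * M x → r ≤ 2 * M x → w < 2 ^ L →
      ∃ t ≤ pr.eval (Z x) + (sz (M x) + 1) * pb.eval (Z x) + 1,
        Run (.comp cb cr) (enc ((x, M x), (r, v))) (bits L w)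
          (enc ((x, M x), (2 ^ L, w))) t := by
    intro r v w hv hr' hw
    obtain ⟨t₁, ht₁, r₁⟩ := hr ((x, M x), (r, v)) (Z x) (hsz r v hv hr')
    obtain ⟨t₂, ht₂, r₂⟩ := hb x (M x) (Z x) le_rfl L w 1 0 hw (by omega)
      (fun i hi => by simpa using hlow i hi) (by simpa using hle) (by simpa using hlt.le)
    rw [one_mul, zero_mul, zero_add] at r₂
    have := Nat.mul_le_mul_right (pb.eval (Z x)) hLsz
    exact ⟨t₁ + t₂ + 1, by omega, .comp r₁ r₂⟩
  have hloop : ∀ (bs : List ℕ) (r v₀ v : ℕ), M x ≤ v₀ → v₀ ≤ 2 * M x → r ≤ 2 * M x →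
      (∀ a ∈ bs, M x ≤ a ∧ a < 2 ^ L) → v < M x →
      ∃ t ≤ (bs.length + 1) * τ x + pt.eval (Z x) + 1,
        Run (.loop ct (.comp cb cr)) (enc ((x, M x), (r, v₀)))
          ((bs.map (bits L)).flatten ++ bits L v) (enc ((x, M x), (2 ^ L, v))) t := by
    intro bs
    induction bs with
    | nil =>
      intro r v₀ v h₁ h₂ h₃ _ hv
      obtain ⟨t₁, ht₁, r₁⟩ := ht ((x, M x), (r, v₀)) (Z x) (hsz _ _ h₂ h₃)
      obtain ⟨t₂, ht₂, r₂⟩ := hround r v₀ v h₂ h₃ (by omega)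
      obtain ⟨t₃, ht₃, r₃⟩ := ht ((x, M x), (2 ^ L, v)) (Z x) (hsz _ _ (by omega) hlt.le)
      rw [show Nat.ble (M x) v₀ = true by simpa using h₁] at r₁
      rw [show Nat.ble (M x) v = false by
        rw [← Bool.not_eq_true, Nat.ble_eq]; omega] at r₃
      refine ⟨t₁ + t₂ + (t₃ + 1) + 1, ?_, ?_⟩
      · simp only [List.length_nil, zero_add, one_mul, τ]; omega
      · simpa using Run.loop_step r₁ (by simp [enc]) r₂ (.loop_done r₃)
    | cons b bs ih =>
      intro r v₀ v h₁ h₂ h₃ hbs hv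
      have hb := hbs b List.mem_cons_self
      obtain ⟨t₁, ht₁, r₁⟩ := ht ((x, M x), (r, v₀)) (Z x) (hsz _ _ h₂ h₃)
      obtain ⟨t₂, ht₂, r₂⟩ := hround r v₀ b h₂ h₃ hb.2
      obtain ⟨t₃, ht₃, r₃⟩ := ih (2 ^ L) b v hb.1 (by omega) hlt.le
        (fun a ha => hbs a (List.mem_cons_of_mem _ ha)) hv
      rw [show Nat.ble (M x) v₀ = true by simpa using h₁] at r₁
      refine ⟨t₁ + t₂ + t₃ + 1, ?_, ?_⟩
      · rw [List.length_cons, Nat.succ_mul]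
        simp only [τ] at ht₃ ⊢; omega
      · simpa using Run.loop_step r₁ (by simp [enc]) r₂ r₃
  refine ⟨hpos x, hle, hlt, fun bs v hbs hv => ?_⟩
  obtain ⟨t₁, ht₁, r₁⟩ := hi x (Z x) (by simp only [Z, sz_pair]; omega)
  obtain ⟨t₂, ht₂, r₂⟩ := hloop bs 0 (M x) v le_rfl (by omega) (Nat.zero_le _) hbs hv
  obtain ⟨t₃, ht₃, r₃⟩ := ho ((x, M x), (2 ^ L, v)) (Z x) (hsz _ _ (by omega) hlt.le)
  have hrun := Run.comp (.prim (.const (enc x)) (.nat 0)) (.comp (.comp r₁ r₂) r₃)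
  simp only [List.nil_append, List.append_nil] at hrun
  refine ⟨_, ?_, hrun⟩
  beta_reduce
  have hcost : Prim.cost (.const (enc x)) (.nat 0) = 1 + sz x := by
    simp [Prim.cost, Prim.apply, Val.size, sz]
  rw [hcost]
  rw [Nat.succ_mul] at ht₂ ⊢
  have : bs.length * τ x ≤
      bs.length * (2 * τ x + pt.eval (Z x) + (sz x + 2 + pi.eval (Z x) + po.eval (Z x) + 5)) :=
    Nat.mul_le_mul_left _ (by omega)
  omega

end sampler
/-! ### The feasibility test and the sampler -/

theorem sum_range_mul_div (k c : ℕ) (f : ℕ → ℕ) :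
    ∑ v ∈ Finset.range (k * c), f (v / c) = c * ∑ i ∈ Finset.range k, f i := by
  rcases Nat.eq_zero_or_pos c with rfl | hc
  · simp
  induction k with
  | zero => simp
  | succ k ih =>
    have h : ∀ x ∈ Finset.range c, f ((k * c + x) / c) = f k := by
      intro x hx
      rw [mul_comm, Nat.mul_add_div hc, Nat.div_eq_of_lt (Finset.mem_range.1 hx), add_zero]
    rw [Nat.succ_mul, Finset.sum_range_add, ih, Finset.sum_congr rfl h, Finset.sum_range_succ]
    simp [mul_add]

/-- A function on `{0, …, N - 1}` whose values include a set of `N` elements takes every value in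
this set once, and no other value. -/
theorem sum_range_eq_of_surjOn {X : Type} [DecidableEq X] (W : Finset X) (f : ℕ → X)
    (h : ∀ w ∈ W, ∃ i < W.card, f i = w) (y : X) :
    ∑ i ∈ Finset.range W.card, (if f i = y then 1 else 0) = if y ∈ W then 1 else 0 := by
  have hsub : W ⊆ (Finset.range W.card).image f := by
    intro w hw
    obtain ⟨i, hi, rfl⟩ := h w hw
    exact Finset.mem_image_of_mem f (Finset.mem_range.2 hi)
  have hcard : ((Finset.range W.card).image f).card ≤ W.card :=
    Finset.card_image_le.trans (by simp)
  have himg := Finset.eq_of_subset_of_card_le hsub hcard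
  have hinj : Set.InjOn f (Finset.range W.card) := by
    rw [← Finset.card_image_iff, ← himg, Finset.card_range]
  rw [Finset.sum_boole, Nat.cast_id]
  split_ifs with hy
  · rw [himg] at hy
    obtain ⟨i, hi, rfl⟩ := Finset.mem_image.1 hy
    rw [Finset.card_eq_one]
    refine ⟨i, Finset.ext fun j => ?_⟩
    rw [Finset.mem_filter, Finset.mem_singleton]
    exact ⟨fun hj => hinj (by simpa using hj.1) (by simpa using hi) hj.2,
      by rintro rfl; exact ⟨hi, rfl⟩⟩
  · rw [Finset.card_eq_zero, Finset.filter_eq_empty_iff]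
    rintro i hi rfl
    exact hy (himg ▸ Finset.mem_image_of_mem f hi)

namespace Inst

/-- The number of accepted, or rejected, improvisations. -/
noncomputable def total (C : Inst) (b : Bool) : ℕ := C.countWords b.toNat []

/-- The word with index `i` among the accepted, or rejected, improvisations. -/
noncomputable def nthWord (C : Inst) (b : Bool) (i : ℕ) : List ℕ :=
  unrank (C.countWords b.toNat) (List.range C.alphabet) (List.range (C.n + 1)) i

/-- The feasibility test: with `a` accepted and `b` rejected improvisations, it checks that
`1 ≤ hi * (a + b)`, `lo * (a + b) ≤ 1`, `1 - ε ≤ hi * a` and `lo * b ≤ ε`, after multiplication by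
the denominators; the subtraction is not truncated because `ε ≤ 1`. -/
noncomputable def feasibleTest (C : Inst) : Bool :=
  Nat.ble (ratDen C.hi) (ratNum C.hi * (C.total true + C.total false)) &&
  Nat.ble (ratNum C.lo * (C.total true + C.total false)) (ratDen C.lo) &&
  Nat.ble ((ratDen C.ε - ratNum C.ε) * ratDen C.hi)
    (ratNum C.hi * C.total true * ratDen C.ε) &&
  Nat.ble (ratNum C.lo * C.total false * ratDen C.ε)
    (ratNum C.ε * ratDen C.lo)

/-- Numerator and denominator of `min (hi * a) (1 - lo * b)`, the probability with which an accepted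
improvisation is chosen. The subtraction is not truncated if the feasibility test succeeds. -/
noncomputable def weight (C : Inst) : ℕ × ℕ :=
  bif Nat.ble (ratNum C.hi * C.total true * ratDen C.lo)
      ((ratDen C.lo - ratNum C.lo * C.total false) * ratDen C.hi)
    then (ratNum C.hi * C.total true, ratDen C.hi)
    else (ratDen C.lo - ratNum C.lo * C.total false, ratDen C.lo)

/-- The number of accepted, or rejected, improvisations, or `1` if there is none. -/
noncomputable def total' (C : Inst) (b : Bool) : ℕ := C.total b + (1 - C.total b)

/-- The size of the range from which a random number is drawn. -/
noncomputable def sampleRange (C : Inst) : ℕ := C.weight.2 * C.total' true * C.total' false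

/-- The improvisation for a random number below `sampleRange`. -/
noncomputable def sampleWord (C : Inst) (v : ℕ) : List ℕ :=
  bif Nat.ble (C.total' true * (C.weight.1 * C.total' false)) v then
    C.nthWord false ((v - C.total' true * (C.weight.1 * C.total' false)) /
      ((C.weight.2 - C.weight.1) * C.total' true))
  else C.nthWord true (v / (C.weight.1 * C.total' false))

end Inst

namespace PolyTime
variable {γ : Type} [Enc γ] {c : γ → Inst}

@[fun_prop] theorem total (h : PolyTime c) (b : Bool) : PolyTime fun x => (c x).total b := by
  unfold Inst.total; fun_prop

@[fun_prop] theorem total' (h : PolyTime c) (b : Bool) : PolyTime fun x => (c x).total' b := by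
  unfold Inst.total'; fun_prop

@[fun_prop] theorem nthWord {i : γ → ℕ} (h : PolyTime c) (b : Bool) (hi : PolyTime i) :
    PolyTime fun x => (c x).nthWord b (i x) :=
  unrank (c := fun x => (c x).countWords b.toNat) (by fun_prop) (by fun_prop) (by fun_prop) hi

@[fun_prop] theorem feasibleTest (h : PolyTime c) : PolyTime fun x => (c x).feasibleTest := by
  unfold Inst.feasibleTest; fun_prop

@[fun_prop] theorem weight (h : PolyTime c) : PolyTime fun x => (c x).weight := by
  unfold Inst.weight; fun_prop

@[fun_prop] theorem sampleRange (h : PolyTime c) : PolyTime fun x => (c x).sampleRange := by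
  unfold Inst.sampleRange; fun_prop

@[fun_prop] theorem sampleWord {v : γ → ℕ} (h : PolyTime c) (hv : PolyTime v) :
    PolyTime fun x => (c x).sampleWord (v x) := by
  unfold Inst.sampleWord; fun_prop

end PolyTime

namespace Inst
variable (C : Inst)

theorem total_eq (b : Bool) : C.total b = (C.words b).card := by
  rw [total, countWords_eq]; simp

theorem sum_nthWord (b : Bool) (w : List (Fin C.alphabet)) :
    ∑ i ∈ Finset.range (C.total b), (if C.nthWord b i = w.map (↑) then 1 else 0) =
      if w ∈ C.words b then 1 else 0 := by
  classical
  have hinj : Function.Injective (List.map ((↑) : Fin C.alphabet → ℕ)) :=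
    Fin.val_injective.list_map
  let W : Finset (List ℕ) := (C.words b).image (List.map (↑))
  have hW : W.card = C.total b := by rw [total_eq, Finset.card_image_of_injective _ hinj]
  have key := sum_range_eq_of_surjOn W (C.nthWord b) (fun w hw => ?_) (w.map (↑))
  · rw [hW] at key
    rw [key]
    simp only [W, Finset.mem_image, hinj.eq_iff, exists_eq_right]
  · refine exists_unrank_eq W List.nodup_range ?_ ?_ _ hw ?_
    · intro w hw a ha
      obtain ⟨w', -, rfl⟩ := Finset.mem_image.1 hw
      obtain ⟨a', -, rfl⟩ := List.mem_map.1 ha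
      simp
    · intro u
      rw [countWords_eq, Finset.filter_image, Finset.card_image_of_injective _ hinj]
    · obtain ⟨w', hw', rfl⟩ := Finset.mem_image.1 hw
      have := (C.mem_words.1 hw').1.2.2
      simpa using this.trans (Nat.le_succ _)

theorem total'_pos (b : Bool) : 0 < C.total' b := by unfold total'; omega

theorem weight_snd_pos : 0 < C.weight.2 := by
  unfold weight
  cases Nat.ble _ _ <;> exact Rat.den_pos _

theorem sampleRange_pos : 0 < C.sampleRange :=
  Nat.mul_pos (Nat.mul_pos C.weight_snd_pos (C.total'_pos _)) (C.total'_pos _)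

theorem cast_eq_ratNum_div {x : ℚ} (hx : 0 ≤ x) : (x : ℝ) = ratNum x / ratDen x := by
  have h₁ : ((x.num.natAbs : ℤ) : ℝ) = (x.num : ℝ) := by
    rw [Int.natAbs_of_nonneg (Rat.num_nonneg.2 hx)]
  rw [ratNum, ratDen, Rat.cast_def, ← h₁, Int.cast_natCast]

/-- The inequalities checked by the feasibility test. -/
structure Bounds : Prop where
  one_le : 1 ≤ (C.hi : ℝ) * (C.total true + C.total false)
  le_one : (C.lo : ℝ) * (C.total true + C.total false) ≤ 1
  soft_hi : 1 - (C.ε : ℝ) ≤ C.hi * C.total true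
  soft_lo : (C.lo : ℝ) * C.total false ≤ C.ε

theorem feasibleTest_iff : C.feasibleTest = true ↔ C.Bounds := by
  have pe : (0 : ℝ) < ratDen C.ε := by exact_mod_cast Rat.den_pos C.ε
  have pl : (0 : ℝ) < ratDen C.lo := by exact_mod_cast Rat.den_pos C.lo
  have ph : (0 : ℝ) < ratDen C.hi := by exact_mod_cast Rat.den_pos C.hi
  have he := cast_eq_ratNum_div C.ε_mem.1
  have hl := cast_eq_ratNum_div C.lo_mem.1
  have hh := cast_eq_ratNum_div C.hi_mem.1
  have hε : ratNum C.ε ≤ ratDen C.ε := by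
    have h : (C.ε : ℝ) ≤ 1 := by exact_mod_cast C.ε_mem.2
    rw [he, div_le_one pe] at h
    exact_mod_cast h
  simp only [feasibleTest, Bool.and_eq_true, Nat.ble_eq]
  rw [← Nat.cast_le (α := ℝ), ← Nat.cast_le (α := ℝ), ← Nat.cast_le (α := ℝ),
    ← Nat.cast_le (α := ℝ)]
  push_cast [Nat.cast_sub hε]
  have e₁ : (ratDen C.hi : ℝ) ≤ ratNum C.hi * (C.total true + C.total false) ↔
      1 ≤ (C.hi : ℝ) * (C.total true + C.total false) := by
    rw [hh, div_mul_eq_mul_div, le_div_iff₀ ph, one_mul]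
  have e₂ : (ratNum C.lo : ℝ) * (C.total true + C.total false) ≤ ratDen C.lo ↔
      (C.lo : ℝ) * (C.total true + C.total false) ≤ 1 := by
    rw [hl, div_mul_eq_mul_div, div_le_one pl]
  have e₃ : ((ratDen C.ε : ℝ) - ratNum C.ε) * ratDen C.hi ≤
      ratNum C.hi * C.total true * ratDen C.ε ↔ 1 - (C.ε : ℝ) ≤ C.hi * C.total true := by
    rw [he, hh, div_mul_eq_mul_div, one_sub_div pe.ne', div_le_div_iff₀ pe ph]
  have e₄ : (ratNum C.lo : ℝ) * C.total false * ratDen C.ε ≤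
      ratNum C.ε * ratDen C.lo ↔ (C.lo : ℝ) * C.total false ≤ C.ε := by
    rw [he, hl, div_mul_eq_mul_div, div_le_div_iff₀ pl pe]
  rw [e₁, e₂, e₃, e₄]
  exact ⟨fun ⟨⟨⟨h₁, h₂⟩, h₃⟩, h₄⟩ => ⟨h₁, h₂, h₃, h₄⟩, fun ⟨h₁, h₂, h₃, h₄⟩ => ⟨⟨⟨h₁, h₂⟩, h₃⟩, h₄⟩⟩

theorem improvisations_eq [DecidableEq (List (Fin C.alphabet))] :
    (C.improvisations : Set (List (Fin C.alphabet))) = ↑(C.words true ∪ C.words false) := by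
  ext w
  rw [Finset.mem_coe, Finset.mem_union, mem_words, mem_words]
  by_cases h : w ∈ C.dfa.accepts <;> simp [h]

theorem admissible_eq : (C.admissible : Set (List (Fin C.alphabet))) = ↑(C.words true) := by
  ext w
  rw [Finset.mem_coe, mem_words]
  exact ⟨fun h => ⟨h.1, iff_of_true h.2 rfl⟩, fun h => ⟨h.1, h.2.2 rfl⟩⟩

theorem disjoint_words : Disjoint (C.words true) (C.words false) := by
  rw [Finset.disjoint_left]
  intro w h₁ h₂
  have h₃ := (C.mem_words.1 h₁).2
  have h₄ := (C.mem_words.1 h₂).2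
  rw [h₃] at h₄; simp at h₄

/-- The inequalities are obtained by summing the values of an improvising distribution over the
accepted and over the rejected improvisations. -/
theorem bounds_of_feasible (h : C.Feasible) : C.Bounds := by
  classical
  obtain ⟨D, h₁, h₂, h₃⟩ := h
  have hne : ∀ (s : Finset (List (Fin C.alphabet))), ∀ w ∈ s, D w ≠ ⊤ :=
    fun s w _ => D.apply_ne_top w
  have hI : ∑ w ∈ C.words true, (D w).toReal + ∑ w ∈ C.words false, (D w).toReal = 1 := by
    rw [← Finset.sum_union C.disjoint_words, ← ENNReal.toReal_sum (hne _),
      ← PMF.toOuterMeasure_apply_finset, ← C.improvisations_eq, h₁, ENNReal.toReal_one]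
  have hA : 1 - (C.ε : ℝ) ≤ ∑ w ∈ C.words true, (D w).toReal := by
    rw [← ENNReal.toReal_sum (hne _), ← PMF.toOuterMeasure_apply_finset, ← C.admissible_eq]
    exact h₂
  have hlo : ∀ b, (C.lo : ℝ) * C.total b ≤ ∑ w ∈ C.words b, (D w).toReal := by
    intro b
    have := Finset.card_nsmul_le_sum (C.words b) (fun w => (D w).toReal) C.lo
      fun w hw => (h₃ w (C.mem_words.1 hw).1).1
    rwa [nsmul_eq_mul, ← total_eq, mul_comm] at this
  have hhi : ∀ b, ∑ w ∈ C.words b, (D w).toReal ≤ (C.hi : ℝ) * C.total b := by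
    intro b
    have := Finset.sum_le_card_nsmul (C.words b) (fun w => (D w).toReal) C.hi
      fun w hw => (h₃ w (C.mem_words.1 hw).1).2
    rwa [nsmul_eq_mul, ← total_eq, mul_comm] at this
  have a₁ := hlo true
  have a₂ := hlo false
  have a₃ := hhi true
  have a₄ := hhi false
  constructor <;> linarith

variable {C}

theorem weight_eq (h : C.Bounds) :
    (C.weight.1 : ℝ) / C.weight.2 =
      min ((C.hi : ℝ) * C.total true) (1 - (C.lo : ℝ) * C.total false) := by
  have pl : (0 : ℝ) < ratDen C.lo := by exact_mod_cast Rat.den_pos C.lo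
  have ph : (0 : ℝ) < ratDen C.hi := by exact_mod_cast Rat.den_pos C.hi
  have hl := cast_eq_ratNum_div C.lo_mem.1
  have hh := cast_eq_ratNum_div C.hi_mem.1
  have hlb : ratNum C.lo * C.total false ≤ ratDen C.lo := by
    have h₁ := h.le_one
    have h₂ : (0 : ℝ) ≤ C.lo * C.total true :=
      mul_nonneg (by exact_mod_cast C.lo_mem.1) (Nat.cast_nonneg _)
    have h₃ : (C.lo : ℝ) * C.total false ≤ 1 := by linarith
    rw [hl, div_mul_eq_mul_div, div_le_one pl] at h₃
    exact_mod_cast h₃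
  have e₁ : ((ratNum C.hi * C.total true : ℕ) : ℝ) / ratDen C.hi =
      C.hi * C.total true := by
    rw [hh]; push_cast; ring
  have e₂ : ((ratDen C.lo - ratNum C.lo * C.total false : ℕ) : ℝ) / ratDen C.lo =
      1 - C.lo * C.total false := by
    rw [hl, Nat.cast_sub hlb]; push_cast; field_simp
  rw [← e₁, ← e₂]
  unfold weight
  cases hc : Nat.ble _ _
  · rw [← Bool.not_eq_true, Nat.ble_eq, not_le] at hc
    rw [min_eq_right]
    · rfl
    · rw [div_le_div_iff₀ pl ph]; exact_mod_cast hc.le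
  · rw [Nat.ble_eq] at hc
    rw [min_eq_left]
    · rfl
    · rw [div_le_div_iff₀ ph pl]; exact_mod_cast hc

/-- If there are no accepted (rejected) improvisations, then the weight of this kind of words is
`0`, so that it does no harm that `total'` differs from `total`. -/
theorem weight_spec (h : C.Bounds) : C.weight.1 ≤ C.weight.2 ∧
    C.total true * C.weight.1 = C.total' true * C.weight.1 ∧
    C.total false * (C.weight.2 - C.weight.1) = C.total' false * (C.weight.2 - C.weight.1) := by
  have hd : (0 : ℝ) < C.weight.2 := by exact_mod_cast C.weight_snd_pos
  have hw := weight_eq h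
  have hl : (0 : ℝ) ≤ C.lo := by exact_mod_cast C.lo_mem.1
  have h₁ : C.weight.1 ≤ C.weight.2 := by
    have : (C.weight.1 : ℝ) / C.weight.2 ≤ 1 := by
      rw [hw]
      refine (min_le_right _ _).trans ?_
      have : (0 : ℝ) ≤ C.lo * C.total false := mul_nonneg hl (Nat.cast_nonneg _)
      linarith
    rw [div_le_one hd] at this
    exact_mod_cast this
  refine ⟨h₁, ?_, ?_⟩
  · rcases Nat.eq_zero_or_pos (C.total true) with h0 | h0
    · have : (C.weight.1 : ℝ) / C.weight.2 ≤ 0 := by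
        rw [hw, h0]; simp
      have h₂ : (C.weight.1 : ℝ) ≤ 0 := by
        rwa [div_le_iff₀ hd, zero_mul] at this
      have h₃ : C.weight.1 = 0 := by exact_mod_cast h₂.antisymm (Nat.cast_nonneg _)
      simp [h₃]
    · unfold total'; rw [show 1 - C.total true = 0 by omega, add_zero]
  · rcases Nat.eq_zero_or_pos (C.total false) with h0 | h0
    · have h₂ := h.one_le
      have : 1 ≤ (C.weight.1 : ℝ) / C.weight.2 := by
        rw [hw, h0] at *
        refine le_min (by simpa [h0] using h₂) (by simp)
      rw [le_div_iff₀ hd, one_mul] at this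
      have h₃ : C.weight.2 ≤ C.weight.1 := by exact_mod_cast this
      simp [Nat.sub_eq_zero_of_le h₃]
    · unfold total'; rw [show 1 - C.total false = 0 by omega, add_zero]

/-- The number of random numbers that yield an improvisation. -/
noncomputable def multiplicity (C : Inst) (w : List (Fin C.alphabet)) : ℕ := by
  classical exact
  (if w ∈ C.words true then C.weight.1 * C.total' false else 0) +
    if w ∈ C.words false then (C.weight.2 - C.weight.1) * C.total' true else 0

/-- The number of `v < C.sampleRange` with `C.sampleWord v = w` is `C.multiplicity w`: the range
consists of `total' b` intervals of equal length for either kind `b` of words, one for each word. -/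
theorem sum_sampleWord (h : C.Bounds) (w : List (Fin C.alphabet)) :
    ∑ v ∈ Finset.range C.sampleRange, (if C.sampleWord v = w.map (↑) then 1 else 0) =
      C.multiplicity w := by
  obtain ⟨h₁, h₂, h₃⟩ := weight_spec h
  have hM : C.sampleRange = C.total' true * (C.weight.1 * C.total' false) +
      C.total' false * ((C.weight.2 - C.weight.1) * C.total' true) := by
    obtain ⟨e, he⟩ := Nat.exists_eq_add_of_le h₁
    rw [sampleRange, he, Nat.add_sub_cancel_left]; ring
  -- A range of random numbers contributes nothing if there is no word of its kind.
  have hpart : ∀ (b : Bool) (k : ℕ), (C.total b ≠ C.total' b → k = 0) →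
      ∑ v ∈ Finset.range (C.total' b * k),
        (if C.nthWord b (v / k) = w.map (↑) then 1 else 0) = if w ∈ C.words b then k else 0 := by
    intro b k hk
    rw [sum_range_mul_div _ _ fun i => if C.nthWord b i = w.map (↑) then 1 else 0]
    by_cases hb : C.total b = C.total' b
    · rw [← hb, sum_nthWord]; simp
    · simp [hk hb]
  rw [hM, Finset.sum_range_add, multiplicity]
  congr 1
  · rw [← hpart true]
    · refine Finset.sum_congr rfl fun v hv => ?_
      rw [sampleWord, show Nat.ble (C.total' true * (C.weight.1 * C.total' false)) v = false by
        rw [← Bool.not_eq_true, Nat.ble_eq, not_le]; exact Finset.mem_range.1 hv]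
      rfl
    · intro hne
      have : C.weight.1 = 0 := by
        by_contra h0
        exact hne (Nat.eq_of_mul_eq_mul_right (Nat.pos_of_ne_zero h0) h₂)
      rw [this, zero_mul]
  · rw [← hpart false]
    · refine Finset.sum_congr rfl fun v hv => ?_
      rw [sampleWord, show Nat.ble (C.total' true * (C.weight.1 * C.total' false))
        (C.total' true * (C.weight.1 * C.total' false) + v) = true by simp,
        Nat.add_sub_cancel_left]
      rfl
    · intro hne
      have : C.weight.2 - C.weight.1 = 0 := by
        by_contra h0
        exact hne (Nat.eq_of_mul_eq_mul_right (Nat.pos_of_ne_zero h0) h₃)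
      rw [this, zero_mul]

theorem multiplicity_true {w : List (Fin C.alphabet)} (hw : w ∈ C.words true) :
    C.multiplicity w = C.weight.1 * C.total' false := by
  rw [multiplicity, if_pos hw, if_neg (Finset.disjoint_left.1 C.disjoint_words hw), add_zero]

theorem multiplicity_false {w : List (Fin C.alphabet)} (hw : w ∈ C.words false) :
    C.multiplicity w = (C.weight.2 - C.weight.1) * C.total' true := by
  rw [multiplicity, if_pos hw, if_neg (Finset.disjoint_right.1 C.disjoint_words hw), zero_add]

theorem sum_multiplicity_true (h : C.Bounds) :
    ∑ w ∈ C.words true, C.multiplicity w = C.weight.1 * (C.total' true * C.total' false) := by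
  rw [Finset.sum_congr rfl fun w hw => multiplicity_true hw, Finset.sum_const, ← total_eq,
    smul_eq_mul, ← mul_assoc, (weight_spec h).2.1]
  ring

theorem sum_multiplicity (h : C.Bounds) [DecidableEq (List (Fin C.alphabet))] :
    ∑ w ∈ C.words true ∪ C.words false, C.multiplicity w = C.sampleRange := by
  obtain ⟨h₁, -, h₃⟩ := weight_spec h
  rw [Finset.sum_union C.disjoint_words, sum_multiplicity_true h,
    Finset.sum_congr rfl fun w hw => multiplicity_false hw, Finset.sum_const, ← total_eq,
    smul_eq_mul, ← mul_assoc (C.total false), h₃, sampleRange]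
  obtain ⟨e, he⟩ := Nat.exists_eq_add_of_le h₁
  rw [he, Nat.add_sub_cancel_left]; ring

open scoped Classical in
/-- The distribution of the sampled words. -/
noncomputable def distribution (h : C.Bounds) : PMF (List (Fin C.alphabet)) :=
  PMF.ofFinset (fun w => (C.multiplicity w : ℝ≥0∞) / C.sampleRange)
    (C.words true ∪ C.words false)
    (by
      have h₁ := C.sampleRange_pos.ne'
      simp only [div_eq_mul_inv]
      rw [← Finset.sum_mul, ← Nat.cast_sum, sum_multiplicity h]
      exact ENNReal.mul_inv_cancel (by simpa using h₁) (by simp))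
    (fun w hw => by
      rw [Finset.mem_union, not_or] at hw
      simp [multiplicity, hw.1, hw.2])

theorem distribution_apply (h : C.Bounds) (w : List (Fin C.alphabet)) :
    distribution h w = (C.multiplicity w : ℝ≥0∞) / C.sampleRange := rfl

/-- An accepted improvisation has probability `w / a` and a rejected one `(1 - w) / b`, where
`w = min (hi * a) (1 - lo * b)`; this choice of `w` is the largest one that respects the upper bound
for accepted and the lower bound for rejected improvisations. -/
theorem isImprovising_distribution (h : C.Bounds) : C.IsImprovising (distribution h) := by
  classical
  obtain ⟨hle, h₂, h₃⟩ := weight_spec h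
  have hw := weight_eq h
  have hd : (0 : ℝ) < C.weight.2 := by exact_mod_cast C.weight_snd_pos
  have pa : (0 : ℝ) < C.total' true := by exact_mod_cast C.total'_pos true
  have pb : (0 : ℝ) < C.total' false := by exact_mod_cast C.total'_pos false
  have hl : (0 : ℝ) ≤ C.lo := by exact_mod_cast C.lo_mem.1
  have hh : (0 : ℝ) ≤ C.hi := by exact_mod_cast C.hi_mem.1
  obtain ⟨b₁, b₂, b₃, b₄⟩ := h
  set a : ℝ := (C.total true : ℝ) with ha
  set b : ℝ := (C.total false : ℝ) with hb
  have ha0 : 0 ≤ a := Nat.cast_nonneg _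
  have hb0 : 0 ≤ b := Nat.cast_nonneg _
  have hlh : (C.lo : ℝ) * a ≤ C.hi * a := by
    have : (C.lo : ℝ) ≤ C.hi := by
      by_contra hlt
      push Not at hlt
      rcases (add_nonneg ha0 hb0).eq_or_lt with h0 | h0
      · rw [← h0, mul_zero] at b₁; linarith
      · have := mul_lt_mul_of_pos_right hlt h0; linarith
    exact mul_le_mul_of_nonneg_right this ha0
  have hval : ∀ w, ((distribution ⟨b₁, b₂, b₃, b₄⟩) w).toReal =
      (C.multiplicity w : ℝ) / C.sampleRange := by
    intro w
    rw [distribution_apply, ENNReal.toReal_div, ENNReal.toReal_natCast, ENNReal.toReal_natCast]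
  have hM : (C.sampleRange : ℝ) = C.weight.2 * C.total' true * C.total' false := by
    rw [sampleRange]; push_cast; ring
  have hmin₁ : (C.weight.1 : ℝ) / C.weight.2 ≤ C.hi * a := hw ▸ min_le_left _ _
  have hmin₂ : (C.weight.1 : ℝ) / C.weight.2 ≤ 1 - C.lo * b := hw ▸ min_le_right _ _
  have hmin₃ : ∀ x : ℝ, x ≤ C.hi * a → x ≤ 1 - C.lo * b → x ≤ (C.weight.1 : ℝ) / C.weight.2 :=
    fun x h₁ h₂ => hw ▸ le_min h₁ h₂
  refine ⟨?_, ?_, ?_⟩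
  · rw [PMF.toOuterMeasure_apply_eq_one_iff, improvisations_eq]
    intro w hw
    by_contra hn
    rw [PMF.mem_support_iff] at hw
    rw [Finset.mem_coe, Finset.mem_union, not_or] at hn
    exact hw (by rw [distribution_apply]; simp [multiplicity, hn.1, hn.2])
  · rw [admissible_eq, PMF.toOuterMeasure_apply_finset,
      ENNReal.toReal_sum fun w _ => PMF.apply_ne_top _ w]
    simp only [hval]
    rw [← Finset.sum_div, ← Nat.cast_sum, sum_multiplicity_true ⟨b₁, b₂, b₃, b₄⟩, hM]
    have : ((C.weight.1 * (C.total' true * C.total' false) : ℕ) : ℝ) /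
        (C.weight.2 * C.total' true * C.total' false) = (C.weight.1 : ℝ) / C.weight.2 := by
      push_cast; field_simp
    rw [this]
    exact hmin₃ _ b₃ (by linarith)
  · intro w hw
    rw [hval]
    rw [improvisations_eq, Finset.mem_coe, Finset.mem_union] at hw
    rcases hw with hw | hw
    · have hpos : 0 < C.total true := by
        rw [total_eq]; exact Finset.card_pos.2 ⟨w, hw⟩
      have ht : C.total' true = C.total true := by unfold total'; omega
      have ha1 : 0 < a := Nat.cast_pos.2 hpos
      have : (C.multiplicity w : ℝ) / C.sampleRange = (C.weight.1 : ℝ) / C.weight.2 / a := by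
        rw [multiplicity_true hw, hM, ht]; push_cast; rw [← ha]; field_simp
      rw [this, le_div_iff₀ ha1, div_le_iff₀ ha1]
      exact ⟨hmin₃ _ hlh (by linarith), hmin₁⟩
    · have hpos : 0 < C.total false := by
        rw [total_eq]; exact Finset.card_pos.2 ⟨w, hw⟩
      have ht : C.total' false = C.total false := by unfold total'; omega
      have hb1 : 0 < b := Nat.cast_pos.2 hpos
      have : (C.multiplicity w : ℝ) / C.sampleRange =
          (1 - (C.weight.1 : ℝ) / C.weight.2) / b := by
        rw [multiplicity_false hw, hM, ht, Nat.cast_mul, Nat.cast_sub hle, ← hb]; field_simp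
      rw [this, le_div_iff₀ hb1, div_le_iff₀ hb1]
      refine ⟨by linarith, ?_⟩
      have := hmin₃ (1 - C.hi * b) (by linarith) (by
        have : (C.lo : ℝ) * b ≤ C.hi * b := by
          refine mul_le_mul_of_nonneg_right ?_ hb0
          by_contra hlt
          push Not at hlt
          have := mul_lt_mul_of_pos_right hlt (by linarith : 0 < a + b)
          linarith
        linarith)
      linarith

theorem bounds_iff_feasible : C.Bounds ↔ C.Feasible :=
  ⟨fun h => ⟨_, isImprovising_distribution h⟩, C.bounds_of_feasible⟩

open scoped Classical in
theorem isImproviser_of_sampler (h : C.Bounds) {G : Code} {L T : ℕ}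
    (hG : IsRejectionSampler G (.nat 0) L C.sampleRange T fun v => enc (C.sampleWord v)) :
    C.IsImproviser G := by
  refine ⟨hG.expectedTime_le.trans_lt (ENNReal.natCast_lt_top _), distribution h,
    isImprovising_distribution h, fun w => ?_⟩
  have henc : ∀ l : List ℕ, enc l = C.encodeWord w ↔ l = List.map Fin.val w := by
    have hinj : ∀ l l' : List ℕ, enc l = enc l' → l = l' := by
      intro l
      induction l with
      | nil => intro l' h; cases l' <;> simp [enc, Val.ofList] at h ⊢
      | cons a l ih =>
        intro l' h
        cases l' with
        | nil => simp [enc, Val.ofList] at h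
        | cons b l' =>
          rw [enc_cons, enc_cons, Val.pair.injEq] at h
          rw [ih l' h.2, show a = b by simpa [enc] using h.1]
    have hw : C.encodeWord w = enc (List.map Fin.val w) := by
      simp only [Instance.encodeWord, enc]
      congr 1
      simp [← List.map_eq_flatMap, List.bind_eq_flatMap]
    intro l
    rw [hw]
    exact ⟨hinj _ _, fun h => h ▸ rfl⟩
  rw [hG.outProb_eq, distribution_apply, ← sum_sampleWord h, Finset.sum_boole]
  simp only [henc, Nat.cast_id]

end Inst

/-- The code of the program that ignores its argument and runs `G` on `x` can be computed from `x` in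
polynomial time. -/
theorem polyTime_encode {γ : Type} [Enc γ] (G : Code) :
    PolyTime fun x : γ => (Code.comp G (.prim (.const (enc x)))).encode :=
  PolyTime.of_enc_eq (f := fun x : γ => ((2 : ℕ), G.encode, (0 : ℕ), (1 : ℕ), x)) (by fun_prop)
    fun _ => rfl

end CI

/-- There is a polynomial-time improvisation scheme for the class of control improvisation instances
whose hard specification is an unambiguous context-free grammar and whose soft specification is a
deterministic finite automaton. -/
theorem theorem5p5 : ∃ A : CI.Code, CI.IsPolyTimeScheme CI.UCFG CI.DFAs A := by
  open CI in
  obtain ⟨G, T, ⟨q, hq⟩, hG⟩ := exists_rejectionSampler (γ := Inst) (M := Inst.sampleRange)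
    (out := fun p => p.1.sampleWord p.2) (by fun_prop) Inst.sampleRange_pos (by fun_prop)
  have hf : PolyTime fun C : Inst => bif C.feasibleTest
      then (Code.comp G (.prim (.const (Enc.enc C)))).encode else Val.nat 0 :=
    PolyTime.cond (by fun_prop) (polyTime_encode G) (by fun_prop)
  obtain ⟨A, u, ⟨p, hp⟩, hA⟩ := hf
  have htrue : ∀ C : Inst, C.Feasible → C.feasibleTest = true := fun C h =>
    C.feasibleTest_iff.2 (C.bounds_of_feasible h)
  have hfalse : ∀ C : Inst, ¬ C.Feasible → C.feasibleTest = false := fun C h => by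
    rw [← Bool.not_eq_true, Inst.feasibleTest_iff, Inst.bounds_iff_feasible]; exact h
  refine ⟨A, fun C hC => ?_, fun C hC => ?_, ⟨p, fun C y t h => ?_⟩, ⟨8 * q, fun C G' t h => ?_⟩⟩
  · obtain ⟨t, -, hr⟩ := hA C
    simp only [htrue C hC, cond_true] at hr
    exact ⟨_, t, hr, Inst.isImproviser_of_sampler (Inst.bounds_of_feasible C hC) (hG C)⟩
  · obtain ⟨t, -, hr⟩ := hA C
    simp only [hfalse C hC, cond_false] at hr
    exact ⟨t, hr⟩
  · obtain ⟨t', ht', hr⟩ := hA C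
    obtain ⟨-, -, rfl⟩ := Run.deterministic (r := []) (r' := []) h hr rfl
    exact ht'.trans (hp C)
  · obtain ⟨t', -, hr⟩ := hA C
    obtain ⟨-, hy, -⟩ := Run.deterministic (r := []) (r' := []) h hr rfl
    cases hc : Inst.feasibleTest C with
    | false =>
      simp only [hc, cond_false] at hy
      replace hy : G'.encode = Val.nat 0 := hy
      cases G' <;> simp [Code.encode] at hy
    | true =>
      simp only [hc, cond_true] at hy
      obtain rfl := Code.encode_injective hy
      refine (hG C).expectedTime_le.trans ?_
      have := hq C
      rw [Polynomial.eval_mul, Polynomial.eval_ofNat]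
      exact_mod_cast Nat.mul_le_mul_left 8 this
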